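/- **Conventions.** A generalized quantum circuit consists of gates from $\{\mathrm{CNOT},H,T\}$ on finitely many qubits; designated qubits carry the input, the others start in $|0\rangle$, and all but the designated output qubits are traced out at the end. Its size is the number of gates plus the number of input qubits (including those initialized to zero) plus the number of output qubits (including those traced out). A *QPT algorithm* is a family of circuits, indexed by $\lambda\in\mathbb N$, of size polynomial in $\lambda$; classical outputs are obtained by measuring the output qubits in the computational basis. A *non-uniform QPT adversary* is such a family in which some input qubits are in addition initialized to an arbitrary density matrix $\rho_\lambda$ (quantum advice). A function $\varepsilon:\mathbb N\to\mathbb R$ is negligible if $\lambda^d\varepsilon(\lambda)\to0$ for every $d\in\mathbb N$. "Polynomially bounded" means bounded by a polynomial. **QPRF.** A *selectively secure quantum pseudorandom function* $F:\{0,1\}^\lambda\times\{0,1\}^{m(\lambda)}\to\{0,1\}^{\ell(\lambda)}$ is a QPT algorithm, with classical input $(k,x)$ and randomized classical output $F(k,x)$, such that: * (*Pseudodeterminism*) there are a constant $c>0$ and a function $\mu(\lambda)=O(\lambda^{-c})$ such that for all $\lambda$ and all $x\in\{0,1\}^{m(\lambda)}$ there is a set $\mathcal K_{\lambda,x}\subseteq\{0,1\}^\lambda$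 with $\Pr_{k\gets\{0,1\}^\lambda}[k\in\mathcal K_{\lambda,x}]\ge1-\mu(\lambda)$ and $\max_{y}\Pr[F(k,x)=y]\ge1-\mu(\lambda)$ for all $k\in\mathcal K_{\lambda,x}$; * (*Selective security*) for every polynomially bounded $q:\mathbb N\to\mathbb N$, every non-uniform QPT distinguisher $A$ and every family of inputs $x_1,\dots,x_{q(\lambda)}\in\{0,1\}^{m(\lambda)}$ there is a negligible $\varepsilon$ such that, for every $\lambda$ for which $x_1,\dots,x_{q(\lambda)}$ are pairwise distinct, the probabilities that $A_\lambda(x_1,\dots,x_{q(\lambda)},y_1,\dots,y_{q(\lambda)})=1$ in the following two cases differ by at most $\varepsilon(\lambda)$: (i) $k\gets\{0,1\}^\lambda$ and $y_j\gets F(k,x_j)$ with fresh randomness for each $j$; (ii) $y_1,\dots,y_{q(\lambda)}$ are independent and uniform in $\{0,1\}^{\ell(\lambda)}$. **Construction.** Given such an $F$: * $\mathsf{Gen}(1^\lambda)$ outputs a uniform key $k=k_1\|\cdots\|k_\lambda\in\{0,1\}^{\lambda^2}$ with blocks $k_i\in\{0,1\}^\lambda$. * $\mathsf{Enc}(1^\lambda,k,msg)$,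 for $msg\in\{0,1\}^{\ell(\lambda)}$, picks $r\gets\{0,1\}^{m(\lambda)}$ uniformly, computes $y_i\gets F(k_i,r)$ for $i=1,\dots,\lambda$ and outputs $(r,\,msg\oplus y_1,\dots,msg\oplus y_\lambda)$. * $\mathsf{Dec}(1^\lambda,k,(r,c_1,\dots,c_\lambda))$ computes $y_i'\gets F(k_i,r)$ for $i=1,\dots,\lambda$ afresh and outputs the majority of the strings $c_1\oplus y_1',\dots,c_\lambda\oplus y_\lambda'$, i.e. the string that occurs more than $\lambda/2$ times, or $0^{\ell(\lambda)}$ if there is none. **Theorem.** Let $F:\{0,1\}^\lambda\times\{0,1\}^{m(\lambda)}\to\{0,1\}^{\ell(\lambda)}$ be a selectively secure quantum pseudorandom function with $m(\lambda)=\omega(\log\lambda)$. Then $(\mathsf{Gen},\mathsf{Enc},\mathsf{Dec})$ is a non-adaptive CPA-secure quantum private-key encryption scheme with classical ciphertexts, that is: 1. $\mathsf{Gen}$, $\mathsf{Enc}$ and $\mathsf{Dec}$ are QPT algorithms. 2. (*Correctness*) There is a negligible $\varepsilon$ such that for all $\lambda\in\mathbb N$ and all $msg\in\{0,1\}^{\ell(\lambda)}$,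 $$\Pr\big[\mathsf{Dec}(1^\lambda,k,\mathsf{Enc}(1^\lambda,k,msg))=msg\big]\ge1-\varepsilon(\lambda),$$ where the probability is over $k\gets\mathsf{Gen}(1^\lambda)$ and the randomness of $\mathsf{Enc}$ and $\mathsf{Dec}$. 3. (*Non-adaptive CPA security*) For every polynomially bounded $q:\mathbb N\to\mathbb N$ and every non-uniform QPT adversary $A$ there is a negligible $\varepsilon$ such that for all $\lambda\in\mathbb N$, $|\Pr[b'=b]-\tfrac12|\le\varepsilon(\lambda)$ in the following experiment: the challenger samples $k\gets\mathsf{Gen}(1^\lambda)$ and a uniform bit $b$; $A$ outputs classical message pairs $(m_1^0,m_1^1),\dots,(m_{q(\lambda)}^0,m_{q(\lambda)}^1)$ with all messages in $\{0,1\}^{\ell(\lambda)}$, keeping a quantum memory; $A$ receives $\mathsf{Enc}(1^\lambda,k,m_1^b),\dots,\mathsf{Enc}(1^\lambda,k,m_{q(\lambda)}^b)$; $A$ outputs a bit $b'$. -/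

import Mathlib

open Filter Asymptotics
open scoped ComplexOrder

noncomputable section

namespace QCrypto

/-! ### Bit registers and quantum states -/

/-- Assignments of bits to the positions of a register `I`, i.e. `{0,1}^I`. -/
abbrev Bits (I : Type) : Type := I → Bool

/-- Operators on the Hilbert space `(ℂ²)^{⊗ I}` of a register of qubits labelled by `I`. -/
abbrev Op (I : Type) : Type := Matrix (Bits I) (Bits I) ℂ

/-- Density matrices. -/
structure IsDensity {I : Type} [Fintype I] [DecidableEq I] (ρ : Op I) : Prop where
  posSemidef : ρ.PosSemidef
  trace_eq_one : ρ.trace = 1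

/-- The computational basis state `|x⟩⟨x|`. -/
def ket {I : Type} [Fintype I] (x : Bits I) : Op I :=
  Matrix.single x x 1

/-- The product state `ρ ⊗ σ` on the union of two registers. -/
def tensor {I J : Type} (ρ : Op I) (σ : Op J) : Op (I ⊕ J) :=
  Matrix.of fun u v => ρ (u ∘ Sum.inl) (v ∘ Sum.inl) * σ (u ∘ Sum.inr) (v ∘ Sum.inr)

/-- Probability of outcome `y` when all qubits are measured in the computational basis. -/
def measure {I : Type} (ρ : Op I) (y : Bits I) : ℝ := (ρ y y).re

/-- The unnormalised state of register `J` after register `I` has been measured in the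
computational basis with outcome `x`; its trace is the probability of that outcome. -/
def afterOutcome {I J : Type} (σ : Op (I ⊕ J)) (x : Bits I) : Op J :=
  Matrix.of fun u v => σ (Sum.elim x u) (Sum.elim x v)

/-! ### Generalized quantum circuits over the gate set `{CNOT, H, T}` -/

inductive Gate (W : Type) : Type
  | H (v : W) : Gate W
  | T (v : W) : Gate W
  | CNOT (control target : W) (ne : control ≠ target) : Gate W

/-- The unitary of a gate, acting on all wires `W` (as the identity on the untouched ones). -/
def Gate.unitary {W : Type} [Fintype W] [DecidableEq W] : Gate W → Op W
  | .H v => Matrix.of fun x y =>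
      if ∀ w, w ≠ v → x w = y w then
        (if x v = true ∧ y v = true then -1 else 1) / (Real.sqrt 2 : ℂ)
      else 0
  | .T v => Matrix.diagonal fun x =>
      if x v = true then Complex.exp (Complex.I * Real.pi / 4) else 1
  | .CNOT c t _ => Matrix.of fun x y =>
      if x = Function.update y t (xor (y t) (y c)) then 1 else 0

/-- A generalized quantum circuit with input register `I` and output register `O`. Wires that are
not input wires start in state zero; wires that are not output wires are traced out. -/
structure Circuit (I O : Type) where
  Wire : Type
  [fintypeWire : Fintype Wire]
  [decEqWire : DecidableEq Wire]
  gates : List (Gate Wire)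
  inp : I ↪ Wire
  out : O ↪ Wire

attribute [instance] Circuit.fintypeWire Circuit.decEqWire

namespace Circuit

variable {I O : Type} (C : Circuit I O)

/-- Number of gates, plus number of input qubits (including those initialized to zero), plus
number of output qubits (including those traced out). -/
def size : ℕ := C.gates.length + Fintype.card C.Wire + Fintype.card C.Wire

/-- The unitary part; the head of the list of gates is applied first. -/
def unitary : Op C.Wire := C.gates.foldl (fun U g => g.unitary * U) 1

open Classical in
/-- The input `ρ` placed on the input wires, all other wires being zero. -/
def load (ρ : Op I) : Op C.Wire :=
  Matrix.of fun u v =>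
    if ∀ w, w ∉ Set.range C.inp → u w = false ∧ v w = false then ρ (u ∘ C.inp) (v ∘ C.inp) else 0

open Classical in
/-- The partial trace over the wires that are not output wires. -/
def traceOut (σ : Op C.Wire) : Op O :=
  Matrix.of fun i j => ∑ u : Bits C.Wire, ∑ v : Bits C.Wire,
    if u ∘ C.out = i ∧ v ∘ C.out = j ∧ ∀ w, w ∉ Set.range C.out → u w = v w then σ u v else 0

/-- The quantum channel computed by the circuit. -/
def run (ρ : Op I) : Op O :=
  C.traceOut (C.unitary * C.load ρ * C.unitary.conjTranspose)

/-- Probability that the circuit, run on the classical input `x`, yields the classical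
output `y`. -/
def prob [Fintype I] (x : Bits I) (y : Bits O) : ℝ := measure (C.run (ket x)) y

end Circuit

/-! ### Efficiency and negligibility -/

def PolyBounded (f : ℕ → ℕ) : Prop := ∃ p : Polynomial ℕ, ∀ n, f n ≤ p.eval n

/-- Negligible functions: `n^d * ε n → 0` for every `d`. -/
def Negligible (ε : ℕ → ℝ) : Prop := SuperpolynomialDecay atTop (fun n : ℕ => (n : ℝ)) ε

/-- A randomized function family with classical inputs and outputs (`f n x y` being the probability
of output `y` on input `x`) is a QPT algorithm: it is the input-output behaviour of a family of
circuits of polynomial size. -/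
def IsQPT {I O : ℕ → Type} [∀ n, Fintype (I n)] (f : ∀ n, Bits (I n) → Bits (O n) → ℝ) : Prop :=
  ∃ C : ∀ n, Circuit (I n) (O n), PolyBounded (fun n => (C n).size) ∧
    ∀ n x y, (C n).prob x y = f n x y

/-- The probability of each single element of `{0,1}^I` under the uniform distribution. -/
def unif (I : Type) [Fintype I] : ℝ := ((2 : ℝ) ^ Fintype.card I)⁻¹

/-- Non-uniform QPT algorithms with classical input and one output bit: polynomial-size circuits
with quantum advice. -/
structure Distinguisher (I : ℕ → Type) where
  advLen : ℕ → ℕ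
  circuit : ∀ n, Circuit (Fin (advLen n) ⊕ I n) Unit
  advice : ∀ n, Op (Fin (advLen n))
  polySize : PolyBounded fun n => (circuit n).size
  isDensity : ∀ n, IsDensity (advice n)

/-- Probability that the distinguisher outputs `1` on input `x`. -/
def Distinguisher.accept {I : ℕ → Type} [∀ n, Fintype (I n)] (A : Distinguisher I) (n : ℕ)
    (x : Bits (I n)) : ℝ :=
  measure ((A.circuit n).run (tensor (A.advice n) (ket x))) fun _ => true

/-! ### Selectively secure quantum pseudorandom functions -/

/-- Families of randomized functions `{0,1}^n × {0,1}^{m n} → {0,1}^{ℓ n}`: `F n k x y` is the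
probability that `F(k, x)` outputs `y`. -/
abbrev KeyedFun (m ℓ : ℕ → ℕ) : Type :=
  ∀ n, Bits (Fin n) → Bits (Fin (m n)) → Bits (Fin (ℓ n)) → ℝ

namespace KeyedFun

variable {m ℓ : ℕ → ℕ} (F : KeyedFun m ℓ)

def QPT : Prop :=
  IsQPT (I := fun n => Fin n ⊕ Fin (m n)) (O := fun n => Fin (ℓ n))
    fun n z y => F n (z ∘ Sum.inl) (z ∘ Sum.inr) y

/-- Pseudodeterminism `1 - O(n^{-c})` for some constant `c > 0`. -/
def Pseudodeterministic : Prop :=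
  ∃ c : ℝ, 0 < c ∧ ∃ μ : ℕ → ℝ, (μ =O[atTop] fun n : ℕ => (n : ℝ) ^ (-c)) ∧
    ∀ n, ∀ x : Bits (Fin (m n)), ∃ good : Finset (Bits (Fin n)),
      1 - μ n ≤ good.card * unif (Fin n) ∧
      ∀ k ∈ good, ∃ y : Bits (Fin (ℓ n)), 1 - μ n ≤ F n k x y

variable {q : ℕ → ℕ}

/-- What the distinguisher sees: the list of inputs and the list of outputs. -/
abbrev ViewReg (m ℓ q : ℕ → ℕ) (n : ℕ) : Type :=
  (Fin (q n) × Fin (m n)) ⊕ (Fin (q n) × Fin (ℓ n))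

def view {n : ℕ} (x : Fin (q n) → Bits (Fin (m n))) (y : Fin (q n) → Bits (Fin (ℓ n))) :
    Bits (ViewReg m ℓ q n) :=
  Sum.elim (fun p => x p.1 p.2) (fun p => y p.1 p.2)

/-- Acceptance probability when the outputs come from `F` under one uniform key, each evaluated
with fresh randomness. -/
def realAccept (A : Distinguisher (ViewReg m ℓ q)) (n : ℕ)
    (x : Fin (q n) → Bits (Fin (m n))) : ℝ :=
  ∑ k : Bits (Fin n), unif (Fin n) * ∑ y : Fin (q n) → Bits (Fin (ℓ n)),
    (∏ j, F n k (x j) (y j)) * A.accept n (view x y)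

/-- Acceptance probability when the outputs are independent uniform strings. -/
def idealAccept (A : Distinguisher (ViewReg m ℓ q)) (n : ℕ)
    (x : Fin (q n) → Bits (Fin (m n))) : ℝ :=
  ∑ y : Fin (q n) → Bits (Fin (ℓ n)), (∏ _j : Fin (q n), unif (Fin (ℓ n))) * A.accept n (view x y)

/-- Indistinguishability on every family of pairwise distinct inputs. Distinctness is asked for
each `n` separately, so that the finitely many `n` with `2 ^ m n < q n` do not make the
condition void. -/
def SelectivelySecure : Prop :=
  ∀ q : ℕ → ℕ, PolyBounded q → ∀ A : Distinguisher (ViewReg m ℓ q),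
    ∀ x : ∀ n, Fin (q n) → Bits (Fin (m n)), ∃ ε : ℕ → ℝ, Negligible ε ∧
      ∀ n, Function.Injective (x n) → |F.realAccept A n (x n) - idealAccept A n (x n)| ≤ ε n

/-- Selectively secure quantum pseudorandom functions. -/
structure IsSelectivelySecureQPRF : Prop where
  qpt : F.QPT
  pseudodeterministic : F.Pseudodeterministic
  selectivelySecure : F.SelectivelySecure

end KeyedFun

/-! ### Private-key encryption with classical ciphertexts -/

/-- Input-output behaviour of a triple `(Gen, Enc, Dec)`; keys, messages and ciphertexts for
security parameter `n` are bit strings with positions `K n`, `M n`, `C n`. The values are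
probabilities: `Gen n k` of key `k`, `Enc n k msg c` of ciphertext `c`, `Dec n k c msg` of
decrypting `c` to `msg`. -/
structure Scheme (K M C : ℕ → Type) where
  Gen : ∀ n, Bits (K n) → ℝ
  Enc : ∀ n, Bits (K n) → Bits (M n) → Bits (C n) → ℝ
  Dec : ∀ n, Bits (K n) → Bits (C n) → Bits (M n) → ℝ

/-- Non-uniform QPT adversaries in the non-adaptive CPA experiment with `q n` queries. The first
circuit, run on the advice, produces all message pairs (bit `t` of `m_j^b` is at position
`(j, b, t)`) and a quantum memory; the second one gets all ciphertexts and the memory and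
produces the guess. -/
structure CPAAdversary (q : ℕ → ℕ) (M C : ℕ → Type) where
  advLen : ℕ → ℕ
  memLen : ℕ → ℕ
  choose : ∀ n, Circuit (Fin (advLen n)) ((Fin (q n) × Bool × M n) ⊕ Fin (memLen n))
  guess : ∀ n, Circuit (Fin (memLen n) ⊕ (Fin (q n) × C n)) Unit
  advice : ∀ n, Op (Fin (advLen n))
  choose_polySize : PolyBounded fun n => (choose n).size
  guess_polySize : PolyBounded fun n => (guess n).size
  isDensity : ∀ n, IsDensity (advice n)

namespace Scheme

variable {K M C : ℕ → Type}
  [∀ n, Fintype (K n)] [∀ n, DecidableEq (K n)]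
  [∀ n, Fintype (M n)] [∀ n, DecidableEq (M n)]
  [∀ n, Fintype (C n)] [∀ n, DecidableEq (C n)]

/-- All three algorithms are QPT. -/
def QPT (S : Scheme K M C) : Prop :=
  IsQPT (I := fun _ => Empty) (O := K) (fun n _ k => S.Gen n k) ∧
  IsQPT (I := fun n => K n ⊕ M n) (O := C)
    (fun n z c => S.Enc n (z ∘ Sum.inl) (z ∘ Sum.inr) c) ∧
  IsQPT (I := fun n => K n ⊕ C n) (O := M)
    (fun n z msg => S.Dec n (z ∘ Sum.inl) (z ∘ Sum.inr) msg)

/-- Decryption recovers every message except with negligible probability over `Gen`, `Enc`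
and `Dec`. -/
def Correct (S : Scheme K M C) : Prop :=
  ∃ ε : ℕ → ℝ, Negligible ε ∧ ∀ n, ∀ msg : Bits (M n),
    1 - ε n ≤ ∑ k, S.Gen n k * ∑ c, S.Enc n k msg c * S.Dec n k c msg

/-- Probability that the adversary guesses the challenge bit. -/
def cpaWin (S : Scheme K M C) {q : ℕ → ℕ} (A : CPAAdversary q M C) (n : ℕ) : ℝ :=
  ∑ b : Bool, (1 / 2) * ∑ k : Bits (K n), S.Gen n k *
    ∑ msgs : Bits (Fin (q n) × Bool × M n), ∑ c : Fin (q n) → Bits (C n),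
      (∏ j, S.Enc n k (fun t => msgs (j, b, t)) (c j)) *
        measure ((A.guess n).run
          (tensor (afterOutcome ((A.choose n).run (A.advice n)) msgs)
            (ket fun p => c p.1 p.2))) fun _ => b

/-- Every adversary has negligible advantage in the non-adaptive CPA experiment. -/
def NonAdaptiveCPASecure (S : Scheme K M C) : Prop :=
  ∀ q : ℕ → ℕ, PolyBounded q → ∀ A : CPAAdversary q M C,
    ∃ ε : ℕ → ℝ, Negligible ε ∧ ∀ n, |S.cpaWin A n - 1 / 2| ≤ ε n

/-- Non-adaptive CPA-secure quantum private-key encryption schemes. -/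
structure IsNonAdaptiveCPASecureEncryption (S : Scheme K M C) : Prop where
  qpt : S.QPT
  correct : S.Correct
  secure : S.NonAdaptiveCPASecure

end Scheme

/-! ### The construction -/

/-- Bitwise exclusive or. -/
def xorBits {I : Type} (x y : Bits I) : Bits I := fun i => xor (x i) (y i)

open Classical in
/-- Majority vote: the string that occurs in more than half of the positions, and the all-zero
string if there is none. -/
def majority {n : ℕ} {I : Type} (v : Fin n → Bits I) : Bits I :=
  if h : ∃ w : Bits I, n < 2 * (Finset.univ.filter fun i => v i = w).card then h.choose
  else fun _ => false

/-- Positions of the key: `n` blocks of `n` bits, bit `j` of `k_i` being at `(i, j)`. -/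
abbrev KeyReg (n : ℕ) : Type := Fin n × Fin n

/-- Positions of the ciphertext: the nonce, followed by `n` blocks of the length of the message. -/
abbrev CtReg (m ℓ : ℕ → ℕ) (n : ℕ) : Type := Fin (m n) ⊕ (Fin n × Fin (ℓ n))

/-- The ciphertext `(r, c_1, …, c_n)`. -/
def mkCt {m ℓ : ℕ → ℕ} {n : ℕ} (r : Bits (Fin (m n))) (c : Fin n → Bits (Fin (ℓ n))) :
    Bits (CtReg m ℓ n) :=
  Sum.elim r fun p => c p.1 p.2

/-- The encryption scheme built from `F`. `Gen` outputs a uniform key `k_1, …, k_n`. `Enc` picks a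
uniform nonce `r`, evaluates `y_i ← F(k_i, r)` and outputs `(r, msg ⊕ y_1, …, msg ⊕ y_n)`. `Dec`
evaluates `y_i ← F(k_i, r)` afresh and outputs the majority of the strings `c_i ⊕ y_i`. -/
def ske {m ℓ : ℕ → ℕ} (F : KeyedFun m ℓ) :
    Scheme KeyReg (fun n => Fin (ℓ n)) (CtReg m ℓ) where
  Gen n _ := unif (KeyReg n)
  Enc n k msg c :=
    ∑ r : Bits (Fin (m n)), unif (Fin (m n)) * ∑ y : Fin n → Bits (Fin (ℓ n)),
      (∏ i, F n (fun j => k (i, j)) r (y i)) *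
        if c = mkCt r (fun i => xorBits msg (y i)) then 1 else 0
  Dec n k c msg :=
    ∑ y : Fin n → Bits (Fin (ℓ n)),
      (∏ i, F n (fun j => k (i, j)) (c ∘ Sum.inl) (y i)) *
        if msg = majority (fun i => xorBits (fun t => c (Sum.inr (i, t))) (y i)) then 1 else 0

end QCrypto

end

/-!
The algorithms are polynomial-size circuits because the majority of the blocks is computed by a
polynomial-size Boolean network, and such a network is evaluated on a quantum register by Toffoli
gates, which are words in `CNOT`, `H` and `T`.

For correctness, the blocks carry independent keys. Pseudodeterminism makes each block decrypt to
the wrong string with probability at most `3μ`, so by a Chernoff bound it is negligibly unlikely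
that half of them do.

For security, the nonces collide with negligible probability since `2 ^ m` is superpolynomial. For
fixed pairwise distinct nonces, the values of `F` under the keys `k₁, …, k_λ` are replaced by
uniform strings one block at a time; once all of them are uniform, the ciphertexts are independent
of the challenge bit. A single replacement is a game against selective security: its distinguisher
fixes the best choice of messages and of the values in the other blocks, holds the corresponding
memory state of the adversary as advice, and applies the now known masks by `NOT` gates.
-/

noncomputable section

namespace QCrypto

/-! ### Gates as unitary matrices -/

/-- The unitary of a list of gates, the head being applied first. -/
def gatesUnitary {W : Type} [Fintype W] [DecidableEq W] (gs : List (Gate W)) : Op W :=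
  gs.foldl (fun U g => g.unitary * U) 1

section GatesUnitary

variable {W : Type} [Fintype W] [DecidableEq W]

theorem foldl_unitary_mul (gs : List (Gate W)) (A : Op W) :
    gs.foldl (fun U g => g.unitary * U) A = gatesUnitary gs * A := by
  induction gs generalizing A with
  | nil => simp [gatesUnitary]
  | cons g gs ih =>
    simp only [gatesUnitary, List.foldl_cons]
    rw [ih, ih (g.unitary * 1), Matrix.mul_one, Matrix.mul_assoc]

@[simp] theorem gatesUnitary_nil : gatesUnitary ([] : List (Gate W)) = 1 := rfl

@[simp] theorem gatesUnitary_cons (g : Gate W) (gs : List (Gate W)) :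
    gatesUnitary (g :: gs) = gatesUnitary gs * g.unitary := by
  rw [gatesUnitary, List.foldl_cons, foldl_unitary_mul, Matrix.mul_one]

@[simp] theorem gatesUnitary_append (gs hs : List (Gate W)) :
    gatesUnitary (gs ++ hs) = gatesUnitary hs * gatesUnitary gs := by
  induction gs with
  | nil => simp
  | cons g gs ih =>
    rw [List.cons_append, gatesUnitary_cons, ih, gatesUnitary_cons, Matrix.mul_assoc]

end GatesUnitary

section Extend

variable {V W : Type} {α : Type*} (f : V ↪ W)

theorem eqOn_extend (z : V → α) (v : W → α) :
    Set.EqOn (Function.extend f z v) v (Set.range f)ᶜ :=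
  fun _ hw => Function.extend_apply' _ _ _ hw

theorem eq_extend_iff (z : V → α) (u v : W → α) :
    u = Function.extend f z v ↔ u ∘ f = z ∧ Set.EqOn u v (Set.range f)ᶜ := by
  constructor
  · rintro rfl
    exact ⟨Function.extend_comp f.injective z v, eqOn_extend f z v⟩
  · rintro ⟨rfl, h⟩
    funext w
    by_cases hw : w ∈ Set.range f
    · obtain ⟨a, rfl⟩ := hw
      rw [f.injective.extend_apply, Function.comp_apply]
    · rw [h hw, Function.extend_apply' _ _ _ hw]

theorem extend_comp_self (v : W → α) : Function.extend f (v ∘ f) v = v :=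
  ((eq_extend_iff f _ v v).2 ⟨rfl, fun _ _ => rfl⟩).symm

theorem extend_update_comp [DecidableEq V] [DecidableEq W] (v : W → α) (a : V) (b : α) :
    Function.extend f (Function.update (v ∘ f) a b) v = Function.update v (f a) b := by
  symm
  rw [eq_extend_iff]
  exact ⟨Function.update_comp_eq_of_injective v f.injective a b, fun w hw =>
    Function.update_of_ne (fun h => hw ⟨a, h.symm⟩) _ _⟩

theorem extend_extend (z z' : V → α) (v : W → α) :
    Function.extend f z (Function.extend f z' v) = Function.extend f z v :=
  (eq_extend_iff f _ _ _).2
    ⟨Function.extend_comp f.injective _ _, (eqOn_extend f _ _).trans (eqOn_extend f _ _)⟩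

open Classical in
theorem sum_eqOn_compl_range [Fintype V] [DecidableEq V] [Fintype W] [DecidableEq W] [Fintype α]
    {R : Type*} [AddCommMonoid R] (v : W → α) (g : (W → α) → R) :
    ∑ w, (if Set.EqOn w v (Set.range f)ᶜ then g w else 0)
      = ∑ z : V → α, g (Function.extend f z v) := by
  rw [← Finset.sum_filter]
  refine Finset.sum_nbij' (fun w => w ∘ f) (fun z => Function.extend f z v) (by simp)
    (fun z _ => by simpa using eqOn_extend f z v) (fun w hw => ?_)
    (fun z _ => Function.extend_comp f.injective z v) (fun w hw => ?_) <;>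
  · have := (eq_extend_iff f _ w v).2 ⟨rfl, (Finset.mem_filter.1 hw).2⟩
    rw [← this]

end Extend

open Classical in
/-- The operator `A` acting on the wires in the range of `f`, as the identity on the others. -/
def extendOp {V W : Type} (f : V ↪ W) (A : Op V) : Op W :=
  Matrix.of fun u v => if Set.EqOn u v (Set.range f)ᶜ then A (u ∘ f) (v ∘ f) else 0

section ExtendOp

variable {V W : Type} (f : V ↪ W)

theorem extendOp_mulVec [Fintype V] [DecidableEq V] [Fintype W] [DecidableEq W]
    (A : Op V) (Ψ : Bits W → ℂ) (v : Bits W) :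
    (extendOp f A).mulVec Ψ v = A.mulVec (fun z => Ψ (Function.extend f z v)) (v ∘ f) := by
  classical
  calc (extendOp f A).mulVec Ψ v
      = ∑ w, if Set.EqOn w v (Set.range f)ᶜ then A (v ∘ f) (w ∘ f) * Ψ w else 0 :=
        Finset.sum_congr rfl fun w _ => by
          simp only [extendOp, Matrix.of_apply, ite_mul, zero_mul, Set.eqOn_comm (f₁ := v)]
    _ = ∑ z, A (v ∘ f) (Function.extend f z v ∘ f) * Ψ (Function.extend f z v) :=
        sum_eqOn_compl_range f v fun w => A (v ∘ f) (w ∘ f) * Ψ w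
    _ = _ := by simp only [Function.extend_comp f.injective, Matrix.mulVec, dotProduct]

theorem extendOp_mul [Fintype V] [DecidableEq V] [Fintype W] [DecidableEq W] (A B : Op V) :
    extendOp f (A * B) = extendOp f A * extendOp f B := by
  refine Matrix.ext_of_mulVec_single fun v => funext fun w => ?_
  simp only [← Matrix.mulVec_mulVec, extendOp_mulVec, Function.extend_comp f.injective,
    extend_extend]

theorem extendOp_one [Fintype V] [Fintype W] : extendOp f (1 : Op V) = 1 := by
  classical
  refine Matrix.ext_of_mulVec_single fun v => funext fun w => ?_
  simp only [extendOp_mulVec, Matrix.one_mulVec, extend_comp_self]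

end ExtendOp

/-- The register map that flips the bit `t` of those `x` for which `p x` holds. -/
def flipIf {W : Type} [DecidableEq W] (t : W) (p : Bits W → Bool) (x : Bits W) : Bits W :=
  Function.update x t (x t ^^ p x)

/-- The phase `ω = e^{iπ/4}` of the `T` gate. -/
def tPhase : ℂ := Complex.exp (Complex.I * Real.pi / 4)

theorem tPhase_pow_four : tPhase ^ 4 = -1 := by
  rw [tPhase, ← Complex.exp_nat_mul, ← Complex.exp_pi_mul_I]
  congr 1
  push_cast
  ring

theorem norm_tPhase : ‖tPhase‖ = 1 := by
  rw [← pow_eq_one_iff_of_nonneg (norm_nonneg _) four_ne_zero, ← norm_pow, tPhase_pow_four,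
    norm_neg, norm_one]

theorem single_comp_involutive {α R : Type*} [DecidableEq α] [Zero R] {σ : α → α}
    (hσ : Function.Involutive σ) (a : α) (r : R) :
    (fun x => (Pi.single a r : α → R) (σ x)) = Pi.single (σ a) r := by
  funext x
  simp only [Pi.single_apply, hσ.eq_iff]

section GateUnitary

variable {W : Type} [DecidableEq W]

theorem flipIf_involutive (t : W) (p : Bits W → Bool)
    (hp : ∀ x b, p (Function.update x t b) = p x) : Function.Involutive (flipIf t p) := fun x => by
  simp [flipIf, hp]

variable [Fintype W]

theorem Gate.H_mulVec (t : W) (Ψ : Bits W → ℂ) (x : Bits W) :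
    (Gate.H t).unitary.mulVec Ψ x = (Ψ (Function.update x t false)
      + (if x t then -1 else 1) * Ψ (Function.update x t true)) / (Real.sqrt 2 : ℂ) := by
  have hne : Function.update x t false ≠ Function.update x t true := fun h => by
    simpa using congrFun h t
  have hupd (b : Bool) : ∀ w, w ≠ t → x w = Function.update x t b w := fun w hw => by simp [hw]
  rw [Matrix.mulVec, dotProduct, ← Finset.sum_subset (Finset.subset_univ
    {Function.update x t false, Function.update x t true}), Finset.sum_pair hne]
  · simp only [Gate.unitary, Matrix.of_apply, if_pos (hupd _), Function.update_self]
    simp only [Bool.false_eq_true, and_false, if_false, and_true]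
    ring
  · intro y _ hy
    refine mul_eq_zero_of_left (if_neg fun h => hy ?_) _
    have : y = Function.update x t (y t) :=
      (Function.update_eq_iff.2 ⟨rfl, h⟩).symm
    rw [this]
    cases y t <;> simp

theorem Gate.unitary_T (t : W) :
    (Gate.T t).unitary = Matrix.diagonal fun x => tPhase ^ (x t).toNat := by
  rw [Gate.unitary]
  congr 1
  funext x
  cases hx : x t <;> simp [tPhase]

theorem Gate.CNOT_mulVec (c t : W) (h : c ≠ t) (Ψ : Bits W → ℂ) (x : Bits W) :
    (Gate.CNOT c t h).unitary.mulVec Ψ x = Ψ (flipIf t (· c) x) := by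
  have hσ := flipIf_involutive t (· c) fun y b => Function.update_of_ne h b y
  have (y : Bits W) : x = Function.update y t (y t ^^ y c) ↔ flipIf t (· c) x = y :=
    ⟨fun e => e ▸ hσ y, fun e => e ▸ (hσ x).symm⟩
  simp only [Matrix.mulVec, dotProduct, Gate.unitary, Matrix.of_apply, this, ite_mul, one_mul,
    zero_mul, Finset.sum_ite_eq, Finset.mem_univ, if_true]

theorem sqrt_two_mul_self : (Real.sqrt 2 : ℂ) * Real.sqrt 2 = 2 := by
  rw [← Complex.ofReal_mul, Real.mul_self_sqrt zero_le_two, Complex.ofReal_ofNat]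

theorem Gate.H_isHermitian (t : W) : (Gate.H t).unitary.IsHermitian := by
  ext x y
  have h : (∀ w, w ≠ t → y w = x w) ↔ ∀ w, w ≠ t → x w = y w := by simp only [eq_comm]
  simp only [Matrix.conjTranspose_apply, Gate.unitary, Matrix.of_apply, h,
    and_comm (a := y t = true)]
  split_ifs <;> simp

theorem Gate.CNOT_isHermitian (c t : W) (h : c ≠ t) : (Gate.CNOT c t h).unitary.IsHermitian := by
  have hσ := flipIf_involutive t (· c) fun y b => Function.update_of_ne h b y
  ext x y
  have : y = Function.update x t (x t ^^ x c) ↔ x = Function.update y t (y t ^^ y c) :=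
    ⟨fun e => e ▸ (hσ x).symm, fun e => e ▸ (hσ y).symm⟩
  simp only [Matrix.conjTranspose_apply, Gate.unitary, Matrix.of_apply, this]
  split_ifs <;> simp

theorem Gate.H_mul_self (t : W) : (Gate.H t).unitary * (Gate.H t).unitary = 1 := by
  refine Matrix.ext_of_mulVec_single fun v => funext fun x => ?_
  have h2 : (Real.sqrt 2 : ℂ) ≠ 0 := by simp
  rw [← Matrix.mulVec_mulVec, Matrix.one_mulVec]
  simp only [Gate.H_mulVec, Function.update_idem, Function.update_self]
  cases h : x t <;>
  · simp only [← h, Function.update_eq_self]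
    simp only [h, Bool.false_eq_true, if_true, if_false]
    field_simp
    rw [sq, sqrt_two_mul_self]
    ring

theorem Gate.CNOT_mul_self (c t : W) (h : c ≠ t) :
    (Gate.CNOT c t h).unitary * (Gate.CNOT c t h).unitary = 1 := by
  refine Matrix.ext_of_mulVec_single fun v => funext fun x => ?_
  rw [← Matrix.mulVec_mulVec, Matrix.one_mulVec, Gate.CNOT_mulVec, Gate.CNOT_mulVec,
    flipIf_involutive t (· c) fun y b => Function.update_of_ne h b y]

theorem Gate.unitary_mem_unitaryGroup (g : Gate W) :
    g.unitary ∈ Matrix.unitaryGroup (Bits W) ℂ := by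
  rw [Matrix.mem_unitaryGroup_iff', Matrix.star_eq_conjTranspose]
  cases g with
  | H t => rw [Gate.H_isHermitian, Gate.H_mul_self]
  | CNOT c t h => rw [Gate.CNOT_isHermitian, Gate.CNOT_mul_self]
  | T t =>
    rw [Gate.unitary_T, Matrix.diagonal_conjTranspose, Matrix.diagonal_mul_diagonal,
      ← Matrix.diagonal_one]
    congr 1
    funext x
    cases hx : x t <;> simp [hx, Complex.conj_mul', norm_tPhase]

theorem gatesUnitary_mem_unitaryGroup (gs : List (Gate W)) :
    gatesUnitary gs ∈ Matrix.unitaryGroup (Bits W) ℂ := by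
  induction gs with
  | nil => exact one_mem _
  | cons g gs ih => exact gatesUnitary_cons g gs ▸ mul_mem ih g.unitary_mem_unitaryGroup

end GateUnitary

/-- Relabelling of the wires of a gate. -/
def Gate.map {V W : Type} (f : V ↪ W) : Gate V → Gate W
  | .H v => .H (f v)
  | .T v => .T (f v)
  | .CNOT c t h => .CNOT (f c) (f t) (f.injective.ne h)

section Map

variable {V W : Type} [Fintype V] [DecidableEq V] [Fintype W] [DecidableEq W] (f : V ↪ W)

theorem Gate.unitary_map (g : Gate V) : (g.map f).unitary = extendOp f g.unitary := by
  refine Matrix.ext_of_mulVec_single fun v => funext fun x => ?_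
  cases g with
  | H t => simp only [Gate.map, extendOp_mulVec, Gate.H_mulVec, extend_update_comp,
      Function.comp_apply]
  | T t => simp only [Gate.map, extendOp_mulVec, Gate.unitary_T, Matrix.mulVec_diagonal,
      extend_comp_self, Function.comp_apply]
  | CNOT c t h => simp only [Gate.map, extendOp_mulVec, Gate.CNOT_mulVec, flipIf,
      extend_update_comp, Function.comp_apply]

theorem gatesUnitary_map (gs : List (Gate V)) :
    gatesUnitary (gs.map (Gate.map f)) = extendOp f (gatesUnitary gs) := by
  induction gs with
  | nil => rw [List.map_nil, gatesUnitary_nil, gatesUnitary_nil, extendOp_one]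
  | cons g gs ih =>
    rw [List.map_cons, gatesUnitary_cons, gatesUnitary_cons, ih, extendOp_mul, Gate.unitary_map]

end Map

section BooleanGates

variable {W : Type}

/-- The phase `ω ^ k` on the parity of two wires. -/
def parityPhaseGates (k : ℕ) (c t : W) (h : c ≠ t) : List (Gate W) :=
  [.CNOT c t h] ++ List.replicate k (.T t) ++ [.CNOT c t h]

/-- The doubly controlled phase flip. -/
def cczGates (a b t : W) (hab : a ≠ b) (hat : a ≠ t) (hbt : b ≠ t) : List (Gate W) :=
  [.T a, .T b, .T t] ++ parityPhaseGates 7 a b hab ++ parityPhaseGates 7 b t hbt ++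
    parityPhaseGates 7 a t hat ++ ([.CNOT a t hat] ++ parityPhaseGates 1 b t hbt ++ [.CNOT a t hat])

/-- The Toffoli gate, adding `a ∧ b` to the target `t`. -/
def toffoliGates (a b t : W) (hab : a ≠ b) (hat : a ≠ t) (hbt : b ≠ t) : List (Gate W) :=
  [.H t] ++ cczGates a b t hab hat hbt ++ [.H t]

/-- The negation of the wire `t`. -/
def notGates (t : W) : List (Gate W) := [.H t] ++ List.replicate 4 (.T t) ++ [.H t]

theorem length_toffoliGates (a b t : W) (hab : a ≠ b) (hat : a ≠ t) (hbt : b ≠ t) :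
    (toffoliGates a b t hab hat hbt).length = 37 := rfl

theorem length_notGates (t : W) : (notGates t).length = 6 := rfl

variable [Fintype W] [DecidableEq W]

theorem gatesUnitary_replicate_T (k : ℕ) (t : W) :
    gatesUnitary (List.replicate k (.T t))
      = Matrix.diagonal fun x => tPhase ^ (k * (x t).toNat) := by
  induction k with
  | zero => simp
  | succ k ih =>
    simp only [List.replicate_succ, gatesUnitary_cons, ih, Gate.unitary_T,
      Matrix.diagonal_mul_diagonal, ← pow_add, Nat.succ_mul]

theorem gatesUnitary_CNOT_conj (c t : W) (h : c ≠ t) {gs : List (Gate W)} {d : Bits W → ℂ}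
    (hd : gatesUnitary gs = Matrix.diagonal d) :
    gatesUnitary ([.CNOT c t h] ++ gs ++ [.CNOT c t h])
      = Matrix.diagonal fun x => d (flipIf t (· c) x) := by
  refine Matrix.ext_of_mulVec_single fun v => funext fun x => ?_
  simp only [gatesUnitary_append, gatesUnitary_cons, gatesUnitary_nil, hd, one_mul,
    ← Matrix.mulVec_mulVec, Gate.CNOT_mulVec, Matrix.mulVec_diagonal,
    flipIf_involutive t (· c) (fun y b => Function.update_of_ne h b y) x]

theorem gatesUnitary_H_conj (t : W) (p : Bits W → Bool)
    (hp : ∀ x b, p (Function.update x t b) = p x) {gs : List (Gate W)}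
    (hgs : gatesUnitary gs = Matrix.diagonal fun x => if x t && p x then -1 else 1)
    (Ψ : Bits W → ℂ) (x : Bits W) :
    (gatesUnitary ([.H t] ++ gs ++ [.H t])).mulVec Ψ x = Ψ (flipIf t p x) := by
  have h2 : (Real.sqrt 2 : ℂ) ≠ 0 := by simp
  simp only [gatesUnitary_append, gatesUnitary_cons, gatesUnitary_nil, hgs, one_mul,
    ← Matrix.mulVec_mulVec, Gate.H_mulVec, Matrix.mulVec_diagonal, Function.update_idem,
    Function.update_self, hp, flipIf]
  cases hx : x t <;> cases hpx : p x <;>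
  · simp only [Bool.true_and, Bool.false_and, Bool.false_eq_true, if_true, if_false, Bool.xor_true,
      Bool.xor_false, Bool.not_true, Bool.not_false]
    field_simp
    rw [sq, sqrt_two_mul_self]
    ring

theorem gatesUnitary_parityPhaseGates (k : ℕ) (c t : W) (h : c ≠ t) :
    gatesUnitary (parityPhaseGates k c t h)
      = Matrix.diagonal fun x => tPhase ^ (k * (x t ^^ x c).toNat) := by
  rw [parityPhaseGates, gatesUnitary_CNOT_conj c t h (gatesUnitary_replicate_T k t)]
  simp only [flipIf, Function.update_self]

/- Modulo 8, `a + b + t - (a ⊕ b) - (b ⊕ t) - (a ⊕ t) + (a ⊕ b ⊕ t) = 4abt`. -/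
theorem tPhase_pow_mul_eq_ccz (a b t : Bool) :
    tPhase ^ a.toNat * tPhase ^ b.toNat * tPhase ^ t.toNat * tPhase ^ (7 * (b ^^ a).toNat) *
      tPhase ^ (7 * (t ^^ b).toNat) * tPhase ^ (7 * (t ^^ a).toNat) *
      tPhase ^ (1 * ((t ^^ a) ^^ b).toNat) = if t && (a && b) then -1 else 1 := by
  have h16 : tPhase ^ 16 = 1 := by
    rw [show 16 = 4 * 4 from rfl, pow_mul, tPhase_pow_four]
    norm_num
  simp only [← pow_add]
  cases a <;> cases b <;> cases t <;> simp [h16, tPhase_pow_four]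

theorem gatesUnitary_cczGates (a b t : W) (hab : a ≠ b) (hat : a ≠ t) (hbt : b ≠ t) :
    gatesUnitary (cczGates a b t hab hat hbt)
      = Matrix.diagonal fun x => if x t && (x a && x b) then -1 else 1 := by
  rw [cczGates, gatesUnitary_append,
    gatesUnitary_CNOT_conj a t hat (gatesUnitary_parityPhaseGates 1 b t hbt), gatesUnitary_append,
    gatesUnitary_append, gatesUnitary_append]
  simp only [gatesUnitary_parityPhaseGates, gatesUnitary_cons, gatesUnitary_nil, one_mul,
    Gate.unitary_T, Matrix.diagonal_mul_diagonal]
  congr 1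
  funext x
  rw [← tPhase_pow_mul_eq_ccz]
  simp only [flipIf, Function.update_self, Function.update_of_ne hbt]
  ring

theorem toffoliGates_mulVec (a b t : W) (hab : a ≠ b) (hat : a ≠ t) (hbt : b ≠ t)
    (Ψ : Bits W → ℂ) (x : Bits W) :
    (gatesUnitary (toffoliGates a b t hab hat hbt)).mulVec Ψ x
      = Ψ (flipIf t (fun y => y a && y b) x) :=
  gatesUnitary_H_conj t _ (fun y c => by simp [hat, hbt])
    (gatesUnitary_cczGates a b t hab hat hbt) Ψ x

theorem notGates_mulVec (t : W) (Ψ : Bits W → ℂ) (x : Bits W) :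
    (gatesUnitary (notGates t)).mulVec Ψ x = Ψ (flipIf t (fun _ => true) x) := by
  refine gatesUnitary_H_conj t (fun _ => true) (fun _ _ => rfl) ?_ Ψ x
  rw [gatesUnitary_replicate_T]
  congr 1
  funext y
  cases hy : y t <;> simp [tPhase_pow_four]

end BooleanGates

/-! ### Circuits -/

theorem sum_elim_eq_sum {I J : Type*} [Fintype I] [DecidableEq I] [Fintype J] [DecidableEq J]
    {α R : Type*} [Fintype α] [AddCommMonoid R] (g : (I ⊕ J → α) → R) :
    ∑ w, g w = ∑ u : I → α, ∑ v : J → α, g (Sum.elim u v) := by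
  rw [← Fintype.sum_prod_type']
  exact Fintype.sum_equiv (Equiv.sumArrowEquivProdArrow I J α) _ _ fun w => by
    simp [Equiv.sumArrowEquivProdArrow]

theorem posSemidef_ite_submatrix {α β : Type*} [Finite α] {M : Matrix β β ℂ} (hM : M.PosSemidef)
    (f : α → β) (p : α → Prop) [DecidablePred p] :
    (Matrix.of fun u v => if p u ∧ p v then M (f u) (f v) else 0 : Matrix α α ℂ).PosSemidef := by
  classical
  have := Fintype.ofFinite α
  convert (hM.submatrix f).mul_mul_conjTranspose_same
    (Matrix.diagonal fun u => if p u then (1 : ℂ) else 0) using 1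
  ext u v
  rw [Matrix.diagonal_conjTranspose, Matrix.mul_diagonal, Matrix.diagonal_mul]
  by_cases hu : p u <;> by_cases hv : p v <;> simp [hu, hv]

section States

variable {I J : Type}

theorem tensor_ket_apply [Fintype J] (ρ : Op I) (x : Bits J) (u v : Bits (I ⊕ J)) :
    tensor ρ (ket x) u v = if u ∘ Sum.inr = x ∧ v ∘ Sum.inr = x then
      ρ (u ∘ Sum.inl) (v ∘ Sum.inl) else 0 := by
  simp only [tensor, ket, Matrix.of_apply, Matrix.single_apply, eq_comm (a := x), mul_ite, mul_one,
    mul_zero]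

theorem tensor_ket_posSemidef [Finite I] [Fintype J] {ρ : Op I} (hρ : ρ.PosSemidef)
    (x : Bits J) : (tensor ρ (ket x)).PosSemidef := by
  convert posSemidef_ite_submatrix hρ (· ∘ Sum.inl) (fun u : Bits (I ⊕ J) => u ∘ Sum.inr = x)
    using 1
  ext u v
  exact tensor_ket_apply ρ x u v

theorem tensor_ket_trace [Fintype I] [DecidableEq I] [Fintype J] [DecidableEq J]
    (ρ : Op I) (x : Bits J) : (tensor ρ (ket x)).trace = ρ.trace := by
  simp only [Matrix.trace, Matrix.diag_apply]
  rw [sum_elim_eq_sum]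
  simp [tensor_ket_apply]

theorem tensor_smul (c : ℂ) (ρ : Op I) (σ : Op J) : tensor (c • ρ) σ = c • tensor ρ σ := by
  ext u v
  simp [tensor, mul_assoc]

theorem ket_posSemidef [Fintype I] (x : Bits I) : (ket x).PosSemidef := by
  classical
  rw [ket, ← Matrix.diagonal_single]
  exact Matrix.PosSemidef.diagonal (Pi.single_nonneg.2 zero_le_one)

theorem ket_trace [Fintype I] [DecidableEq I] (x : Bits I) : (ket x).trace = 1 :=
  Matrix.trace_single_eq_same x 1

theorem afterOutcome_posSemidef {σ : Op (I ⊕ J)} (hσ : σ.PosSemidef) (x : Bits I) :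
    (afterOutcome σ x).PosSemidef :=
  hσ.submatrix fun u => Sum.elim x u

theorem sum_afterOutcome_trace [Fintype I] [DecidableEq I] [Fintype J] [DecidableEq J]
    (σ : Op (I ⊕ J)) : ∑ x, (afterOutcome σ x).trace = σ.trace := by
  simp only [Matrix.trace, Matrix.diag_apply, sum_elim_eq_sum (I := I), afterOutcome,
    Matrix.of_apply]

theorem measure_nonneg {ρ : Op I} (hρ : ρ.PosSemidef) (y : Bits I) : 0 ≤ measure ρ y :=
  (Complex.le_def.1 hρ.diag_nonneg).1

theorem measure_smul (c : ℝ) (ρ : Op I) (y : Bits I) :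
    measure ((c : ℂ) • ρ) y = c * measure ρ y := by
  simp [measure]

theorem sum_measure [Fintype I] [DecidableEq I] (ρ : Op I) :
    ∑ y, measure ρ y = ρ.trace.re := by
  simp only [measure, Matrix.trace, Matrix.diag_apply, Complex.re_sum]

end States

namespace Circuit

variable {I O : Type} (C : Circuit I O)

/-- The initial assignment of the wires on a classical input. -/
def init (x : Bits I) : Bits C.Wire := Function.extend C.inp x fun _ => false

theorem unitary_eq_gatesUnitary : C.unitary = gatesUnitary C.gates := rfl

open Classical in
theorem load_apply (ρ : Op I) (u v : Bits C.Wire) : C.load ρ u v =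
    if Set.EqOn u (fun _ => false) (Set.range C.inp)ᶜ ∧
        Set.EqOn v (fun _ => false) (Set.range C.inp)ᶜ then ρ (u ∘ C.inp) (v ∘ C.inp) else 0 :=
  if_congr forall₂_and rfl rfl

theorem load_ket [Fintype I] (x : Bits I) :
    C.load (ket x) = Matrix.single (C.init x) (C.init x) 1 := by
  classical
  ext u v
  simp only [load_apply, ket, Matrix.single_apply, init, eq_comm (b := u), eq_comm (b := v),
    eq_extend_iff, ← ite_and]
  exact if_congr (by tauto) rfl rfl

theorem load_posSemidef {ρ : Op I} (hρ : ρ.PosSemidef) : (C.load ρ).PosSemidef := by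
  classical
  convert posSemidef_ite_submatrix hρ (fun u : Bits C.Wire => u ∘ C.inp)
    (fun u => Set.EqOn u (fun _ => false) (Set.range C.inp)ᶜ) using 1
  ext u v
  exact (C.load_apply ρ u v).trans (by simp only [Matrix.of_apply])

theorem load_trace [Fintype I] [DecidableEq I] (ρ : Op I) : (C.load ρ).trace = ρ.trace := by
  classical
  simp only [Matrix.trace, Matrix.diag_apply, load_apply, and_self]
  refine (sum_eqOn_compl_range C.inp (fun _ => false) fun u => ρ (u ∘ C.inp) (u ∘ C.inp)).trans ?_
  simp only [Function.extend_comp C.inp.injective]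

theorem load_smul (c : ℂ) (ρ : Op I) : C.load (c • ρ) = c • C.load ρ := by
  ext u v
  simp only [load_apply, Matrix.smul_apply, smul_ite, smul_zero]

theorem traceOut_apply (σ : Op C.Wire) (i j : Bits O) [DecidableEq (Bits O)] :
    C.traceOut σ i j =
      ∑ u : Bits C.Wire, if u ∘ C.out = i then σ u (Function.extend C.out j u) else 0 := by
  classical
  refine Finset.sum_congr rfl fun u _ => ?_
  have (v : Bits C.Wire) : (u ∘ C.out = i ∧ v ∘ C.out = j ∧ ∀ w, w ∉ Set.range C.out → u w = v w) ↔
      v = Function.extend C.out j u ∧ u ∘ C.out = i := by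
    rw [eq_extend_iff, Set.eqOn_comm]
    exact ⟨fun h => ⟨h.2, h.1⟩, fun h => ⟨h.2, h.1⟩⟩
  simp only [this, ite_and, Finset.sum_ite_eq', Finset.mem_univ, if_true]

theorem traceOut_diag (σ : Op C.Wire) (y : Bits O) [DecidableEq (Bits O)] :
    C.traceOut σ y y = ∑ u : Bits C.Wire, if u ∘ C.out = y then σ u u else 0 := by
  rw [traceOut_apply]
  refine Finset.sum_congr rfl fun u _ => ?_
  split_ifs with h
  · rw [← h, extend_comp_self]
  · rfl

theorem traceOut_eq_sum [DecidableEq (Bits O)] (σ : Op C.Wire) : C.traceOut σ =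
    ∑ z : Bits C.Wire with z ∘ C.out = fun _ => false,
      σ.submatrix (Function.extend C.out · z) (Function.extend C.out · z) := by
  ext i j
  rw [traceOut_apply, ← Finset.sum_filter, Matrix.sum_apply]
  refine Finset.sum_nbij' (fun u => Function.extend C.out (fun _ => false) u)
    (fun z => Function.extend C.out i z) ?_ ?_ ?_ ?_ ?_
  all_goals
    intro u hu
    simp only [Finset.mem_filter, Finset.mem_univ, true_and, Function.extend_comp C.out.injective,
      extend_extend, Matrix.submatrix_apply] at hu ⊢
  all_goals rw [← hu, extend_comp_self]

theorem traceOut_trace [Fintype O] [DecidableEq O] (σ : Op C.Wire) :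
    (C.traceOut σ).trace = σ.trace := by
  simp only [Matrix.trace, Matrix.diag_apply, traceOut_diag]
  rw [Finset.sum_comm]
  simp only [Finset.sum_ite_eq, Finset.mem_univ, if_true]

theorem run_posSemidef {ρ : Op I} (hρ : ρ.PosSemidef) : (C.run ρ).PosSemidef := by
  classical
  rw [run, traceOut_eq_sum]
  exact Matrix.posSemidef_sum _ fun z _ =>
    ((C.load_posSemidef hρ).mul_mul_conjTranspose_same _).submatrix _

theorem run_trace [Fintype I] [DecidableEq I] [Fintype O] [DecidableEq O] (ρ : Op I) :
    (C.run ρ).trace = ρ.trace := by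
  have hU := Matrix.mem_unitaryGroup_iff'.1 (gatesUnitary_mem_unitaryGroup C.gates)
  rw [Matrix.star_eq_conjTranspose] at hU
  rw [run, traceOut_trace, Matrix.trace_mul_cycle, unitary_eq_gatesUnitary, hU, Matrix.one_mul,
    load_trace]

theorem run_smul (c : ℂ) (ρ : Op I) : C.run (c • ρ) = c • C.run ρ := by
  classical
  rw [run, run, load_smul, Matrix.mul_smul, Matrix.smul_mul, traceOut_eq_sum, traceOut_eq_sum,
    Finset.smul_sum]
  rfl

/-- The amplitudes of the wires after all gates, on a classical input. -/
def finalState (x : Bits I) : Bits C.Wire → ℂ :=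
  (gatesUnitary C.gates).mulVec (Pi.single (C.init x) 1)

theorem prob_eq_sum_normSq [Fintype I] [DecidableEq (Bits O)] (x : Bits I) (y : Bits O) :
    C.prob x y =
      ∑ u, if u ∘ C.out = y then Complex.normSq (C.finalState x u) else 0 := by
  rw [prob, measure, run, load_ket, unitary_eq_gatesUnitary, traceOut_diag, Complex.re_sum]
  have hstate : gatesUnitary C.gates * Matrix.single (C.init x) (C.init x) 1 *
      (gatesUnitary C.gates).conjTranspose =
      Matrix.vecMulVec (C.finalState x) (star (C.finalState x)) := by
    rw [Matrix.single_eq_single_vecMulVec_single, Matrix.mul_vecMulVec, Matrix.vecMulVec_mul,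
      finalState, Matrix.star_mulVec, ← Pi.single_star, star_one]
  refine Finset.sum_congr rfl fun u _ => ?_
  rw [hstate, Matrix.vecMulVec_apply, Pi.star_apply, RCLike.star_def, Complex.mul_conj,
    apply_ite Complex.re, Complex.ofReal_re, Complex.zero_re]

theorem prob_nonneg [Fintype I] (x : Bits I) (y : Bits O) : 0 ≤ C.prob x y :=
  measure_nonneg (C.run_posSemidef (ket_posSemidef x)) y

theorem sum_prob [Fintype I] [Fintype O] [DecidableEq O] (x : Bits I) :
    ∑ y, C.prob x y = 1 := by
  classical
  simp only [prob, sum_measure, run_trace, ket_trace, Complex.one_re]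

end Circuit

theorem gatesUnitary_flatMap_mulVec {J W : Type} [Fintype W] [DecidableEq W]
    {G : J → List (Gate W)} (t : J ↪ W) {p : J → Bits W → Bool}
    (hG : ∀ j Ψ x, (gatesUnitary (G j)).mulVec Ψ x = Ψ (flipIf (t j) (p j) x))
    (hp : ∀ j x y, Set.EqOn x y (Set.range t)ᶜ → p j x = p j y) [DecidableEq J] {js : List J}
    (hjs : js.Nodup) (Ψ : Bits W → ℂ) (x : Bits W) :
    (gatesUnitary (js.flatMap G)).mulVec Ψ x =
      Ψ (xorBits x (Function.extend t (fun j => decide (j ∈ js) && p j x) fun _ => false)) := by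
  have hzero : Function.extend t (fun _ => false) (fun _ => false) = fun _ => false :=
    extend_comp_self t fun _ => false
  have hxor : xorBits x (fun _ => false) = x := funext fun w => Bool.xor_false (x w)
  induction js generalizing Ψ with
  | nil => simp [hzero, hxor]
  | cons j js ih =>
    rw [List.nodup_cons] at hjs
    rw [List.flatMap_cons, gatesUnitary_append, ← Matrix.mulVec_mulVec, ih hjs.2, hG]
    congr 1
    have hpj : p j (xorBits x (Function.extend t (fun j => decide (j ∈ js) && p j x)
        fun _ => false)) = p j x :=
      hp j _ _ fun w hw => by simp only [xorBits, eqOn_extend t _ _ hw, Bool.xor_false]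
    funext w
    rw [flipIf, hpj]
    by_cases hw : w ∈ Set.range t
    · obtain ⟨i, rfl⟩ := hw
      by_cases hij : i = j
      · subst hij
        simp [xorBits, t.injective.extend_apply, hjs.1]
      · simp [xorBits, t.injective.extend_apply, t.injective.eq_iff, hij]
    · rw [Function.update_of_ne fun h => hw ⟨j, h.symm⟩]
      simp only [xorBits, eqOn_extend t _ _ hw]

section SumExtend

variable {I J V : Type} {α : Type*} (f : V ↪ I)

theorem extend_trans_inl (z : V → α) (u : I → α) (v : J → α) :
    Function.extend (f.trans .inl) z (Sum.elim u v) = Sum.elim (Function.extend f z u) v := by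
  symm
  rw [eq_extend_iff]
  refine ⟨Function.extend_comp f.injective z u, ?_⟩
  rintro (i | j) hw
  exacts [eqOn_extend f z u fun ⟨a, ha⟩ => hw ⟨a, congrArg Sum.inl ha⟩, rfl]

theorem extend_trans_inr (z : V → α) (u : J → α) (v : I → α) :
    Function.extend (f.trans .inr) z (Sum.elim u v) = Sum.elim u (Function.extend f z v) := by
  symm
  rw [eq_extend_iff]
  refine ⟨Function.extend_comp f.injective z v, ?_⟩
  rintro (j | i) hw
  exacts [rfl, eqOn_extend f z v fun ⟨a, ha⟩ => hw ⟨a, congrArg Sum.inr ha⟩]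

end SumExtend

section SumExtendOp

variable {I J : Type} [Fintype I] [DecidableEq I] [Fintype J] [DecidableEq J]

theorem extendOp_inl_mulVec (A : Op I) (Ψ : Bits (I ⊕ J) → ℂ) (u : Bits I) (v : Bits J) :
    (extendOp .inl A).mulVec Ψ (Sum.elim u v) = A.mulVec (fun z => Ψ (Sum.elim z v)) u := by
  have hext (z : Bits I) : Function.extend (.inl : I ↪ I ⊕ J) z (Sum.elim u v) = Sum.elim z v :=
    (extend_trans_inl (.refl I) z u v).trans
      (congrArg (Sum.elim · v) (Function.extend_id z u))
  simp only [extendOp_mulVec, hext]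
  rfl

theorem extendOp_inr_mulVec (A : Op J) (Ψ : Bits (I ⊕ J) → ℂ) (u : Bits I) (v : Bits J) :
    (extendOp .inr A).mulVec Ψ (Sum.elim u v) = A.mulVec (fun z => Ψ (Sum.elim u z)) v := by
  have hext (z : Bits J) : Function.extend (.inr : J ↪ I ⊕ J) z (Sum.elim u v) = Sum.elim u z :=
    (extend_trans_inr (.refl J) z u v).trans (congrArg (Sum.elim u) (Function.extend_id z v))
  simp only [extendOp_mulVec, hext]
  rfl

end SumExtendOp

namespace Circuit

section Init

variable {I O : Type} (C : Circuit I O)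

theorem init_apply_inp (x : Bits I) (a : I) : C.init x (C.inp a) = x a :=
  C.inp.injective.extend_apply x _ a

theorem init_of_notMem_range (x : Bits I) {w : C.Wire} (hw : w ∉ Set.range C.inp) :
    C.init x w = false :=
  Function.extend_apply' x _ w hw

end Init

section Seq

variable {I J O : Type} [Fintype J] (A : Circuit I J) (B : Circuit J O)

/-- The gate copying the output bit `j` of `A` to the input wire `j` of `B`. -/
def copyGate (j : J) : Gate (A.Wire ⊕ B.Wire) :=
  .CNOT (Sum.inl (A.out j)) (Sum.inr (B.inp j)) Sum.inl_ne_inr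

/-- The sequential composition: run `A`, copy its output to the input wires of `B`, and run `B`.
As the wires of `A` are traced out, copying by `CNOT` amounts to measuring the output of `A`. -/
abbrev seq : Circuit I O where
  Wire := A.Wire ⊕ B.Wire
  gates := A.gates.map (Gate.map .inl) ++ Finset.univ.toList.flatMap (fun j => [copyGate A B j]) ++
    B.gates.map (Gate.map .inr)
  inp := A.inp.trans .inl
  out := B.out.trans .inr

theorem copyGates_mulVec (Ψ : Bits (A.Wire ⊕ B.Wire) → ℂ) (u : Bits A.Wire) (v : Bits B.Wire) :
    (gatesUnitary (Finset.univ.toList.flatMap fun j => [copyGate A B j])).mulVec Ψ (Sum.elim u v) =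
      Ψ (Sum.elim u (xorBits v (B.init (u ∘ A.out)))) := by
  classical
  rw [gatesUnitary_flatMap_mulVec (B.inp.trans .inr) (p := fun j x => x (Sum.inl (A.out j)))
    (fun j Ψ x => by rw [gatesUnitary_cons, gatesUnitary_nil, Matrix.one_mul, copyGate,
      Gate.CNOT_mulVec]; rfl)
    (fun j x y h => h (by simp)) (Finset.nodup_toList _)]
  have hext : Function.extend (B.inp.trans (.inr : B.Wire ↪ A.Wire ⊕ B.Wire)) (u ∘ A.out)
      (fun _ => false) = Sum.elim (fun _ => false) (B.init (u ∘ A.out)) := by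
    rw [init, ← extend_trans_inr, Sum.elim_lam_const_lam_const]
  simp only [Finset.mem_toList, Finset.mem_univ, decide_true, Bool.true_and, Sum.elim_inl]
  refine congrArg Ψ (funext fun w => ?_)
  rw [xorBits, show (fun j => u (A.out j)) = u ∘ A.out from rfl, hext]
  cases w <;> simp [xorBits]

theorem seq_init (x : Bits I) :
    (seq A B).init x = Sum.elim (A.init x) fun _ => false := by
  rw [init, init, ← extend_trans_inl, Sum.elim_lam_const_lam_const]

theorem seq_unitary_mulVec (Ψ : Bits (A.Wire ⊕ B.Wire) → ℂ) (u : Bits A.Wire) (v : Bits B.Wire) :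
    (gatesUnitary (seq A B).gates).mulVec Ψ (Sum.elim u v) =
      (gatesUnitary B.gates).mulVec (fun b => (gatesUnitary A.gates).mulVec
        (fun z => Ψ (Sum.elim z (xorBits b (B.init (u ∘ A.out))))) u) v := by
  change (gatesUnitary (W := A.Wire ⊕ B.Wire) (_ ++ _ ++ _)).mulVec Ψ (Sum.elim u v) = _
  simp only [gatesUnitary_append, gatesUnitary_map, ← Matrix.mulVec_mulVec,
    extendOp_inr_mulVec, copyGates_mulVec, extendOp_inl_mulVec]

theorem seq_finalState (x : Bits I) (u : Bits A.Wire) (v : Bits B.Wire) :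
    (seq A B).finalState x (Sum.elim u v) = A.finalState x u * B.finalState (u ∘ A.out) v := by
  have hA (b : Bits B.Wire) : (gatesUnitary A.gates).mulVec
      (fun z => (Pi.single (Sum.elim (A.init x) fun _ => false) 1 : Bits (A.Wire ⊕ B.Wire) → ℂ)
        (Sum.elim z b)) u =
      A.finalState x u * (Pi.single (fun _ => false) 1 : Bits B.Wire → ℂ) b := by
    rw [finalState, Matrix.mulVec, Matrix.mulVec, dotProduct, dotProduct, Finset.sum_mul]
    refine Finset.sum_congr rfl fun z _ => ?_
    simp only [Pi.single_apply, Sum.elim_eq_iff, ite_and, mul_ite, mul_one, mul_zero]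
    split_ifs <;> rfl
  have hzero (b : Bits B.Wire) : xorBits b (B.init (u ∘ A.out)) = (fun _ => false) ↔
      b = B.init (u ∘ A.out) := by simp [funext_iff, xorBits]
  calc (seq A B).finalState x (Sum.elim u v)
      = (gatesUnitary B.gates).mulVec (fun b => A.finalState x u *
          (Pi.single (fun _ => false) 1 : Bits B.Wire → ℂ) (xorBits b (B.init (u ∘ A.out)))) v := by
        rw [finalState, seq_init, seq_unitary_mulVec]
        simp only [hA]
    _ = (gatesUnitary B.gates).mulVec
          (A.finalState x u • Pi.single (B.init (u ∘ A.out)) 1) v := by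
        congr 1
        funext b
        simp only [Pi.single_apply, hzero, Pi.smul_apply, smul_eq_mul]
    _ = A.finalState x u * B.finalState (u ∘ A.out) v := by
        rw [Matrix.mulVec_smul, Pi.smul_apply, smul_eq_mul, ← finalState]

theorem seq_prob [Fintype I] [DecidableEq J] (x : Bits I) (z : Bits O) :
    (seq A B).prob x z = ∑ y, A.prob x y * B.prob y z := by
  classical
  simp only [prob_eq_sum_normSq, Finset.sum_mul, ite_mul, zero_mul]
  rw [Finset.sum_comm, ← Finset.sum_congr rfl fun u _ => (Finset.sum_ite_eq _ _ _).symm]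
  refine (sum_elim_eq_sum _).trans (Finset.sum_congr rfl fun u _ => ?_)
  rw [if_pos (Finset.mem_univ _), Finset.mul_sum]
  refine Finset.sum_congr rfl fun v _ => ?_
  rw [seq_finalState, Complex.normSq_mul, mul_ite, mul_zero]
  rfl

theorem seq_size : (seq A B).size ≤ 2 * A.size + B.size := by
  have hJ : Fintype.card J ≤ Fintype.card A.Wire := Fintype.card_le_of_embedding A.out
  have hW : Fintype.card (seq A B).Wire = Fintype.card A.Wire + Fintype.card B.Wire :=
    Fintype.card_sum
  have hG : (seq A B).gates.length = A.gates.length + Fintype.card J + B.gates.length := by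
    simp [seq, List.length_flatMap, add_assoc]
  simp only [size, hW, hG]
  omega

end Seq

section Par

variable {I O : Type} (C : Circuit I O) (ι J : Type)

/-- The wires of the `i`-th copy. -/
def parEmb (W : Type) (i : ι) : W ↪ (ι × W) ⊕ J :=
  ⟨fun w => Sum.inl (i, w), fun _ _ h => (Prod.mk.inj (Sum.inl.inj h)).2⟩

/-- Copies of `C` indexed by `ι`, next to untouched wires `J`. -/
abbrev par [Fintype ι] [DecidableEq ι] [Fintype J] [DecidableEq J] :
    Circuit ((ι × I) ⊕ J) ((ι × O) ⊕ J) where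
  Wire := (ι × C.Wire) ⊕ J
  gates := Finset.univ.toList.flatMap fun i => C.gates.map (Gate.map (parEmb ι J C.Wire i))
  inp := ((Function.Embedding.refl ι).prodMap C.inp).sumMap (.refl J)
  out := ((Function.Embedding.refl ι).prodMap C.out).sumMap (.refl J)

variable {ι J}

/-- The product state with amplitudes `ψ i` on the `i`-th block of wires and `χ` on `J`. -/
def prodVec {W : Type} [Fintype ι] (ψ : ι → Bits W → ℂ) (χ : Bits J → ℂ) :
    Bits ((ι × W) ⊕ J) → ℂ :=
  fun w => (∏ i, ψ i (w ∘ parEmb ι J W i)) * χ (w ∘ Sum.inr)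

section ProdVec

variable {W : Type}

theorem extend_parEmb_comp [DecidableEq ι] (i k : ι) (z : Bits W) (v : Bits ((ι × W) ⊕ J)) :
    Function.extend (parEmb ι J W i) z v ∘ parEmb ι J W k =
      Function.update (fun k => v ∘ parEmb ι J W k) i z k := by
  rcases eq_or_ne k i with rfl | hk
  · rw [Function.update_self, Function.extend_comp (parEmb ι J W k).injective]
  · rw [Function.update_of_ne hk]
    refine funext fun w => eqOn_extend _ z v ?_
    rintro ⟨w', h⟩
    exact hk (Prod.mk.inj (Sum.inl.inj h)).1.symm

theorem prodVec_single [Fintype ι] [DecidableEq (Bits W)]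
    [DecidableEq (Bits J)] [DecidableEq (Bits ((ι × W) ⊕ J))] (x : Bits ((ι × W) ⊕ J)) :
    prodVec (fun i => Pi.single (x ∘ parEmb ι J W i) 1) (Pi.single (x ∘ Sum.inr) 1) =
      Pi.single x 1 := by
  classical
  funext w
  have hw : w = x ↔ (∀ i, w ∘ parEmb ι J W i = x ∘ parEmb ι J W i) ∧
      w ∘ Sum.inr = x ∘ Sum.inr := by
    simp only [funext_iff, Sum.forall, Prod.forall]
    rfl
  simp only [prodVec, Pi.single_apply, hw, Fintype.prod_ite_zero, Finset.prod_const_one, mul_ite,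
    mul_one, mul_zero, ite_and]
  split_ifs <;> rfl

variable [Fintype W] [DecidableEq W] [Fintype ι] [DecidableEq ι] [Fintype J] [DecidableEq J]

theorem extendOp_parEmb_mulVec_prodVec (i : ι) (A : Op W) (ψ : ι → Bits W → ℂ)
    (χ : Bits J → ℂ) :
    (extendOp (parEmb ι J W i) A).mulVec (prodVec ψ χ) =
      prodVec (Function.update ψ i (A.mulVec (ψ i))) χ := by
  funext v
  have hinr (z : Bits W) :
      Function.extend (parEmb ι J W i) z v ∘ Sum.inr = v ∘ Sum.inr :=
    funext fun j => eqOn_extend _ z v (by rintro ⟨w, h⟩; cases h)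
  have hsplit (φ : Bits W → ℂ) (z : Bits W) :
      ∏ k, Function.update ψ i φ k (Function.update (fun k => v ∘ parEmb ι J W k) i z k) =
        φ z * ∏ k ∈ Finset.univ.erase i, ψ k (v ∘ parEmb ι J W k) := by
    rw [← Finset.mul_prod_erase _ _ (Finset.mem_univ i), Function.update_self,
      Function.update_self]
    congr 1
    refine Finset.prod_congr rfl fun k hk => ?_
    rw [Function.update_of_ne (Finset.ne_of_mem_erase hk),
      Function.update_of_ne (Finset.ne_of_mem_erase hk)]
  have hleft (z : Bits W) := hsplit (ψ i) z
  have hright := hsplit (A.mulVec (ψ i)) (v ∘ parEmb ι J W i)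
  simp only [Function.update_eq_self] at hleft
  rw [Function.update_eq_self i (fun k => v ∘ parEmb ι J W k)] at hright
  rw [extendOp_mulVec, prodVec, hright, Matrix.mulVec, Matrix.mulVec, dotProduct, dotProduct,
    Finset.sum_mul, Finset.sum_mul]
  refine Finset.sum_congr rfl fun z _ => ?_
  simp only [prodVec, extend_parEmb_comp, hleft, hinr]
  ring

theorem gatesUnitary_flatMap_mulVec_prodVec (gs : List (Gate W)) {l : List ι} (hl : l.Nodup)
    (ψ : ι → Bits W → ℂ) (χ : Bits J → ℂ) :
    (gatesUnitary (l.flatMap fun i => gs.map (Gate.map (parEmb ι J W i)))).mulVec (prodVec ψ χ) =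
      prodVec (fun i => if i ∈ l then (gatesUnitary gs).mulVec (ψ i) else ψ i) χ := by
  induction l generalizing ψ with
  | nil => simp
  | cons i l ih =>
    rw [List.nodup_cons] at hl
    rw [List.flatMap_cons, gatesUnitary_append, gatesUnitary_map, ← Matrix.mulVec_mulVec,
      extendOp_parEmb_mulVec_prodVec, ih hl.2]
    congr 1
    funext k
    rcases eq_or_ne k i with rfl | hk
    · simp [hl.1]
    · simp [hk]

end ProdVec

variable [Fintype ι] [DecidableEq ι] [Fintype J] [DecidableEq J]

theorem par_init (x : Bits ((ι × I) ⊕ J)) : (par C ι J).init x =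
    Sum.elim (fun p => C.init (fun a => x (.inl (p.1, a))) p.2) (x ∘ Sum.inr) := by
  symm
  rw [init, eq_extend_iff]
  constructor
  · funext a
    rcases a with ⟨i, a⟩ | j
    exacts [C.init_apply_inp (fun a => x (.inl (i, a))) a, rfl]
  · rintro (⟨i, w⟩ | j) hw
    · exact C.init_of_notMem_range _ fun ⟨a, ha⟩ =>
        hw ⟨.inl (i, a), congrArg (fun w => Sum.inl (i, w)) ha⟩
    · exact absurd ⟨.inr j, rfl⟩ hw

theorem par_finalState (x : Bits ((ι × I) ⊕ J)) :
    (par C ι J).finalState x =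
      prodVec (fun i => C.finalState fun a => x (.inl (i, a))) (Pi.single (x ∘ Sum.inr) 1) := by
  rw [finalState, ← prodVec_single, gatesUnitary_flatMap_mulVec_prodVec C.gates
    (Finset.nodup_toList _), par_init, Sum.elim_comp_inr]
  simp only [Finset.mem_toList, Finset.mem_univ, if_true, finalState]
  rfl

theorem par_prob [Fintype I] (x : Bits ((ι × I) ⊕ J)) (y : Bits ((ι × O) ⊕ J)) :
    (par C ι J).prob x y = (∏ i, C.prob (fun a => x (.inl (i, a))) fun a => y (.inl (i, a))) *
      if x ∘ Sum.inr = y ∘ Sum.inr then 1 else 0 := by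
  classical
  have hout (u : Bits ((ι × C.Wire) ⊕ J)) : u ∘ (par C ι J).out = y ↔
      (∀ i, (u ∘ parEmb ι J C.Wire i) ∘ C.out = fun o => y (.inl (i, o))) ∧
        u ∘ Sum.inr = y ∘ Sum.inr := by
    simp only [funext_iff, Sum.forall, Prod.forall]
    rfl
  have hblock (u : ι → Bits C.Wire) (v : Bits J) (i : ι) :
      Sum.elim (fun p : ι × C.Wire => u p.1 p.2) v ∘ parEmb ι J C.Wire i = u i := rfl
  have hterm (u : ι → Bits C.Wire) (v : Bits J) :
      (if (Sum.elim (fun p => u p.1 p.2) v : Bits ((ι × C.Wire) ⊕ J)) ∘ (par C ι J).out = y then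
        Complex.normSq ((par C ι J).finalState x (Sum.elim (fun p => u p.1 p.2) v)) else 0) =
      (∏ i, if u i ∘ C.out = fun o => y (.inl (i, o)) then
        Complex.normSq (C.finalState (fun a => x (.inl (i, a))) (u i)) else 0) *
        if v = y ∘ Sum.inr then if v = x ∘ Sum.inr then 1 else 0 else 0 := by
    rw [hout, par_finalState, prodVec, Complex.normSq_mul, map_prod, Fintype.prod_ite_zero]
    simp only [Sum.elim_comp_inr, Pi.single_apply, apply_ite Complex.normSq, map_one, map_zero,
      ite_and, ite_mul, zero_mul, mul_ite, mul_zero, hblock]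
    split_ifs <;> rfl
  calc (par C ι J).prob x y
      = ∑ u : ι → Bits C.Wire, ∑ v : Bits J, (∏ i, if u i ∘ C.out = fun o => y (.inl (i, o)) then
          Complex.normSq (C.finalState (fun a => x (.inl (i, a))) (u i)) else 0) *
          if v = y ∘ Sum.inr then if v = x ∘ Sum.inr then 1 else 0 else 0 := by
        rw [prob_eq_sum_normSq, sum_elim_eq_sum, ← (Equiv.curry ι C.Wire Bool).symm.sum_comp]
        exact Finset.sum_congr rfl fun u _ => Finset.sum_congr rfl fun v _ => hterm u v
    _ = _ := by
        rw [← Finset.sum_mul_sum, Finset.sum_ite_eq', if_pos (Finset.mem_univ _)]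
        simp only [prob_eq_sum_normSq, eq_comm (a := x ∘ Sum.inr), Fintype.prod_sum]

theorem par_size : (par C ι J).size = Fintype.card ι * C.size + 2 * Fintype.card J := by
  have hW : Fintype.card (par C ι J).Wire = Fintype.card ι * Fintype.card C.Wire + Fintype.card J :=
    Fintype.card_sum.trans (congrArg (· + _) (Fintype.card_prod _ _))
  have hG : (par C ι J).gates.length = Fintype.card ι * C.gates.length := by
    simp [par, List.length_flatMap]
  simp only [size, hW, hG]
  ring

end Par

variable {I I' O : Type}

/-- Relabelling of the input wires. -/
abbrev reindexInp (C : Circuit I O) (e : I' ≃ I) : Circuit I' O where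
  Wire := C.Wire
  gates := C.gates
  inp := e.toEmbedding.trans C.inp
  out := C.out

theorem reindexInp_prob [Fintype I] [Fintype I'] (C : Circuit I O) (e : I' ≃ I) (x : Bits I')
    (y : Bits O) : (C.reindexInp e).prob x y = C.prob (x ∘ e.symm) y := by
  classical
  have hinit : (C.reindexInp e).init x = C.init (x ∘ e.symm) := by
    refine (eq_extend_iff C.inp _ _ _).2 ⟨funext fun i => ?_, fun w hw => ?_⟩
    · simpa using (C.reindexInp e).init_apply_inp x (e.symm i)
    · refine (C.reindexInp e).init_of_notMem_range x ?_
      rintro ⟨i, rfl⟩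
      exact hw ⟨e i, rfl⟩
  simp only [prob_eq_sum_normSq, finalState, hinit]

/-- One uniform bit. -/
abbrev coin : Circuit Empty Unit where
  Wire := Unit
  gates := [.H ()]
  inp := Function.Embedding.ofIsEmpty
  out := .refl Unit

theorem coin_prob (x : Bits Empty) (y : Bits Unit) : coin.prob x y = 1 / 2 := by
  classical
  rw [prob_eq_sum_normSq, Finset.sum_eq_single y]
  · have hinit : coin.init x = fun _ => false := funext fun _ => by simp [init]
    rw [if_pos (by rfl), finalState, hinit, gatesUnitary_cons, gatesUnitary_nil, Matrix.one_mul,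
      Gate.H_mulVec]
    have hfalse : Function.update y () false = fun _ => false := by ext; simp
    have htrue : Function.update y () true ≠ fun _ => false := fun h => by
      simpa using congrFun h ()
    rw [hfalse, Pi.single_eq_same, Pi.single_eq_of_ne htrue]
    simp [Complex.normSq_ofReal]
  · exact fun u _ hu => if_neg hu
  · simp

end Circuit

/-! ### Boolean networks -/

/-- Monomials of degree at most two over `𝔽₂` in the values of wires, the nodes of the Boolean
networks that are compiled to circuits. -/
inductive Monomial (W : Type) : Type
  | one : Monomial W
  | var (a : W) : Monomial W
  | and (a b : W) : Monomial W

namespace Monomial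

variable {W : Type}

/-- The value of a monomial. -/
def eval : Monomial W → Bits W → Bool
  | one, _ => true
  | var a, u => u a
  | and a b, u => u a && u b

/-- The wires occurring in a monomial. -/
def vars : Monomial W → List W
  | one => []
  | var a => [a]
  | and a b => [a, b]

theorem eval_congr (T : Monomial W) {u v : Bits W} (h : ∀ a ∈ T.vars, u a = v a) :
    T.eval u = T.eval v := by
  cases T with
  | one => rfl
  | var a => exact h a (by simp [vars])
  | and a b => simp only [eval, h a (by simp [vars]), h b (by simp [vars])]

variable [DecidableEq W]

/-- Gates adding the value of a monomial to the wire `t`, provided `t` does not occur in it (the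
other cases have to be given some value). -/
def gates (t : W) : Monomial W → List (Gate W)
  | one => notGates t
  | var a => if h : a ≠ t then [.CNOT a t h] else []
  | and a b =>
    if h : a ≠ t ∧ b ≠ t then
      if hab : a = b then [.CNOT a t h.1] else toffoliGates a b t hab h.1 h.2
    else []

theorem length_gates_le (t : W) (T : Monomial W) : (T.gates t).length ≤ 37 := by
  cases T with
  | one => simp [gates, length_notGates]
  | var a =>
    simp only [gates]
    split_ifs <;> simp
  | and a b =>
    simp only [gates]
    split_ifs <;> simp [length_toffoliGates]

theorem gates_mulVec [Fintype W] {t : W} {T : Monomial W} (ht : t ∉ T.vars) (Ψ : Bits W → ℂ)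
    (x : Bits W) : (gatesUnitary (T.gates t)).mulVec Ψ x = Ψ (flipIf t T.eval x) := by
  cases T with
  | one => exact notGates_mulVec t Ψ x
  | var a =>
    have ha : a ≠ t := fun e => ht (by simp [vars, e])
    rw [gates, dif_pos ha, gatesUnitary_cons, gatesUnitary_nil, one_mul]
    exact Gate.CNOT_mulVec a t ha Ψ x
  | and a b =>
    have h : a ≠ t ∧ b ≠ t :=
      ⟨fun e => ht (by simp [vars, e]), fun e => ht (by simp [vars, e])⟩
    rw [gates, dif_pos h]
    split_ifs with hab
    · subst hab
      rw [gatesUnitary_cons, gatesUnitary_nil, one_mul, Gate.CNOT_mulVec]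
      simp only [flipIf, eval, Bool.and_self]
    · exact toffoliGates_mulVec a b t hab h.1 h.2 Ψ x

end Monomial

/-- The value of a sum of monomials. -/
def evalSum {W : Type} (l : List (Monomial W)) (u : Bits W) : Bool :=
  l.foldr (fun T b => T.eval u ^^ b) false

section EvalSum

variable {W : Type}

@[simp] theorem evalSum_nil (u : Bits W) : evalSum [] u = false := rfl

@[simp] theorem evalSum_cons (T : Monomial W) (l : List (Monomial W)) (u : Bits W) :
    evalSum (T :: l) u = (T.eval u ^^ evalSum l u) := rfl

theorem evalSum_congr {l : List (Monomial W)} {u v : Bits W}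
    (h : ∀ T ∈ l, ∀ a ∈ T.vars, u a = v a) : evalSum l u = evalSum l v := by
  induction l with
  | nil => rfl
  | cons T l ih =>
    rw [evalSum_cons, evalSum_cons, T.eval_congr (h T List.mem_cons_self),
      ih fun T' hT' => h T' (List.mem_cons_of_mem T hT')]

variable [DecidableEq W]

theorem evalSum_update {l : List (Monomial W)} {t : W} (ht : ∀ T ∈ l, t ∉ T.vars) (u : Bits W)
    (b : Bool) : evalSum l (Function.update u t b) = evalSum l u :=
  evalSum_congr fun T hT _ ha => Function.update_of_ne (ne_of_mem_of_not_mem ha (ht T hT)) _ _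

variable [Fintype W]

theorem gatesUnitary_flatMap_gates_mulVec {t : W} {l : List (Monomial W)}
    (ht : ∀ T ∈ l, t ∉ T.vars) (Ψ : Bits W → ℂ) (x : Bits W) :
    (gatesUnitary (l.flatMap (Monomial.gates t))).mulVec Ψ x = Ψ (flipIf t (evalSum l) x) := by
  induction l generalizing Ψ with
  | nil => simp [flipIf]
  | cons T l ih =>
    have hT : T.eval (flipIf t (evalSum l) x) = T.eval x := T.eval_congr fun a ha =>
      Function.update_of_ne (ne_of_mem_of_not_mem ha (ht T List.mem_cons_self)) _ _
    rw [List.flatMap_cons, gatesUnitary_append, ← Matrix.mulVec_mulVec,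
      ih fun T' hT' => ht T' (List.mem_cons_of_mem T hT'),
      Monomial.gates_mulVec (ht T List.mem_cons_self), flipIf, hT]
    simp only [flipIf, Function.update_self, Function.update_idem, evalSum_cons, Bool.xor_assoc,
      Bool.xor_comm (evalSum l x)]

theorem gatesUnitary_flatMap_gates_mulVec_single {t : W} {l : List (Monomial W)}
    (ht : ∀ T ∈ l, t ∉ T.vars) (u : Bits W) :
    (gatesUnitary (l.flatMap (Monomial.gates t))).mulVec (Pi.single u 1)
      = Pi.single (flipIf t (evalSum l) u) 1 := by
  rw [← single_comp_involutive (flipIf_involutive t _ (evalSum_update ht))]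
  exact funext (gatesUnitary_flatMap_gates_mulVec ht _)

end EvalSum

section Netlist

variable {W : Type} {rk : W → ℕ} {terms : W → List (Monomial W)}

theorem exists_pairwise_rank_le [Finite W] (rk : W → ℕ) :
    ∃ ws : List W, ws.Nodup ∧ (∀ w, w ∈ ws) ∧ ws.Pairwise (fun a b => rk a ≤ rk b) := by
  have := Fintype.ofFinite W
  let r : W → W → Prop := fun a b => rk a ≤ rk b
  have : Std.Total r := ⟨fun a b => le_total (rk a) (rk b)⟩
  have : IsTrans W r := ⟨fun a b c => le_trans⟩
  have : DecidableRel r := fun a b => Nat.decLe _ _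
  refine ⟨Finset.univ.toList.insertionSort r, ?_, fun w => ?_, List.pairwise_insertionSort r _⟩
  · exact (List.perm_insertionSort r _).nodup_iff.2 (Finset.nodup_toList _)
  · simp [List.mem_insertionSort]

/-- Gates evaluating the sums of monomials `terms w` on the wires `w ∈ ws`, one after the other. -/
def netlistGates [DecidableEq W] (terms : W → List (Monomial W)) (ws : List W) : List (Gate W) :=
  ws.flatMap fun w => (terms w).flatMap (Monomial.gates w)

theorem length_netlistGates_le [DecidableEq W] {L : ℕ} (hL : ∀ w, (terms w).length ≤ L)
    (ws : List W) : (netlistGates terms ws).length ≤ ws.length * (37 * L) := by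
  rw [netlistGates, List.length_flatMap]
  refine (List.sum_le_card_nsmul _ (37 * L) fun n hn => ?_).trans (by simp)
  obtain ⟨w, -, rfl⟩ := List.mem_map.1 hn
  rw [List.length_flatMap]
  refine (List.sum_le_card_nsmul _ 37 fun n hn => ?_).trans ?_
  · obtain ⟨T, -, rfl⟩ := List.mem_map.1 hn
    exact T.length_gates_le w
  · rw [List.length_map, smul_eq_mul, mul_comm]
    exact Nat.mul_le_mul_left _ (hL w)

variable [Fintype W]

theorem netlistGates_mulVec_single [DecidableEq W]
    (hrk : ∀ w, ∀ T ∈ terms w, ∀ a ∈ T.vars, rk a < rk w) {u v : Bits W} {ws : List W}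
    (hnd : ws.Nodup) (hsort : ws.Pairwise fun a b => rk a ≤ rk b)
    (hmem : ∀ w ∈ ws, v w = (u w ^^ evalSum (terms w) v)) (hnotMem : ∀ w ∉ ws, v w = u w) :
    (gatesUnitary (netlistGates terms ws)).mulVec (Pi.single u 1) = Pi.single v 1 := by
  induction ws generalizing u with
  | nil =>
    obtain rfl : v = u := funext fun w => hnotMem w List.not_mem_nil
    rw [netlistGates, List.flatMap_nil, gatesUnitary_nil, Matrix.one_mulVec]
  | cons w ws ih =>
    rw [List.nodup_cons] at hnd
    rw [List.pairwise_cons] at hsort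
    have hw : ∀ T ∈ terms w, w ∉ T.vars := fun T hT hmem => (hrk w T hT w hmem).false
    have hsum : evalSum (terms w) v = evalSum (terms w) u := evalSum_congr fun T hT a ha => by
      have hlt := hrk w T hT a ha
      refine hnotMem a fun hmem => ?_
      rcases List.mem_cons.1 hmem with rfl | hmem
      exacts [hlt.false, hlt.not_ge (hsort.1 a hmem)]
    rw [netlistGates, List.flatMap_cons, gatesUnitary_append, ← Matrix.mulVec_mulVec,
      gatesUnitary_flatMap_gates_mulVec_single hw]
    refine ih hnd.2 hsort.2 (fun a ha => ?_) fun a ha => ?_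
    · rw [flipIf, Function.update_of_ne (ne_of_mem_of_not_mem ha hnd.1)]
      exact hmem a (List.mem_cons_of_mem w ha)
    · rcases eq_or_ne a w with rfl | hne
      · rw [flipIf, Function.update_self, hmem a List.mem_cons_self, hsum]
      · rw [flipIf, Function.update_of_ne hne]
        exact hnotMem a fun h => (List.mem_cons.1 h).elim hne ha

theorem exists_netlist_circuit {I O : Type} [Fintype I] [DecidableEq (Bits O)] (inp : I ↪ W)
    (out : O ↪ W) {L : ℕ} (hL : ∀ w, (terms w).length ≤ L)
    (hrk : ∀ w, ∀ T ∈ terms w, ∀ a ∈ T.vars, rk a < rk w) (val : Bits I → Bits W)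
    (hval : ∀ x w, val x w =
      (Function.extend inp x (fun _ => false) w ^^ evalSum (terms w) (val x))) :
    ∃ C : Circuit I O, C.size ≤ Fintype.card W * (37 * L + 2) ∧
      ∀ x y, C.prob x y = if y = val x ∘ out then 1 else 0 := by
  classical
  obtain ⟨ws, hnd, hmem, hsort⟩ := exists_pairwise_rank_le rk
  refine ⟨Circuit.mk W (netlistGates terms ws) inp out, ?_, fun x y => ?_⟩
  · have := length_netlistGates_le hL ws
    have := Nat.mul_le_mul_right (37 * L) (hnd.length_le_card)
    simp only [Circuit.size]
    linarith
  · have hstate : (Circuit.mk W (netlistGates terms ws) inp out).finalState x =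
        Pi.single (val x) 1 :=
      netlistGates_mulVec_single hrk hnd hsort (fun w _ => hval x w) fun w hw => absurd (hmem w) hw
    rw [Circuit.prob_eq_sum_normSq, hstate, Finset.sum_eq_single (val x)]
    · simp [eq_comm]
    · intro u _ hu
      simp [hu]
    · simp

end Netlist

namespace PolyBounded

variable {f g : ℕ → ℕ}

theorem mono (hg : PolyBounded g) (h : ∀ n, f n ≤ g n) : PolyBounded f :=
  let ⟨p, hp⟩ := hg
  ⟨p, fun n => (h n).trans (hp n)⟩

theorem add (hf : PolyBounded f) (hg : PolyBounded g) : PolyBounded fun n => f n + g n :=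
  let ⟨p, hp⟩ := hf
  let ⟨p', hp'⟩ := hg
  ⟨p + p', fun n => by simpa using add_le_add (hp n) (hp' n)⟩

theorem mul (hf : PolyBounded f) (hg : PolyBounded g) : PolyBounded fun n => f n * g n :=
  let ⟨p, hp⟩ := hf
  let ⟨p', hp'⟩ := hg
  ⟨p * p', fun n => by simpa using Nat.mul_le_mul (hp n) (hp' n)⟩

theorem const (c : ℕ) : PolyBounded fun _ => c := ⟨Polynomial.C c, fun n => by simp⟩

theorem id : PolyBounded fun n => n := ⟨Polynomial.X, fun n => by simp⟩

end PolyBounded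

namespace IsQPT

variable {I J O : ℕ → Type} [∀ n, Fintype (I n)]

theorem congr {f g : ∀ n, Bits (I n) → Bits (O n) → ℝ} (hf : IsQPT f)
    (h : ∀ n x y, f n x y = g n x y) : IsQPT g :=
  let ⟨C, hC, hprob⟩ := hf
  ⟨C, hC, fun n x y => (hprob n x y).trans (h n x y)⟩

theorem comp [∀ n, Fintype (J n)] [∀ n, DecidableEq (J n)]
    {f : ∀ n, Bits (I n) → Bits (J n) → ℝ} {g : ∀ n, Bits (J n) → Bits (O n) → ℝ}
    (hf : IsQPT f) (hg : IsQPT g) : IsQPT fun n x z => ∑ y, f n x y * g n y z := by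
  obtain ⟨A, hA, hA'⟩ := hf
  obtain ⟨B, hB, hB'⟩ := hg
  refine ⟨fun n => (A n).seq (B n),
    (((PolyBounded.const 2).mul hA).add hB).mono fun n => (A n).seq_size (B n), fun n x z => ?_⟩
  rw [Circuit.seq_prob]
  simp_rw [hA', hB']

theorem par {ι : ℕ → Type} [∀ n, Fintype (ι n)] [∀ n, Fintype (J n)]
    {f : ∀ n, Bits (I n) → Bits (O n) → ℝ} (hf : IsQPT f)
    (hι : PolyBounded fun n => Fintype.card (ι n)) (hJ : PolyBounded fun n => Fintype.card (J n)) :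
    IsQPT (I := fun n => (ι n × I n) ⊕ J n) (O := fun n => (ι n × O n) ⊕ J n) fun n x y =>
      (∏ i, f n (fun a => x (.inl (i, a))) fun a => y (.inl (i, a))) *
        if x ∘ Sum.inr = y ∘ Sum.inr then 1 else 0 := by
  classical
  obtain ⟨C, hC, hC'⟩ := hf
  refine ⟨fun n => (C n).par (ι n) (J n), ((hι.mul hC).add ((PolyBounded.const 2).mul hJ)).mono
    fun n => ((C n).par_size).le, fun n x y => ?_⟩
  rw [Circuit.par_prob]
  simp_rw [hC']

end IsQPT

section IsQPT

variable {I O : ℕ → Type} [∀ n, Fintype (I n)]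

theorem isQPT_coins {R : ℕ → Type} [∀ n, Fintype (R n)]
    (hI : PolyBounded fun n => Fintype.card (I n)) (hR : PolyBounded fun n => Fintype.card (R n)) :
    IsQPT (I := I) (O := fun n => (R n × Unit) ⊕ I n) fun n x y =>
      unif (R n) * if x = y ∘ Sum.inr then 1 else 0 := by
  classical
  let e : ∀ n, I n ≃ (R n × Empty) ⊕ I n := fun n => (Equiv.emptySum (R n × Empty) (I n)).symm
  refine ⟨fun n => (Circuit.coin.par (R n) (I n)).reindexInp (e n),
    ((hR.mul (PolyBounded.const Circuit.coin.size)).add ((PolyBounded.const 2).mul hI)).mono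
      fun n => (Circuit.par_size (ι := R n) (J := I n) Circuit.coin).le, fun n x y => ?_⟩
  have hx : (x ∘ (e n).symm) ∘ Sum.inr = x := rfl
  rw [Circuit.reindexInp_prob, Circuit.par_prob, hx]
  simp [Circuit.coin_prob, unif]

theorem extend_inl_apply_inl {α β γ : Type*} (x : α → γ) (d : α ⊕ β → γ) (a : α) :
    Function.extend (Function.Embedding.inl : α ↪ α ⊕ β) x d (.inl a) = x a :=
  Function.Embedding.inl.injective.extend_apply x d a

theorem extend_inl_apply_inr {α β γ : Type*} (x : α → γ) (d : α ⊕ β → γ) (b : β) :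
    Function.extend (Function.Embedding.inl : α ↪ α ⊕ β) x d (.inr b) = d (.inr b) :=
  Function.extend_apply' _ _ _ fun ⟨_, h⟩ => Sum.inl_ne_inr h

theorem evalSum_map_var {V W : Type} (f : V → W) (l : List V) (u : Bits W) :
    evalSum (l.map fun a => .var (f a)) u = l.foldr (fun a b => u (f a) ^^ b) false := by
  induction l with
  | nil => rfl
  | cons a l ih => rw [List.map_cons, evalSum_cons, ih]; rfl

theorem isQPT_of_linear [∀ n, Fintype (O n)]
    (hI : PolyBounded fun n => Fintype.card (I n)) (hO : PolyBounded fun n => Fintype.card (O n))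
    {L : ℕ} (vars : ∀ n, O n → List (I n)) (hL : ∀ n o, (vars n o).length ≤ L) :
    IsQPT fun n (x : Bits (I n)) (y : Bits (O n)) =>
      if y = (fun o => (vars n o).foldr (fun a b => x a ^^ b) false) then 1 else 0 := by
  classical
  have hcircuit : ∀ n, ∃ C : Circuit (I n) (O n),
      C.size ≤ Fintype.card (I n ⊕ O n) * (37 * L + 2) ∧ ∀ x y, C.prob x y =
        if y = (fun o => (vars n o).foldr (fun a b => x a ^^ b) false) then 1 else 0 := by
    intro n
    refine exists_netlist_circuit (W := I n ⊕ O n) .inl .inr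
      (rk := Sum.elim (fun _ => 0) fun _ => 1)
      (terms := Sum.elim (fun _ => []) fun o => (vars n o).map fun a => .var (.inl a)) ?_ ?_
      (fun x => Sum.elim x fun o => (vars n o).foldr (fun a b => x a ^^ b) false) ?_
    · rintro (_ | o)
      · simp
      · simpa using hL n o
    · rintro (_ | o) T hT
      · simp at hT
      · obtain ⟨a, -, rfl⟩ := List.mem_map.1 hT
        simp [Monomial.vars]
    · rintro x (_ | _)
      · rw [extend_inl_apply_inl, Sum.elim_inl, Sum.elim_inl, evalSum_nil, Bool.xor_false]
      · rw [extend_inl_apply_inr, Sum.elim_inr, Sum.elim_inr, Bool.false_xor, evalSum_map_var]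
        rfl
  choose C hsize hprob using hcircuit
  refine ⟨C, ((hI.add hO).mul (PolyBounded.const (37 * L + 2))).mono fun n => ?_, hprob⟩
  simpa using hsize n

end IsQPT

/-! ### Majority -/

section MatchCount

variable {n : ℕ} {α : Type*} [DecidableEq α]

/-- The number of positions before `j` at which `v` takes the same value as at `i`. The majority
network computes these numbers in unary. -/
def matchCount (v : Fin n → α) (i : Fin n) (j : ℕ) : ℕ :=
  (Finset.univ.filter fun j' : Fin n => j'.val < j ∧ v j' = v i).card

theorem matchCount_zero (v : Fin n → α) (i : Fin n) : matchCount v i 0 = 0 := by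
  simp [matchCount]

theorem matchCount_succ (v : Fin n → α) (i j : Fin n) :
    matchCount v i (j.val + 1) = matchCount v i j.val + if v i = v j then 1 else 0 := by
  split_ifs with h
  · have hinsert : (Finset.univ.filter fun j' : Fin n => j'.val < j.val + 1 ∧ v j' = v i) =
        insert j (Finset.univ.filter fun j' : Fin n => j'.val < j.val ∧ v j' = v i) := by
      ext a
      grind
    rw [matchCount, hinsert, Finset.card_insert_of_notMem (by simp), matchCount]
  · rw [matchCount, matchCount, add_zero]
    congr 1
    ext a
    grind

theorem matchCount_mono (v : Fin n → α) (i : Fin n) : Monotone (matchCount v i) :=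
  fun _ _ h => Finset.card_le_card (Finset.monotone_filter_right _
    fun _ _ ha => ⟨ha.1.trans_le h, ha.2⟩)

theorem matchCount_congr (v : Fin n → α) {i i' : Fin n} (h : v i = v i') :
    matchCount v i = matchCount v i' := by
  simp only [funext_iff, matchCount, h, implies_true]

theorem matchCount_top (v : Fin n → α) (i : Fin n) :
    matchCount v i n = (Finset.univ.filter fun j => v j = v i).card := by
  simp [matchCount]

theorem matchCount_self_lt (v : Fin n → α) {i : Fin n} {j : ℕ} (h : i.val < j) :
    matchCount v i i < matchCount v i j := by
  have hsucc := matchCount_succ v i i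
  rw [if_pos rfl] at hsucc
  have hmono : matchCount v i (i.val + 1) ≤ matchCount v i j := matchCount_mono v i h
  omega

theorem matchCount_self_injOn (v : Fin n → α) {i j : Fin n} (hv : v i = v j)
    (h : matchCount v i i = matchCount v j j) : i = j := by
  by_contra hne
  rcases lt_or_gt_of_ne hne with hlt | hlt
  · have := matchCount_self_lt v hlt
    rw [matchCount_congr v hv] at this h
    omega
  · have := matchCount_self_lt v hlt
    rw [← matchCount_congr v hv] at this h
    omega

theorem exists_matchCount_self_eq (v : Fin n → α) {a : Fin n} {h k : ℕ} (hk : k ≤ n)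
    (hlt : h < matchCount v a k) : ∃ i : Fin n, matchCount v i i = h := by
  induction k with
  | zero => simp [matchCount_zero] at hlt
  | succ k ih =>
    rcases lt_or_ge h (matchCount v a k) with hlt' | hge
    · exact ih (by omega) hlt'
    · have hsucc := matchCount_succ v a ⟨k, hk⟩
      have hv : v a = v ⟨k, hk⟩ := by
        by_contra hv
        rw [if_neg hv] at hsucc
        dsimp only at hsucc
        omega
      rw [if_pos hv] at hsucc
      dsimp only at hsucc
      refine ⟨⟨k, hk⟩, ?_⟩
      rw [← matchCount_congr v hv]
      dsimp only
      omega

theorem card_filter_eq_add_card_filter_eq_le (v : Fin n → α) {w w' : α} (h : w ≠ w') :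
    (Finset.univ.filter fun i => v i = w).card + (Finset.univ.filter fun i => v i = w').card
      ≤ n := by
  rw [← Finset.card_union_of_disjoint (Finset.disjoint_filter.2 fun i _ hw hw' =>
    h (hw.symm.trans hw'))]
  simpa using Finset.card_le_univ (_ : Finset (Fin n))

end MatchCount

section Majority

variable {n : ℕ} {I : Type} [DecidableEq (Bits I)] (v : Fin n → Bits I)

theorem majority_eq_of_lt_two_mul_card {w : Bits I}
    (h : n < 2 * (Finset.univ.filter fun i => v i = w).card) : majority v = w := by
  classical
  have hex : ∃ w : Bits I, n < 2 * (Finset.univ.filter fun i => v i = w).card := ⟨w, by convert h⟩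
  have hmaj : n < 2 * (Finset.univ.filter fun i => v i = majority v).card := by
    rw [majority, dif_pos (by convert hex)]
    convert hex.choose_spec
  by_contra hne
  have := card_filter_eq_add_card_filter_eq_le v hne
  omega

theorem majority_eq_false_of_forall_two_mul_card_le
    (h : ∀ w : Bits I, 2 * (Finset.univ.filter fun i => v i = w).card ≤ n) :
    majority v = fun _ => false := by
  rw [majority, dif_neg]
  rintro ⟨w, hw⟩
  have hw' : n < 2 * (Finset.univ.filter fun i => v i = w).card := by convert hw
  exact hw'.not_ge (h w)

theorem majority_eq_of_matchCount_self_eq {i : Fin n} (h : matchCount v i i = n / 2) :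
    majority v = v i := by
  refine majority_eq_of_lt_two_mul_card v ?_
  have := matchCount_self_lt v i.isLt
  rw [← matchCount_top]
  omega

theorem majority_eq_false_of_matchCount_self_ne (h : ∀ i, matchCount v i i ≠ n / 2) :
    majority v = fun _ => false := by
  refine majority_eq_false_of_forall_two_mul_card_le v fun w => ?_
  by_contra! hw
  obtain ⟨a, ha⟩ := Finset.card_pos.1 (Nat.pos_of_mul_pos_left (pos_of_gt hw))
  obtain rfl : v a = w := (Finset.mem_filter.1 ha).2
  rw [← matchCount_top] at hw
  obtain ⟨i, hi⟩ := exists_matchCount_self_eq v le_rfl (by omega : n / 2 < matchCount v a n)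
  exact h i hi

end Majority

section EvalSumMap

variable {W α : Type} {u : Bits W} {l : List α} {f : α → Monomial W}

theorem evalSum_map_eq_false (h : ∀ i ∈ l, (f i).eval u = false) :
    evalSum (l.map f) u = false := by
  induction l with
  | nil => rfl
  | cons a l ih =>
    rw [List.map_cons, evalSum_cons, h a List.mem_cons_self,
      ih fun i hi => h i (List.mem_cons_of_mem a hi), Bool.false_xor]

theorem evalSum_map_eq_single (hl : l.Nodup) {i₀ : α} (h₀ : i₀ ∈ l)
    (h : ∀ i ∈ l, i ≠ i₀ → (f i).eval u = false) : evalSum (l.map f) u = (f i₀).eval u := by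
  induction l with
  | nil => exact absurd h₀ List.not_mem_nil
  | cons a l ih =>
    rw [List.nodup_cons] at hl
    have htail : ∀ i ∈ l, i ≠ i₀ → (f i).eval u = false :=
      fun i hi => h i (List.mem_cons_of_mem a hi)
    rw [List.map_cons, evalSum_cons]
    rcases eq_or_ne a i₀ with rfl | hne
    · rw [evalSum_map_eq_false fun i hi => htail i hi (ne_of_mem_of_not_mem hi hl.1),
        Bool.xor_false]
    · rw [h a List.mem_cons_self hne,
        ih hl.2 (List.mem_of_ne_of_mem hne.symm h₀) htail, Bool.false_xor]

end EvalSumMap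

section MajorityNetwork

/-- The wires of the majority network for `n` strings of `ℓ` bits: the bits of the strings, the
agreement of two strings on a prefix, the number of strings of an initial segment agreeing with a
given one (in unary), and the result. -/
abbrev MajWire (n ℓ : ℕ) : Type :=
  (Fin n × Fin ℓ) ⊕ (Fin n × Fin n × Fin (ℓ + 1)) ⊕ (Fin n × Fin (n + 1) × Fin (n + 1)) ⊕ Fin ℓ

variable {n ℓ : ℕ}

/-- The wire for bit `t` of string `i`. -/
abbrev MajWire.str (i : Fin n) (t : Fin ℓ) : MajWire n ℓ := .inl (i, t)

/-- The wire for the agreement of strings `i` and `j` on the first `t` bits. -/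
abbrev MajWire.agree (i j : Fin n) (t : Fin (ℓ + 1)) : MajWire n ℓ := .inr (.inl (i, j, t))

/-- The wire stating that exactly `s` of the first `j` strings agree with string `i`. -/
abbrev MajWire.count (i : Fin n) (j s : Fin (n + 1)) : MajWire n ℓ := .inr (.inr (.inl (i, j, s)))

/-- The wire for bit `t` of the result. -/
abbrev MajWire.res (t : Fin ℓ) : MajWire n ℓ := .inr (.inr (.inr t))

/-- Sum of monomials for `MajWire.agree i j`; `b = c` is `1 + b + c` over `𝔽₂`. -/
def agreeTerms (i j : Fin n) : Fin (ℓ + 1) → List (Monomial (MajWire n ℓ)) :=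
  Fin.cases [.one] fun t => [.var (.agree i j t.castSucc),
    .and (.agree i j t.castSucc) (.str i t), .and (.agree i j t.castSucc) (.str j t)]

/-- Sum of monomials for `MajWire.count i j s`: the count over the first `j + 1` strings is `s` if
the count over the first `j` is `s` and string `j` differs from string `i`, or the count is `s - 1`
and they agree. -/
def countTerms (i : Fin n) (j s : Fin (n + 1)) : List (Monomial (MajWire n ℓ)) :=
  Fin.cases (if s = 0 then [.one] else [])
    (fun j => [.var (.count i j.castSucc s),
      .and (.agree i j (Fin.last ℓ)) (.count i j.castSucc s)] ++
      (Fin.cases [] (fun s => [.and (.agree i j (Fin.last ℓ)) (.count i j.castSucc s.castSucc)]) s :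
        List (Monomial (MajWire n ℓ)))) j

/-- The middle `n / 2` of the count register. -/
def halfIdx (n : ℕ) : Fin (n + 1) := ⟨n / 2, by omega⟩

/-- Sum of monomials for `MajWire.res t`; at most one of them is nonzero, since at most one string
is preceded by exactly `n / 2` copies of itself. -/
def resTerms (t : Fin ℓ) : List (Monomial (MajWire n ℓ)) :=
  (List.finRange n).map fun i => .and (.count i i.castSucc (halfIdx n)) (.str i t)

/-- The sums of monomials of the majority network. -/
def majTerms : MajWire n ℓ → List (Monomial (MajWire n ℓ))
  | .inl _ => []
  | .inr (.inl (i, j, t)) => agreeTerms i j t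
  | .inr (.inr (.inl (i, j, s))) => countTerms i j s
  | .inr (.inr (.inr t)) => resTerms t

/-- The order of evaluation of the wires of the majority network. -/
def majRank : MajWire n ℓ → ℕ
  | .inl _ => 0
  | .inr (.inl (_, _, t)) => 1 + t
  | .inr (.inr (.inl (_, j, _))) => ℓ + 2 + j
  | .inr (.inr (.inr _)) => ℓ + n + 4

/-- The values of the wires of the majority network. -/
def majVal (v : Fin n → Bits (Fin ℓ)) : Bits (MajWire n ℓ)
  | .inl (i, t) => v i t
  | .inr (.inl (i, j, t)) => decide (∀ t' : Fin ℓ, t'.val < t.val → v i t' = v j t')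
  | .inr (.inr (.inl (i, j, s))) => decide (matchCount v i j = s)
  | .inr (.inr (.inr t)) => majority v t

variable (v : Fin n → Bits (Fin ℓ))

theorem majVal_agree_last (i j : Fin n) :
    majVal v (.agree i j (Fin.last ℓ)) = decide (v i = v j) := by
  simp [majVal, funext_iff]

theorem majVal_agree (i j : Fin n) (t : Fin (ℓ + 1)) :
    majVal v (.agree i j t) = evalSum (agreeTerms i j t) (majVal v) := by
  induction t using Fin.cases with
  | zero => simp [majVal, agreeTerms, Monomial.eval]
  | succ t =>
    have hsucc : (∀ t' : Fin ℓ, t'.val < t.val + 1 → v i t' = v j t') ↔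
        (∀ t' : Fin ℓ, t'.val < t.val → v i t' = v j t') ∧ v i t = v j t := by
      simp only [Nat.lt_succ_iff_lt_or_eq, or_imp, forall_and, Fin.val_inj, forall_eq]
    simp only [majVal, agreeTerms, Monomial.eval, Fin.cases_succ, evalSum_cons, evalSum_nil,
      Fin.val_succ, Fin.val_castSucc, hsucc, Bool.decide_and]
    generalize decide (∀ t' : Fin ℓ, t'.val < t.val → v i t' = v j t') = b
    cases b <;> cases v i t <;> cases v j t <;> rfl

theorem majVal_count (i : Fin n) (j s : Fin (n + 1)) :
    majVal v (.count i j s) = evalSum (countTerms i j s) (majVal v) := by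
  have hval (j s : Fin (n + 1)) : majVal v (.count i j s) = decide (matchCount v i j = s) := rfl
  induction j using Fin.cases with
  | zero =>
    rw [hval, Fin.val_zero, matchCount_zero, countTerms, Fin.cases_zero]
    rcases eq_or_ne s 0 with rfl | hs
    · simp [Monomial.eval]
    · simp [hs, eq_comm (a := 0)]
  | succ j =>
    induction s using Fin.cases with
    | zero =>
      by_cases hij : v i = v j
      · simp [countTerms, Monomial.eval, majVal_agree_last, hval, matchCount_succ, hij]
      · simp only [countTerms, Fin.cases_succ, Fin.cases_zero, List.append_nil, evalSum_cons,
          evalSum_nil, Monomial.eval, majVal_agree_last, hval, Fin.val_succ, Fin.val_castSucc,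
          matchCount_succ, Fin.val_zero, hij, if_false, add_zero, decide_false, Bool.false_and,
          Bool.xor_false]
        rfl
    | succ s =>
      by_cases hij : v i = v j <;>
        simp [countTerms, Monomial.eval, majVal_agree_last, hval, matchCount_succ, hij]

theorem majVal_res (t : Fin ℓ) : majVal v (.res t) = evalSum (resTerms t) (majVal v) := by
  have heval (i : Fin n) : (Monomial.and (.count i i.castSucc (halfIdx n)) (.str i t)).eval
      (majVal v) = (decide (matchCount v i i = n / 2) && v i t) := rfl
  change majority v t = _
  by_cases h : ∃ i : Fin n, matchCount v i i = n / 2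
  · obtain ⟨i, hi⟩ := h
    have hmaj := majority_eq_of_matchCount_self_eq v hi
    rw [resTerms, evalSum_map_eq_single (List.nodup_finRange n) (List.mem_finRange i), heval, hmaj]
    · simp [hi]
    · intro j _ hji
      have hj : matchCount v j j ≠ n / 2 := fun hj => hji <| matchCount_self_injOn v
        ((majority_eq_of_matchCount_self_eq v hj).symm.trans hmaj) (hj.trans hi.symm)
      simp [heval, hj]
  · push Not at h
    rw [resTerms, evalSum_map_eq_false, majority_eq_false_of_matchCount_self_ne v h]
    intro i _
    simp [heval, h i]

theorem length_majTerms_le (w : MajWire n ℓ) : (majTerms w).length ≤ n + 3 := by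
  rcases w with _ | ⟨i, j, t⟩ | ⟨i, j, s⟩ | t
  · simp [majTerms]
  · induction t using Fin.cases <;> simp [majTerms, agreeTerms]
  · induction j using Fin.cases
    · simp only [majTerms, countTerms, Fin.cases_zero]
      split_ifs <;> simp
    · induction s using Fin.cases <;> simp [majTerms, countTerms]
  · simp [majTerms, resTerms]

theorem majRank_lt_of_mem_vars (w : MajWire n ℓ) :
    ∀ T ∈ majTerms w, ∀ a ∈ T.vars, majRank a < majRank w := by
  rcases w with _ | ⟨i, j, t⟩ | ⟨i, j, s⟩ | t
  · simp [majTerms]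
  · induction t using Fin.cases <;>
      simp [-Sum.forall, -Prod.forall, majTerms, agreeTerms, Monomial.vars, majRank]
  · induction j using Fin.cases
    · simp only [majTerms, countTerms, Fin.cases_zero]
      split_ifs <;> simp [Monomial.vars]
    · induction s using Fin.cases <;>
        simp [-Sum.forall, -Prod.forall, majTerms, countTerms, Monomial.vars, majRank] <;> omega
  · intro T hT
    obtain ⟨i, -, rfl⟩ := List.mem_map.1 hT
    simp [-Sum.forall, -Prod.forall, Monomial.vars, majRank]
    omega

theorem exists_majority_circuit (n ℓ : ℕ) : ∃ C : Circuit (Fin n × Fin ℓ) (Fin ℓ),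
    C.size ≤ Fintype.card (MajWire n ℓ) * (37 * (n + 3) + 2) ∧ ∀ x y, C.prob x y =
      if y = majority (fun i t => x (i, t)) then 1 else 0 := by
  refine exists_netlist_circuit (W := MajWire n ℓ) .inl ⟨.res, fun a b h => by simpa using h⟩
    length_majTerms_le majRank_lt_of_mem_vars (fun x => majVal fun i t => x (i, t)) ?_
  rintro x (p | ⟨i, j, t⟩ | ⟨i, j, s⟩ | t)
  · rw [extend_inl_apply_inl]
    exact (Bool.xor_false _).symm
  all_goals rw [extend_inl_apply_inr, Bool.false_xor]
  exacts [majVal_agree _ i j t, majVal_count _ i j s, majVal_res _ t]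

theorem isQPT_majority {ℓ : ℕ → ℕ} (hℓ : PolyBounded ℓ) :
    IsQPT (I := fun n => Fin n × Fin (ℓ n)) (O := fun n => Fin (ℓ n)) fun _ x y =>
      if y = majority (fun i t => x (i, t)) then 1 else 0 := by
  choose C hsize hprob using fun n => exists_majority_circuit n (ℓ n)
  refine ⟨C, PolyBounded.mono ?_ hsize, hprob⟩
  simp only [Fintype.card_sum, Fintype.card_prod, Fintype.card_fin]
  have h1 := PolyBounded.const 1
  have hid := PolyBounded.id
  exact ((hid.mul hℓ).add ((hid.mul (hid.mul (hℓ.add h1))).add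
    ((hid.mul ((hid.add h1).mul (hid.add h1))).add hℓ))).mul
    (((PolyBounded.const 37).mul (hid.add (PolyBounded.const 3))).add (PolyBounded.const 2))

end MajorityNetwork

/-! ### The algorithms of the scheme -/

namespace PolyBounded

variable {A B : ℕ → Type} [∀ n, Fintype (A n)] [∀ n, Fintype (B n)]

theorem card_fin {f : ℕ → ℕ} (hf : PolyBounded f) : PolyBounded fun n => Fintype.card (Fin (f n)) :=
  hf.mono fun n => by simp

theorem card_const (A : Type) [Fintype A] : PolyBounded fun _ => Fintype.card A :=
  const _

theorem card_sum (hA : PolyBounded fun n => Fintype.card (A n))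
    (hB : PolyBounded fun n => Fintype.card (B n)) :
    PolyBounded fun n => Fintype.card (A n ⊕ B n) :=
  (hA.add hB).mono fun n => by simp

theorem card_prod (hA : PolyBounded fun n => Fintype.card (A n))
    (hB : PolyBounded fun n => Fintype.card (B n)) :
    PolyBounded fun n => Fintype.card (A n × B n) :=
  (hA.mul hB).mono fun n => by simp

end PolyBounded

section Composition

variable {I J R O : ℕ → Type} [∀ n, Fintype (I n)]

theorem IsQPT.comp_det [∀ n, Fintype (J n)]
    {f : ∀ n, Bits (I n) → Bits (J n)} {g : ∀ n, Bits (J n) → Bits (O n) → ℝ} (hg : IsQPT g)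
    (hf : IsQPT fun n (x : Bits (I n)) (y : Bits (J n)) => if y = f n x then (1 : ℝ) else 0) :
    IsQPT fun n x z => g n (f n x) z := by
  classical exact (hf.comp hg).congr fun n x z => by simp

theorem sum_ite_comp_inr_mul {A B : Type} [Fintype A] [DecidableEq A] [Fintype B] [DecidableEq B]
    (b : Bits B) (g : Bits (A ⊕ B) → ℝ) :
    ∑ y : Bits (A ⊕ B), (if b = y ∘ Sum.inr then 1 else 0) * g y
      = ∑ a : Bits A, g (Sum.elim a b) := by
  rw [sum_elim_eq_sum]
  refine Finset.sum_congr rfl fun a _ => ?_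
  rw [Fintype.sum_eq_single b fun v hv => by simp [hv.symm]]
  simp

theorem IsQPT.withCoins [∀ n, Fintype (R n)] [∀ n, DecidableEq (R n)]
    {g : ∀ n, Bits ((R n × Unit) ⊕ I n) → Bits (O n) → ℝ} (hg : IsQPT g)
    (hI : PolyBounded fun n => Fintype.card (I n))
    (hR : PolyBounded fun n => Fintype.card (R n)) :
    IsQPT fun n x z => ∑ r : Bits (R n), unif (R n) * g n (Sum.elim (fun p => r p.1) x) z := by
  classical
  refine ((isQPT_coins hI hR).comp hg).congr fun n x z => ?_
  simp_rw [mul_assoc, ← Finset.mul_sum]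
  rw [sum_ite_comp_inr_mul x fun y => g n y z]
  congr 1
  exact Fintype.sum_equiv ((Equiv.prodPUnit (R n)).arrowCongr (Equiv.refl Bool)) _ _ fun _ => rfl

end Composition

namespace KeyedFun.QPT

variable {m ℓ : ℕ → ℕ} {F : KeyedFun m ℓ}

theorem polyBounded_inputLen (hF : F.QPT) : PolyBounded m := by
  obtain ⟨C, hC, -⟩ := hF
  refine hC.mono fun n => ?_
  have := Fintype.card_le_of_embedding (C n).inp
  simp only [Fintype.card_sum, Fintype.card_fin] at this
  simp only [Circuit.size]
  omega

theorem polyBounded_outputLen (hF : F.QPT) : PolyBounded ℓ := by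
  obtain ⟨C, hC, -⟩ := hF
  refine hC.mono fun n => ?_
  have := Fintype.card_le_of_embedding (C n).out
  simp only [Fintype.card_fin] at this
  simp only [Circuit.size]
  omega

theorem nonneg (hF : F.QPT) (n : ℕ) (k : Bits (Fin n)) (x : Bits (Fin (m n)))
    (y : Bits (Fin (ℓ n))) : 0 ≤ F n k x y := by
  obtain ⟨C, -, hC⟩ := hF
  exact (hC n (Sum.elim k x) y).subst ((C n).prob_nonneg _ _)

theorem sum_eq_one (hF : F.QPT) (n : ℕ) (k : Bits (Fin n)) (x : Bits (Fin (m n))) :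
    ∑ y, F n k x y = 1 := by
  obtain ⟨C, -, hC⟩ := hF
  exact (Finset.sum_congr rfl fun y _ => (hC n (Sum.elim k x) y).symm).trans ((C n).sum_prob _)

theorem blocks (hF : F.QPT) {J O : ℕ → Type} [∀ n, Fintype (J n)]
    [∀ n, DecidableEq (Bits (O n))] (hJ : PolyBounded fun n => Fintype.card (J n))
    {g : ∀ n, Bits ((Fin n × Fin (ℓ n)) ⊕ J n) → Bits (O n)}
    (hg : IsQPT fun n (x : Bits ((Fin n × Fin (ℓ n)) ⊕ J n)) (y : Bits (O n)) =>
      if y = g n x then (1 : ℝ) else 0) :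
    IsQPT (I := fun n => (Fin n × (Fin n ⊕ Fin (m n))) ⊕ J n) fun n x z =>
      ∑ y : Fin n → Bits (Fin (ℓ n)), (∏ i, F n (fun j => x (.inl (i, .inl j)))
        (fun t => x (.inl (i, .inr t))) (y i)) *
        if z = g n (Sum.elim (fun p => y p.1 p.2) (x ∘ Sum.inr)) then 1 else 0 := by
  classical
  have hpar := IsQPT.par (ι := fun n => Fin n) (J := J) hF PolyBounded.id.card_fin hJ
  refine (hpar.comp hg).congr fun n x z => ?_
  have hrot (a b c : ℝ) : a * b * c = b * (a * c) := by ring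
  simp_rw [hrot]
  rw [sum_ite_comp_inr_mul]
  exact Fintype.sum_equiv (Equiv.curry (Fin n) (Fin (ℓ n)) Bool) _ _ fun y => rfl

end KeyedFun.QPT

section SchemeQPT

variable {m ℓ : ℕ → ℕ} {F : KeyedFun m ℓ}

theorem isQPT_gen (F : KeyedFun m ℓ) :
    IsQPT (I := fun _ => Empty) (O := KeyReg) fun n _ k => (ske F).Gen n k := by
  have hkey : PolyBounded fun n => Fintype.card (KeyReg n) :=
    PolyBounded.id.card_fin.card_prod PolyBounded.id.card_fin
  have hcopy := isQPT_of_linear (I := fun n => (KeyReg n × Unit) ⊕ Empty) (O := KeyReg)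
    ((hkey.card_prod (PolyBounded.card_const Unit)).card_sum (PolyBounded.card_const Empty)) hkey
    (fun n o => [.inl (o, ())]) (L := 1) (by simp)
  refine (hcopy.withCoins (R := KeyReg) (PolyBounded.card_const Empty) hkey).congr fun n x k => ?_
  simp [ske]

theorem isQPT_enc (hF : F.QPT) : IsQPT (I := fun n => KeyReg n ⊕ Fin (ℓ n)) (O := CtReg m ℓ)
    fun n z c => (ske F).Enc n (z ∘ Sum.inl) (z ∘ Sum.inr) c := by
  have hn := PolyBounded.id.card_fin
  have hm := hF.polyBounded_inputLen.card_fin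
  have hℓ := hF.polyBounded_outputLen.card_fin
  have hin := (hn.card_prod hn).card_sum hℓ
  have hmask := isQPT_of_linear (I := fun n => (Fin n × Fin (ℓ n)) ⊕ (Fin (m n) ⊕ Fin (ℓ n)))
    (O := CtReg m ℓ) ((hn.card_prod hℓ).card_sum (hm.card_sum hℓ))
    (hm.card_sum (hn.card_prod hℓ)) (L := 2)
    (fun n => Sum.elim (fun t => [.inr (.inl t)]) fun p => [.inr (.inr p.2), .inl p])
    (by rintro n (t | p) <;> simp)
  have hroute := isQPT_of_linear (I := fun n => (Fin (m n) × Unit) ⊕ (KeyReg n ⊕ Fin (ℓ n)))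
    (O := fun n => (Fin n × (Fin n ⊕ Fin (m n))) ⊕ (Fin (m n) ⊕ Fin (ℓ n)))
    ((hm.card_prod (PolyBounded.card_const Unit)).card_sum hin)
    ((hn.card_prod (hn.card_sum hm)).card_sum (hm.card_sum hℓ)) (L := 1)
    (fun n => Sum.elim
      (fun p => Sum.elim (fun j => [.inr (.inl (p.1, j))]) (fun t => [.inl (t, ())]) p.2)
      (Sum.elim (fun t => [.inl (t, ())]) fun t => [.inr (.inr t)]))
    (by rintro n (⟨i, j | t⟩ | t | t) <;> simp)
  refine (((hF.blocks (hm.card_sum hℓ) hmask).comp_det hroute).withCoins hin hm).congr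
    fun n z c => ?_
  simp only [ske, Sum.elim_inl, Sum.elim_inr, List.foldr_cons, List.foldr_nil, Bool.xor_false,
    Function.comp_apply]
  refine Finset.sum_congr rfl fun r _ => congrArg _ <| Finset.sum_congr rfl fun y _ =>
    congrArg _ <| if_congr (Eq.congr_right ?_) rfl rfl
  funext o
  rcases o with t | p <;> simp [mkCt, xorBits]

theorem isQPT_dec (hF : F.QPT) :
    IsQPT (I := fun n => KeyReg n ⊕ CtReg m ℓ n) (O := fun n => Fin (ℓ n))
      fun n z msg => (ske F).Dec n (z ∘ Sum.inl) (z ∘ Sum.inr) msg := by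
  have hn := PolyBounded.id.card_fin
  have hm := hF.polyBounded_inputLen.card_fin
  have hblk := hn.card_prod hF.polyBounded_outputLen.card_fin
  have hunmask := isQPT_of_linear (I := fun n => (Fin n × Fin (ℓ n)) ⊕ (Fin n × Fin (ℓ n)))
    (O := fun n => Fin n × Fin (ℓ n)) (hblk.card_sum hblk) hblk (L := 2)
    (fun n p => [.inr p, .inl p]) (by simp)
  have hroute := isQPT_of_linear (I := fun n => KeyReg n ⊕ CtReg m ℓ n)
    (O := fun n => (Fin n × (Fin n ⊕ Fin (m n))) ⊕ (Fin n × Fin (ℓ n)))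
    ((hn.card_prod hn).card_sum (hm.card_sum hblk))
    ((hn.card_prod (hn.card_sum hm)).card_sum hblk) (L := 1)
    (fun n => Sum.elim
      (fun p => Sum.elim (fun j => [.inl (p.1, j)]) (fun t => [.inr (.inl t)]) p.2)
      fun p => [.inr (.inr p)])
    (by rintro n (⟨i, j | t⟩ | p) <;> simp)
  have hmaj := (isQPT_majority hF.polyBounded_outputLen).comp_det hunmask
  refine ((hF.blocks hblk hmaj).comp_det hroute).congr fun n z msg => ?_
  simp only [ske, Sum.elim_inl, Sum.elim_inr, List.foldr_cons, List.foldr_nil, Bool.xor_false,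
    Function.comp_apply]
  rfl

theorem ske_qpt (hF : F.QPT) : (ske F).QPT := ⟨isQPT_gen F, isQPT_enc hF, isQPT_dec hF⟩

end SchemeQPT

/-! ### Correctness -/

section Uniform

theorem sum_prod_apply {ι α R : Type*} [Fintype ι] [DecidableEq ι] [Fintype α] [CommSemiring R]
    (f : ι → α → R) : ∑ a : ι → α, ∏ i, f i (a i) = ∏ i, ∑ x, f i x := by
  rw [Finset.prod_univ_sum, Fintype.piFinset_univ]

theorem unif_nonneg (I : Type) [Fintype I] : 0 ≤ unif I := by
  unfold unif
  positivity

theorem sum_unif (I : Type) [Fintype I] [DecidableEq I] : ∑ _x : Bits I, unif I = 1 := by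
  simp [unif]

theorem unif_prod (I J : Type) [Fintype I] [Fintype J] : unif (I × J) = ∏ _i : I, unif J := by
  simp [unif, ← pow_mul, mul_comm]

theorem sum_prod_unif (ι I : Type) [Fintype ι] [DecidableEq ι] [Fintype I] [DecidableEq I] :
    ∑ _r : ι → Bits I, ∏ _j : ι, unif I = 1 := by
  rw [sum_prod_apply fun _ _ => unif I, sum_unif, Finset.prod_const_one]

theorem sum_unif_mul_prod {ι I : Type} [Fintype ι] [DecidableEq ι] [Fintype I] [DecidableEq I]
    (g : ι → Bits I → ℝ) :
    ∑ k : Bits (ι × I), unif (ι × I) * ∏ i, g i (fun j => k (i, j))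
      = ∏ i, ∑ κ : Bits I, unif I * g i κ := by
  rw [← sum_prod_apply fun i κ => unif I * g i κ]
  simp_rw [Finset.prod_mul_distrib, ← unif_prod]
  exact Fintype.sum_equiv (Equiv.curry ι I Bool) _ _ fun _ => rfl

end Uniform

section MismatchWeight

variable {α : Type*} [DecidableEq α]

/-- The weight of a pair of evaluations of one block. Decryption fails only if at most half of the
blocks agree, and then the product of the weights is at least `1`; but the expected weight of a
block is about `1 / 4`, as in a Chernoff bound. -/
def mismatchWeight (y y' : α) : ℝ := if y = y' then 1 / 4 else 4

theorem mismatchWeight_nonneg (y y' : α) : 0 ≤ mismatchWeight y y' := by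
  unfold mismatchWeight
  split_ifs <;> norm_num

theorem mismatchWeight_le (y y' : α) : mismatchWeight y y' ≤ 4 := by
  unfold mismatchWeight
  split_ifs <;> norm_num

theorem one_le_prod_mismatchWeight {ι : Type*} [Fintype ι] {y y' : ι → α}
    (h : 2 * (Finset.univ.filter fun i => y i = y' i).card ≤ Fintype.card ι) :
    1 ≤ ∏ i, mismatchWeight (y i) (y' i) := by
  have hcard := Finset.card_filter_add_card_filter_not (s := Finset.univ) fun i => y i = y' i
  rw [Finset.card_univ] at hcard
  simp only [mismatchWeight]
  rw [Finset.prod_ite, Finset.prod_const, Finset.prod_const]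
  set a := (Finset.univ.filter fun i => y i = y' i).card
  obtain ⟨d, hd⟩ := Nat.exists_eq_add_of_le
    (show a ≤ (Finset.univ.filter fun i => ¬ y i = y' i).card by omega)
  rw [hd, pow_add, ← mul_assoc, ← mul_pow]
  norm_num [one_le_pow₀]

variable [Fintype α] {p : α → ℝ}

theorem sum_sum_mul_mismatchWeight_le_four (hp : ∀ y, 0 ≤ p y) (hsum : ∑ y, p y = 1) :
    ∑ y, ∑ y', p y * p y' * mismatchWeight y y' ≤ 4 := by
  calc ∑ y, ∑ y', p y * p y' * mismatchWeight y y' ≤ ∑ y, ∑ y', p y * p y' * 4 := by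
        gcongr with y _ y' _
        exacts [mul_nonneg (hp y) (hp y'), mismatchWeight_le y y']
    _ = 4 := by simp only [← Finset.mul_sum, ← Finset.sum_mul, hsum, one_mul]

theorem sum_sum_mul_mismatchWeight_le (hp : ∀ y, 0 ≤ p y) (hsum : ∑ y, p y = 1) (y₀ : α) :
    ∑ y, ∑ y', p y * p y' * mismatchWeight y y' ≤ 1 / 4 + 15 / 2 * (1 - p y₀) := by
  have hle (y y') : p y * p y' * mismatchWeight y y' ≤
      p y * p y' * (31 / 4) - 15 / 4 * (p y * if y' = y₀ then p y' else 0)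
        - 15 / 4 * ((if y = y₀ then p y else 0) * p y') := by
    have := mul_nonneg (hp y) (hp y')
    unfold mismatchWeight
    split_ifs
    all_goals first | linarith | (exfalso; simp_all)
  refine (Finset.sum_le_sum fun y _ => Finset.sum_le_sum fun y' _ => hle y y').trans ?_
  simp only [Finset.sum_sub_distrib, ← Finset.mul_sum, ← Finset.sum_mul, hsum, Finset.sum_ite_eq',
    Finset.mem_univ, if_true]
  linarith

end MismatchWeight

section Correctness

variable {m ℓ : ℕ → ℕ} {F : KeyedFun m ℓ} {n : ℕ}

theorem xorBits_cancel_right {I : Type} (x y : Bits I) : xorBits (xorBits x y) y = x := by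
  funext i
  simp [xorBits]

theorem one_le_prod_mismatchWeight_of_ne_majority {msg : Bits (Fin (ℓ n))}
    {y y' : Fin n → Bits (Fin (ℓ n))}
    (h : msg ≠ majority fun i => xorBits (xorBits msg (y i)) (y' i)) :
    1 ≤ ∏ i, mismatchWeight (y i) (y' i) := by
  refine one_le_prod_mismatchWeight ?_
  by_contra! hlt
  refine h (majority_eq_of_lt_two_mul_card _ ?_).symm
  rw [Fintype.card_fin] at hlt
  refine hlt.trans_le (Nat.mul_le_mul_left 2 (Finset.card_le_card fun i hi => ?_))
  simp only [Finset.mem_filter, Finset.mem_univ, true_and] at hi ⊢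
  rw [hi, xorBits_cancel_right]

/-- The expectation of `w y y'` for two independent evaluations `y`, `y'` of `F` on `r` under the
same uniform key. -/
def blockExpectation (F : KeyedFun m ℓ) (n : ℕ) (r : Bits (Fin (m n)))
    (w : Bits (Fin (ℓ n)) → Bits (Fin (ℓ n)) → ℝ) : ℝ :=
  ∑ k : Bits (Fin n), unif (Fin n) * ∑ y, ∑ y', F n k r y * F n k r y' * w y y'

/-- The expectation of `φ y y'` for two independent evaluations `y`, `y'` of `F` on `r` under all
blocks of a uniform key of the encryption scheme. -/
def keyExpectation (F : KeyedFun m ℓ) {n : ℕ} (r : Bits (Fin (m n)))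
    (φ : (Fin n → Bits (Fin (ℓ n))) → (Fin n → Bits (Fin (ℓ n))) → ℝ) : ℝ :=
  ∑ k : Bits (KeyReg n), unif (KeyReg n) * ∑ y, ∑ y',
    (∏ i, F n (fun j => k (i, j)) r (y i) * F n (fun j => k (i, j)) r (y' i)) * φ y y'

theorem blockExpectation_one (hF : F.QPT) (r : Bits (Fin (m n))) :
    blockExpectation F n r (fun _ _ => 1) = 1 := by
  simp only [blockExpectation, mul_one, ← Finset.mul_sum, hF.sum_eq_one, sum_unif]

theorem blockExpectation_nonneg (hF : F.QPT) (r : Bits (Fin (m n)))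
    {w : Bits (Fin (ℓ n)) → Bits (Fin (ℓ n)) → ℝ} (hw : ∀ y y', 0 ≤ w y y') :
    0 ≤ blockExpectation F n r w :=
  Finset.sum_nonneg fun _ _ => mul_nonneg (unif_nonneg _) <| Finset.sum_nonneg fun _ _ =>
    Finset.sum_nonneg fun _ _ => mul_nonneg (mul_nonneg (hF.nonneg _ _ _ _) (hF.nonneg _ _ _ _))
      (hw _ _)

theorem blockExpectation_mismatchWeight_le (hF : F.QPT) {r : Bits (Fin (m n))} {μ : ℝ}
    {good : Finset (Bits (Fin n))} (hgood : 1 - μ ≤ good.card * unif (Fin n))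
    (h : ∀ k ∈ good, ∃ y : Bits (Fin (ℓ n)), 1 - μ ≤ F n k r y) :
    blockExpectation F n r mismatchWeight ≤ 1 / 4 + 23 / 2 * μ := by
  have hu := unif_nonneg (Fin n)
  have hμ : 0 ≤ μ := by
    have : (good.card : ℝ) * unif (Fin n) ≤ 1 := by
      rw [← sum_unif (Fin n), ← nsmul_eq_mul, ← Finset.sum_const]
      exact Finset.sum_le_univ_sum_of_nonneg fun _ => hu
    linarith
  have hkey (k : Bits (Fin n)) : ∑ y, ∑ y', F n k r y * F n k r y' * mismatchWeight y y' ≤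
      1 / 4 + 15 / 2 * μ + (4 - if k ∈ good then 4 else 0) := by
    split_ifs with hk
    · obtain ⟨y, hy⟩ := h k hk
      have := sum_sum_mul_mismatchWeight_le (hF.nonneg n k r) (hF.sum_eq_one n k r) y
      linarith
    · have := sum_sum_mul_mismatchWeight_le_four (hF.nonneg n k r) (hF.sum_eq_one n k r)
      linarith
  calc blockExpectation F n r mismatchWeight
      ≤ ∑ k : Bits (Fin n),
          unif (Fin n) * (1 / 4 + 15 / 2 * μ + (4 - if k ∈ good then 4 else 0)) :=
        Finset.sum_le_sum fun k _ => mul_le_mul_of_nonneg_left (hkey k) hu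
    _ = 1 / 4 + 15 / 2 * μ + 4 * (1 - good.card * unif (Fin n)) := by
        simp_rw [mul_add, mul_sub, Finset.sum_add_distrib, Finset.sum_sub_distrib,
          ← Finset.sum_mul, ← Finset.mul_sum, sum_unif]
        simp only [Finset.sum_ite_mem, Finset.univ_inter, Finset.sum_const, nsmul_eq_mul]
        ring
    _ ≤ 1 / 4 + 23 / 2 * μ := by linarith

theorem keyExpectation_prod (r : Bits (Fin (m n)))
    (w : Bits (Fin (ℓ n)) → Bits (Fin (ℓ n)) → ℝ) :
    keyExpectation F r (fun y y' => ∏ i, w (y i) (y' i)) = blockExpectation F n r w ^ n := by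
  have hpair (κ : Fin n → Bits (Fin n)) : ∑ y : Fin n → Bits (Fin (ℓ n)),
      ∑ y' : Fin n → Bits (Fin (ℓ n)), ∏ i, (F n (κ i) r (y i) * F n (κ i) r (y' i) *
        w (y i) (y' i)) = ∏ i, ∑ y, ∑ y', F n (κ i) r y * F n (κ i) r y' * w y y' := by
    rw [← sum_prod_apply fun i y => ∑ y', F n (κ i) r y * F n (κ i) r y' * w y y']
    exact Finset.sum_congr rfl fun y _ =>
      sum_prod_apply fun i y' => F n (κ i) r (y i) * F n (κ i) r y' * w (y i) y'
  simp_rw [keyExpectation, ← Finset.prod_mul_distrib, hpair]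
  rw [sum_unif_mul_prod fun _ k => ∑ y, ∑ y', F n k r y * F n k r y' * w y y', Finset.prod_const,
    Finset.card_univ, Fintype.card_fin, blockExpectation]

theorem keyExpectation_sub (r : Bits (Fin (m n)))
    (φ ψ : (Fin n → Bits (Fin (ℓ n))) → (Fin n → Bits (Fin (ℓ n))) → ℝ) :
    keyExpectation F r (fun y y' => φ y y' - ψ y y')
      = keyExpectation F r φ - keyExpectation F r ψ := by
  simp only [keyExpectation, mul_sub, Finset.sum_sub_distrib]

theorem keyExpectation_mono (hF : F.QPT) (r : Bits (Fin (m n)))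
    {φ ψ : (Fin n → Bits (Fin (ℓ n))) → (Fin n → Bits (Fin (ℓ n))) → ℝ}
    (h : ∀ y y', φ y y' ≤ ψ y y') : keyExpectation F r φ ≤ keyExpectation F r ψ := by
  unfold keyExpectation
  gcongr with k _ y _ y' _
  · exact unif_nonneg _
  · exact Finset.prod_nonneg fun i _ => mul_nonneg (hF.nonneg _ _ _ _) (hF.nonneg _ _ _ _)
  · exact h y y'

theorem sum_enc_mul (k : Bits (KeyReg n)) (msg : Bits (Fin (ℓ n))) (h : Bits (CtReg m ℓ n) → ℝ) :
    ∑ c, (ske F).Enc n k msg c * h c = ∑ r : Bits (Fin (m n)), unif (Fin (m n)) *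
      ∑ y : Fin n → Bits (Fin (ℓ n)), (∏ i, F n (fun j => k (i, j)) r (y i)) *
        h (mkCt r fun i => xorBits msg (y i)) := by
  simp only [ske, Finset.sum_mul, Finset.mul_sum]
  rw [Finset.sum_comm]
  refine Finset.sum_congr rfl fun r _ => ?_
  rw [Finset.sum_comm]
  exact Finset.sum_congr rfl fun y _ => by simp [mul_assoc]

theorem decryption_prob_eq (F : KeyedFun m ℓ) (msg : Bits (Fin (ℓ n))) :
    ∑ k, (ske F).Gen n k * ∑ c, (ske F).Enc n k msg c * (ske F).Dec n k c msg =
    ∑ r : Bits (Fin (m n)), unif (Fin (m n)) * keyExpectation F r fun y y' =>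
      if msg = majority (fun i => xorBits (xorBits msg (y i)) (y' i)) then 1 else 0 := by
  simp_rw [sum_enc_mul, keyExpectation, Finset.mul_sum]
  rw [Finset.sum_comm]
  refine Finset.sum_congr rfl fun r _ => Finset.sum_congr rfl fun k _ =>
    Finset.sum_congr rfl fun y _ => ?_
  simp only [ske, Finset.mul_sum]
  refine Finset.sum_congr rfl fun y' _ => ?_
  rw [Finset.prod_mul_distrib]
  have hblock (i : Fin n) : (fun t => mkCt r (fun i => xorBits msg (y i)) (.inr (i, t)))
      = xorBits msg (y i) := rfl
  have hnonce : mkCt r (fun i => xorBits msg (y i)) ∘ Sum.inl = r := rfl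
  simp only [hblock, hnonce]
  ring

theorem one_sub_pow_le_keyExpectation_decryption (hF : F.QPT) (r : Bits (Fin (m n)))
    (msg : Bits (Fin (ℓ n))) :
    1 - blockExpectation F n r mismatchWeight ^ n ≤ keyExpectation F r fun y y' =>
      if msg = majority (fun i => xorBits (xorBits msg (y i)) (y' i)) then 1 else 0 := by
  have hone : keyExpectation F r (fun _ _ => 1) = 1 := by
    simpa only [Finset.prod_const_one, blockExpectation_one hF, one_pow] using
      keyExpectation_prod (F := F) r fun _ _ => 1
  calc 1 - blockExpectation F n r mismatchWeight ^ n
      = keyExpectation F r fun y y' => 1 - ∏ i, mismatchWeight (y i) (y' i) := by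
        rw [keyExpectation_sub, hone, keyExpectation_prod]
    _ ≤ _ := keyExpectation_mono hF r fun y y' => by
        split_ifs with h
        · exact sub_le_self 1 (Finset.prod_nonneg fun i _ => mismatchWeight_nonneg (y i) (y' i))
        · exact sub_nonpos.2 (one_le_prod_mismatchWeight_of_ne_majority h)

theorem decryption_prob_nonneg (hF : F.QPT) (msg : Bits (Fin (ℓ n))) :
    0 ≤ ∑ k, (ske F).Gen n k * ∑ c, (ske F).Enc n k msg c * (ske F).Dec n k c msg := by
  rw [decryption_prob_eq]
  refine Finset.sum_nonneg fun r _ => mul_nonneg (unif_nonneg _) ?_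
  have hzero : keyExpectation F r (fun _ _ => 0) = 0 := by simp [keyExpectation]
  exact hzero.ge.trans (keyExpectation_mono hF r fun y y' => by split_ifs <;> norm_num)

theorem decryption_prob_ge (hF : F.QPT) (msg : Bits (Fin (ℓ n)))
    (hw : ∀ r, blockExpectation F n r mismatchWeight ≤ 1 / 2) :
    1 - (1 / 2) ^ n ≤
      ∑ k, (ske F).Gen n k * ∑ c, (ske F).Enc n k msg c * (ske F).Dec n k c msg := by
  have hpow (r : Bits (Fin (m n))) : blockExpectation F n r mismatchWeight ^ n ≤ (1 / 2) ^ n :=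
    pow_le_pow_left₀ (blockExpectation_nonneg hF r mismatchWeight_nonneg) (hw r) n
  rw [decryption_prob_eq]
  calc 1 - (1 / 2) ^ n = ∑ _r : Bits (Fin (m n)), unif (Fin (m n)) * (1 - (1 / 2) ^ n) := by
        rw [← Finset.sum_mul, sum_unif, one_mul]
    _ ≤ _ := Finset.sum_le_sum fun r _ => mul_le_mul_of_nonneg_left
        ((sub_le_sub_left (hpow r) 1).trans (one_sub_pow_le_keyExpectation_decryption hF r msg))
        (unif_nonneg _)

theorem ske_correct (hF : F.QPT) (hd : F.Pseudodeterministic) : (ske F).Correct := by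
  obtain ⟨c, hc, μ, hμ, hgood⟩ := hd
  have hμ0 : Tendsto μ atTop (nhds 0) :=
    hμ.trans_tendsto ((tendsto_rpow_neg_atTop hc).comp tendsto_natCast_atTop_atTop)
  have hsmall : ∀ᶠ n in atTop, μ n ≤ 1 / 46 := hμ0.eventually_le_const (by norm_num)
  refine ⟨fun n => if μ n ≤ 1 / 46 then (1 / 2) ^ n else 1, ?_, fun n msg => ?_⟩
  · have hpow : Negligible fun n => (1 / 2 : ℝ) ^ n := fun d =>
      tendsto_pow_const_mul_const_pow_of_abs_lt_one d (by norm_num [abs_of_pos])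
    refine SuperpolynomialDecay.congr' hpow ?_
    filter_upwards [hsmall] with n hn
    rw [if_pos hn]
  · dsimp only
    split_ifs with h
    · refine decryption_prob_ge hF msg fun r => ?_
      obtain ⟨good, hcard, hmax⟩ := hgood n r
      have := blockExpectation_mismatchWeight_le hF hcard hmax
      linarith
    · rw [sub_self]
      exact decryption_prob_nonneg hF msg

end Correctness

/-! ### Security -/

theorem mul_mul_conjTranspose_eq_submatrix {β : Type*} [Fintype β] {U : Matrix β β ℂ} {σ : β → β}
    (hU : ∀ Ψ x, U.mulVec Ψ x = Ψ (σ x)) (A : Matrix β β ℂ) :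
    U * A * U.conjTranspose = A.submatrix σ σ := by
  have hmul (B : Matrix β β ℂ) : U * B = B.submatrix σ id :=
    Matrix.ext fun x y => hU (fun z => B z y) x
  rw [← Matrix.conjTranspose_conjTranspose (U * A), ← Matrix.conjTranspose_mul, hmul, hmul]
  ext x y
  simp

namespace Circuit

section Mask

variable {M K V O : Type} (G : Circuit (M ⊕ K) O) (mask : Bits K)

/-- The wires flipped by `maskGates`. -/
def maskWires : Bits G.Wire := Function.extend (G.inp ∘ Sum.inr) mask fun _ => false

theorem maskWires_apply_inr (a : K) : maskWires G mask (G.inp (.inr a)) = mask a :=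
  (G.inp.injective.comp Sum.inr_injective).extend_apply mask _ a

theorem maskWires_of_notMem_range {w : G.Wire} (hw : w ∉ Set.range (G.inp ∘ Sum.inr)) :
    maskWires G mask w = false :=
  Function.extend_apply' mask _ w hw

theorem maskWires_apply_inl (a : M) : maskWires G mask (G.inp (.inl a)) = false :=
  maskWires_of_notMem_range G mask fun ⟨_, h⟩ => Sum.inr_ne_inl (G.inp.injective h)

variable [Fintype K]

open Classical in
theorem load_tensor_ket (ρ : Op M) (x : Bits K) (u v : Bits G.Wire) :
    G.load (tensor ρ (ket x)) u v =
      if Set.EqOn u (G.init (Sum.elim (fun _ => false) x)) (Set.range (G.inp ∘ Sum.inl))ᶜ ∧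
          Set.EqOn v (G.init (Sum.elim (fun _ => false) x)) (Set.range (G.inp ∘ Sum.inl))ᶜ then
        ρ (u ∘ G.inp ∘ Sum.inl) (v ∘ G.inp ∘ Sum.inl) else 0 := by
  have hfit (u : Bits G.Wire) :
      Set.EqOn u (G.init (Sum.elim (fun _ => false) x)) (Set.range (G.inp ∘ Sum.inl))ᶜ ↔
        Set.EqOn u (fun _ => false) (Set.range G.inp)ᶜ ∧ (u ∘ G.inp) ∘ Sum.inr = x := by
    refine ⟨fun h => ⟨fun w hw => ?_, funext fun a => ?_⟩, fun ⟨hzero, hx⟩ w hw => ?_⟩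
    · exact (h fun ⟨a, ha⟩ => hw ⟨_, ha⟩).trans (G.init_of_notMem_range _ hw)
    · exact (h fun ⟨b, hb⟩ => Sum.inl_ne_inr (G.inp.injective hb)).trans (G.init_apply_inp _ _)
    · by_cases hw' : w ∈ Set.range G.inp
      · obtain ⟨a | a, rfl⟩ := hw'
        · exact absurd ⟨a, rfl⟩ hw
        · exact (congrFun hx a).trans (G.init_apply_inp (Sum.elim _ x) (.inr a)).symm
      · exact (hzero hw').trans (G.init_of_notMem_range _ hw').symm
  rw [load_apply, tensor_ket_apply, ← ite_and]
  refine if_congr ?_ rfl rfl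
  rw [hfit, hfit]
  tauto

/-- The gates flipping the wires of the inputs selected by `mask`. -/
def maskGates : List (Gate G.Wire) :=
  Finset.univ.toList.flatMap fun a => if mask a then notGates (G.inp (.inr a)) else []

/-- The circuit `G`, whose classical inputs `K` are now obtained from a smaller register `V` by
padding with zeros along `f` and adding the hard-wired string `mask`. -/
abbrev maskInput (f : V ↪ K) : Circuit (M ⊕ V) O where
  Wire := G.Wire
  gates := maskGates G mask ++ G.gates
  inp := ((Function.Embedding.refl M).sumMap f).trans G.inp
  out := G.out

theorem maskGates_mulVec (Ψ : Bits G.Wire → ℂ) (x : Bits G.Wire) :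
    (gatesUnitary (maskGates G mask)).mulVec Ψ x = Ψ (xorBits x (maskWires G mask)) := by
  classical
  have hflip (a : K) (Ψ : Bits G.Wire → ℂ) (x : Bits G.Wire) :
      (gatesUnitary (if mask a then notGates (G.inp (.inr a)) else [])).mulVec Ψ x
        = Ψ (flipIf (G.inp (.inr a)) (fun _ => mask a) x) := by
    cases mask a
    · simp [flipIf]
    · exact notGates_mulVec _ Ψ x
  have h := gatesUnitary_flatMap_mulVec (Function.Embedding.inr.trans G.inp)
    (p := fun a _ => mask a) hflip (fun _ _ _ _ => rfl) (Finset.nodup_toList Finset.univ) Ψ x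
  simp only [Finset.mem_toList, Finset.mem_univ, decide_true, Bool.true_and] at h
  exact h

theorem maskInput_init (f : V ↪ K) (x : Bits V) :
    (maskInput G mask f).init (Sum.elim (fun _ => false) x) =
      xorBits (G.init (Sum.elim (fun _ => false)
        (xorBits (Function.extend f x fun _ => false) mask))) (maskWires G mask) := by
  symm
  refine (eq_extend_iff (maskInput G mask f).inp _ _ _).2 ?_
  refine ⟨funext fun a => ?_, fun w hw => ?_⟩
  · rcases a with a | a
    · exact congrArg₂ xor (G.init_apply_inp _ (.inl a)) (maskWires_apply_inl G mask a)
    · refine (congrArg₂ xor (G.init_apply_inp _ (.inr (f a)))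
        (maskWires_apply_inr G mask (f a))).trans ?_
      simp [xorBits, f.injective.extend_apply]
  · by_cases hw' : w ∈ Set.range G.inp
    · obtain ⟨a | a, rfl⟩ := hw'
      · exact absurd ⟨.inl a, rfl⟩ hw
      · have ha : ¬∃ b, f b = a := fun ⟨b, hb⟩ => hw ⟨.inr b, congrArg (G.inp ∘ Sum.inr) hb⟩
        refine (congrArg₂ xor (G.init_apply_inp _ (.inr a)) (maskWires_apply_inr G mask a)).trans ?_
        simp [xorBits, Function.extend_apply' _ _ _ ha]
    · exact congrArg₂ xor (G.init_of_notMem_range _ hw')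
        (maskWires_of_notMem_range G mask fun ⟨a, ha⟩ => hw' ⟨_, ha⟩)

theorem maskInput_load [Fintype V] (f : V ↪ K) (ρ : Op M) (x : Bits V) :
    ((maskInput G mask f).load (tensor ρ (ket x))).submatrix (xorBits · (maskWires G mask))
        (xorBits · (maskWires G mask)) =
      G.load (tensor ρ (ket (xorBits (Function.extend f x fun _ => false) mask))) := by
  classical
  have hmem (u : Bits G.Wire) :
      xorBits u (maskWires G mask) ∘ G.inp ∘ Sum.inl = u ∘ G.inp ∘ Sum.inl := funext fun a => by
    simp [xorBits, maskWires_apply_inl]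
  have hcancel (u v : Bits G.Wire) (s : Set G.Wire) :
      Set.EqOn (xorBits u (maskWires G mask)) (xorBits v (maskWires G mask)) s ↔ Set.EqOn u v s :=
    forall₂_congr fun w _ => Bool.xor_left_inj
  ext u v
  rw [Matrix.submatrix_apply, load_tensor_ket, load_tensor_ket, maskInput_init]
  exact if_congr (and_congr (hcancel _ _ _) (hcancel _ _ _)) (congrArg₂ ρ (hmem u) (hmem v)) rfl

theorem maskInput_run [Fintype V] (f : V ↪ K) (ρ : Op M) (x : Bits V) :
    (maskInput G mask f).run (tensor ρ (ket x)) =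
      G.run (tensor ρ (ket (xorBits (Function.extend f x fun _ => false) mask))) := by
  rw [run, run, ← maskInput_load,
    ← mul_mul_conjTranspose_eq_submatrix (maskGates_mulVec G mask)]
  change G.traceOut (gatesUnitary (maskGates G mask ++ G.gates) * _ *
    (gatesUnitary (maskGates G mask ++ G.gates)).conjTranspose) = _
  rw [gatesUnitary_append, Matrix.conjTranspose_mul, unitary_eq_gatesUnitary]
  simp only [Matrix.mul_assoc]

theorem length_maskGates_le : (maskGates G mask).length ≤ 6 * Fintype.card K := by
  have hle (a : K) : (if mask a then notGates (G.inp (.inr a)) else []).length ≤ 6 := by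
    split_ifs
    exacts [(length_notGates _).le, Nat.zero_le 6]
  rw [maskGates, List.length_flatMap]
  refine (List.sum_le_card_nsmul _ 6 ?_).trans ?_
  · simpa using fun a => hle a
  · simp [mul_comm]

theorem maskInput_size (f : V ↪ K) : (maskInput G mask f).size ≤ 7 * G.size := by
  have hgates := length_maskGates_le G mask
  have hcard : Fintype.card K ≤ Fintype.card G.Wire :=
    Fintype.card_le_of_embedding (Function.Embedding.inr.trans G.inp)
  simp only [size, List.length_append]
  lia

end Mask

end Circuit

theorem Negligible.polyBounded_mul {f : ℕ → ℝ} {q : ℕ → ℕ} (hf : Negligible f)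
    (hq : PolyBounded q) : Negligible fun n => q n * f n := by
  obtain ⟨p, hp⟩ := hq
  refine (SuperpolynomialDecay.polynomial_mul hf (p.map (Nat.castRingHom ℝ))).trans_abs_le
    fun n => ?_
  have heval : (p.map (Nat.castRingHom ℝ)).eval (n : ℝ) = ((p.eval n : ℕ) : ℝ) := by simp
  rw [abs_mul, abs_mul, heval, Nat.abs_cast, Nat.abs_cast]
  gcongr
  exact hp n

theorem pow_le_two_pow_of_log_le {n m d : ℕ} (hn : 0 < n)
    (h : d * Real.log n ≤ Real.log 2 * m) : (n : ℝ) ^ d ≤ 2 ^ m := by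
  rw [← Real.log_le_log_iff (by positivity) (by positivity), Real.log_pow, Real.log_pow,
    mul_comm (m : ℝ)]
  exact h

theorem negligible_unif {m : ℕ → ℕ}
    (hm : (fun n : ℕ => Real.log n) =o[atTop] fun n : ℕ => (m n : ℝ)) :
    Negligible fun n => unif (Fin (m n)) := by
  intro d
  have hlog : ∀ᶠ n : ℕ in atTop, ((d + 1 : ℕ) : ℝ) * Real.log n ≤ Real.log 2 * m n := by
    filter_upwards [hm.bound (c := Real.log 2 / (d + 1 : ℕ)) (by positivity)] with n hn
    rwa [Real.norm_of_nonneg (Real.log_natCast_nonneg n), Real.norm_natCast, div_mul_eq_mul_div,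
      le_div_iff₀' (by positivity)] at hn
  refine squeeze_zero' (Eventually.of_forall fun n => mul_nonneg (by positivity) (unif_nonneg _)) ?_
    (tendsto_inv_atTop_zero.comp (tendsto_natCast_atTop_atTop (R := ℝ)))
  filter_upwards [hlog, eventually_gt_atTop 0] with n hn hpos
  have hpow := pow_le_two_pow_of_log_le hpos hn
  rw [Function.comp_apply, unif, Fintype.card_fin, ← div_eq_mul_inv, div_le_iff₀ (by positivity),
    inv_mul_eq_div, le_div_iff₀ (by positivity), ← pow_succ]
  exact hpow

/- For each `n` take the choice with the largest value; `none` covers the `n` without choices. -/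
theorem exists_negligible_of_families {α : ℕ → Type*} [∀ n, Finite (α n)] (v : ∀ n, α n → ℝ)
    (h : ∀ c : ∀ n, Option (α n), ∃ ε, Negligible ε ∧ ∀ n a, c n = some a → v n a ≤ ε n) :
    ∃ ε, Negligible ε ∧ (∀ n, 0 ≤ ε n) ∧ ∀ n a, v n a ≤ ε n := by
  have hmax (n : ℕ) : ∃ c : Option (α n), ∀ a, ∃ a', c = some a' ∧ v n a ≤ v n a' := by
    rcases isEmpty_or_nonempty (α n) with hα | hα
    · exact ⟨none, fun a => hα.elim a⟩
    · obtain ⟨a', ha'⟩ := Finite.exists_max (v n)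
      exact ⟨some a', fun a => ⟨a', rfl, ha' a⟩⟩
  choose c hc using hmax
  obtain ⟨ε, hε, hle⟩ := h c
  refine ⟨fun n => |ε n|, SuperpolynomialDecay.trans_abs_le hε fun n => (abs_abs (ε n)).le,
    fun n => abs_nonneg _, fun n a => ?_⟩
  obtain ⟨a', ha', hmax⟩ := hc n a
  exact hmax.trans ((hle n a' ha').trans (le_abs_self _))

theorem abs_sum_mul_le {α : Type*} [Fintype α] {w f : α → ℝ} {B : ℝ} (hw : ∀ a, 0 ≤ w a)
    (hw1 : ∑ a, w a = 1) (hf : ∀ a, |f a| ≤ B) : |∑ a, w a * f a| ≤ B :=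
  calc |∑ a, w a * f a| ≤ ∑ a, w a * |f a| := by
        simpa only [abs_mul, abs_of_nonneg (hw _)] using
          Finset.abs_sum_le_sum_abs (fun a => w a * f a) Finset.univ
    _ ≤ ∑ a, w a * B := Finset.sum_le_sum fun a _ => mul_le_mul_of_nonneg_left (hf a) (hw a)
    _ = B := by rw [← Finset.sum_mul, hw1, one_mul]

section Hybrid

variable {α : Type*} [Fintype α] {n : ℕ}

theorem sum_fin_cons {β : Type*} [AddCommMonoid β] (f : (Fin (n + 1) → α) → β) :
    ∑ Y, f Y = ∑ z : α, ∑ Y : Fin n → α, f (Fin.cons z Y) := by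
  rw [← Fintype.sum_prod_type']
  exact (Equiv.sum_comp (Fin.consEquiv fun _ => α) f).symm

theorem sum_prod_sub_prod_succ {R : Type*} [CommRing R] (P U : α → R)
    (g : (Fin (n + 1) → α) → R) :
    ∑ Y : Fin (n + 1) → α, (∏ i, P (Y i) - ∏ i, U (Y i)) * g Y =
      ∑ Y : Fin n → α, (∏ i, P (Y i)) * ∑ z, (P z - U z) * g (Fin.cons z Y) +
      ∑ z, U z * ∑ Y : Fin n → α, (∏ i, P (Y i) - ∏ i, U (Y i)) * g (Fin.cons z Y) := by
  rw [sum_fin_cons]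
  simp_rw [Finset.mul_sum]
  rw [Finset.sum_comm (s := (Finset.univ : Finset (Fin n → α))), ← Finset.sum_add_distrib]
  refine Finset.sum_congr rfl fun z _ => ?_
  rw [← Finset.sum_add_distrib]
  refine Finset.sum_congr rfl fun Y _ => ?_
  simp only [Fin.prod_univ_succ, Fin.cons_zero, Fin.cons_succ]
  ring

theorem abs_sum_prod_sub_prod_le {P U : α → ℝ} (hP : ∀ a, 0 ≤ P a) (hU : ∀ a, 0 ≤ U a)
    (hP1 : ∑ a, P a = 1) (hU1 : ∑ a, U a = 1) {B : ℝ} (g : (Fin n → α) → ℝ)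
    (hg : ∀ i Y, |∑ z, (P z - U z) * g (Function.update Y i z)| ≤ B) :
    |∑ Y : Fin n → α, (∏ i, P (Y i) - ∏ i, U (Y i)) * g Y| ≤ n * B := by
  induction n with
  | zero => simp
  | succ n ih =>
    have hfirst : |∑ Y : Fin n → α, (∏ i, P (Y i)) * ∑ z, (P z - U z) * g (Fin.cons z Y)| ≤ B := by
      obtain ⟨z₀⟩ : Nonempty α := by
        by_contra h
        simp [not_nonempty_iff.1 h] at hP1
      refine abs_sum_mul_le (fun Y => Finset.prod_nonneg fun i _ => hP _) ?_ fun Y => ?_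
      · rw [sum_prod_apply fun _ => P, hP1, Finset.prod_const_one]
      · simpa only [Fin.update_cons_zero] using hg 0 (Fin.cons z₀ Y)
    have hrest : |∑ z, U z * ∑ Y : Fin n → α, (∏ i, P (Y i) - ∏ i, U (Y i)) * g (Fin.cons z Y)|
        ≤ n * B :=
      abs_sum_mul_le hU hU1 fun z => ih _ fun i Y => by
        simpa only [← Fin.cons_update] using hg i.succ (Fin.cons z Y)
    rw [sum_prod_sub_prod_succ]
    push_cast
    linarith [abs_add_le (∑ Y : Fin n → α, (∏ i, P (Y i)) * ∑ z, (P z - U z) * g (Fin.cons z Y))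
      (∑ z, U z * ∑ Y : Fin n → α, (∏ i, P (Y i) - ∏ i, U (Y i)) * g (Fin.cons z Y))]

end Hybrid

section Collision

variable {ι I : Type} [Fintype ι] [DecidableEq ι] [Fintype I] [DecidableEq I]

theorem sum_prod_unif_mul_eq {j j' : ι} (h : j ≠ j') :
    ∑ r : ι → Bits I, (∏ _i : ι, unif I) * (if r j = r j' then 1 else 0) = unif I := by
  calc ∑ r : ι → Bits I, (∏ _i : ι, unif I) * (if r j = r j' then (1 : ℝ) else 0)
      = ∑ x : Bits I, ∑ s : {i // i ≠ j} → Bits I,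
          (unif I * ∏ _i : {i // i ≠ j}, unif I) * if x = s ⟨j', h.symm⟩ then 1 else 0 := by
        rw [← Fintype.sum_prod_type', Fintype.prod_eq_mul_prod_subtype_ne (fun _ => unif I) j]
        exact Fintype.sum_equiv (Equiv.funSplitAt j (Bits I)) _ _ fun r => rfl
    _ = ∑ _s : {i // i ≠ j} → Bits I, unif I * ∏ _i : {i // i ≠ j}, unif I := by
        rw [Finset.sum_comm]
        simp
    _ = unif I := by rw [← Finset.mul_sum, sum_prod_unif, mul_one]

open Classical in
theorem sum_prod_unif_mul_not_injective_le :
    ∑ r : ι → Bits I, (∏ _i : ι, unif I) * (if Function.Injective r then 0 else 1)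
      ≤ (Fintype.card ι * Fintype.card ι : ℕ) * unif I := by
  have hunion (r : ι → Bits I) : (if Function.Injective r then (0 : ℝ) else 1) ≤
      ∑ p ∈ (Finset.univ : Finset ι).offDiag, if r p.1 = r p.2 then 1 else 0 := by
    have hnonneg (p : ι × ι) : (0 : ℝ) ≤ if r p.1 = r p.2 then 1 else 0 := by
      split_ifs <;> norm_num
    split_ifs with hr
    · exact Finset.sum_nonneg fun p _ => hnonneg p
    · obtain ⟨j, j', heq, hne⟩ := Function.not_injective_iff.1 hr
      exact (by simp [heq] : (1 : ℝ) ≤ if r j = r j' then 1 else 0).trans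
        (Finset.single_le_sum (a := (j, j'))
          (f := fun p : ι × ι => if r p.1 = r p.2 then (1 : ℝ) else 0)
          (fun p _ => hnonneg p)
          (Finset.mem_offDiag.2 ⟨Finset.mem_univ j, Finset.mem_univ j', hne⟩))
  calc ∑ r : ι → Bits I, (∏ _i : ι, unif I) * (if Function.Injective r then (0 : ℝ) else 1)
      ≤ ∑ r : ι → Bits I, (∏ _i : ι, unif I) *
          ∑ p ∈ (Finset.univ : Finset ι).offDiag, if r p.1 = r p.2 then 1 else 0 :=
        Finset.sum_le_sum fun r _ => mul_le_mul_of_nonneg_left (hunion r)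
          (Finset.prod_nonneg fun _ _ => unif_nonneg I)
    _ = ∑ _p ∈ (Finset.univ : Finset ι).offDiag, unif I := by
        simp_rw [Finset.mul_sum]
        rw [Finset.sum_comm]
        exact Finset.sum_congr rfl fun p hp => sum_prod_unif_mul_eq (Finset.mem_offDiag.1 hp).2.2
    _ ≤ (Fintype.card ι * Fintype.card ι : ℕ) * unif I := by
        rw [Finset.sum_const, nsmul_eq_mul, Finset.offDiag_card]
        exact mul_le_mul_of_nonneg_right (by exact_mod_cast Nat.sub_le _ _) (unif_nonneg I)

end Collision

section Ciphertexts

variable {m ℓ : ℕ → ℕ} {F : KeyedFun m ℓ} {n : ℕ} {ι : Type} [Fintype ι]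

theorem sum_prod_pushforward_mul {α β R : Type*} [DecidableEq ι] [Fintype α] [Fintype β]
    [DecidableEq β] [CommSemiring R] (w : α → R) (φ : ι → α → β) (h : (ι → β) → R) :
    ∑ c, (∏ j, ∑ a, w a * if c j = φ j a then 1 else 0) * h c =
      ∑ a : ι → α, (∏ j, w (a j)) * h fun j => φ j (a j) := by
  simp_rw [← sum_prod_apply fun j a => w a * if _ = φ j a then 1 else 0, Finset.prod_mul_distrib,
    Finset.prod_ite_zero, Finset.sum_mul]
  rw [Finset.sum_comm]
  refine Finset.sum_congr rfl fun a _ => ?_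
  simp [← funext_iff]

/-- The joint distribution of the values of `F` on the inputs `r` under one uniform key, each
evaluated with fresh randomness. -/
def outDist (F : KeyedFun m ℓ) (n : ℕ) (r : ι → Bits (Fin (m n))) (Y : ι → Bits (Fin (ℓ n))) : ℝ :=
  ∑ k : Bits (Fin n), unif (Fin n) * ∏ j, F n k (r j) (Y j)

theorem outDist_nonneg (hF : F.QPT) (r : ι → Bits (Fin (m n))) (Y : ι → Bits (Fin (ℓ n))) :
    0 ≤ outDist F n r Y :=
  Finset.sum_nonneg fun _ _ => mul_nonneg (unif_nonneg _) <|
    Finset.prod_nonneg fun _ _ => hF.nonneg _ _ _ _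

variable [DecidableEq ι]

theorem sum_outDist (hF : F.QPT) (r : ι → Bits (Fin (m n))) : ∑ Y, outDist F n r Y = 1 := by
  have hkey (k : Bits (Fin n)) : ∑ Y : ι → Bits (Fin (ℓ n)), ∏ j, F n k (r j) (Y j) = 1 := by
    rw [sum_prod_apply fun j y => F n k (r j) y]
    simp [hF.sum_eq_one]
  simp only [outDist]
  rw [Finset.sum_comm]
  exact (Finset.sum_congr rfl fun k _ => by rw [← Finset.mul_sum, hkey, mul_one]).trans (sum_unif _)

/-- The ciphertexts of the messages `msg` with nonces `r` and values `Y` of `F`, where `Y i j` is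
the value under block `i` of the key on the nonce of message `j`. -/
def ciphertexts (r : ι → Bits (Fin (m n))) (msg : ι → Bits (Fin (ℓ n)))
    (Y : Fin n → ι → Bits (Fin (ℓ n))) : Bits (ι × CtReg m ℓ n) :=
  fun p => (mkCt (r p.1) fun i => xorBits (msg p.1) (Y i p.1) : Bits (CtReg m ℓ n)) p.2

theorem sum_prod_enc_mul (k : Bits (KeyReg n)) (msg : ι → Bits (Fin (ℓ n)))
    (h : Bits (ι × CtReg m ℓ n) → ℝ) :
    ∑ c : ι → Bits (CtReg m ℓ n), (∏ j, (ske F).Enc n k (msg j) (c j)) * h (fun p => c p.1 p.2) =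
    ∑ r : ι → Bits (Fin (m n)), (∏ _j : ι, unif (Fin (m n))) *
      ∑ Y : Fin n → ι → Bits (Fin (ℓ n)), (∏ i, ∏ j, F n (fun t => k (i, t)) (r j) (Y i j)) *
        h (ciphertexts r msg Y) := by
  have hEnc (j : ι) (c : Bits (CtReg m ℓ n)) : (ske F).Enc n k (msg j) c =
      ∑ a : Bits (Fin (m n)) × (Fin n → Bits (Fin (ℓ n))),
        (unif (Fin (m n)) * ∏ i, F n (fun t => k (i, t)) a.1 (a.2 i)) *
          if c = mkCt a.1 (fun i => xorBits (msg j) (a.2 i)) then 1 else 0 := by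
    simp only [ske, Fintype.sum_prod_type, Finset.mul_sum, mul_assoc]
  simp_rw [hEnc]
  rw [sum_prod_pushforward_mul _
    (fun j (a : Bits (Fin (m n)) × (Fin n → Bits (Fin (ℓ n)))) =>
      (mkCt a.1 fun i => xorBits (msg j) (a.2 i) : Bits (CtReg m ℓ n)))
    fun c => h fun p => c p.1 p.2]
  simp_rw [Finset.prod_mul_distrib, Finset.mul_sum, Finset.prod_comm (γ := Fin n)]
  rw [← Fintype.sum_prod_type']
  refine Fintype.sum_equiv ((Equiv.arrowProdEquivProdArrow ι _ _).trans
    (.prodCongr (.refl _) (Equiv.piComm fun _ _ => Bits (Fin (ℓ n))))) _ _ fun a => ?_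
  rw [mul_assoc]
  rfl

theorem sum_key_enc_mul (msg : ι → Bits (Fin (ℓ n))) (h : Bits (ι × CtReg m ℓ n) → ℝ) :
    ∑ k : Bits (KeyReg n), unif (KeyReg n) * ∑ c : ι → Bits (CtReg m ℓ n),
      (∏ j, (ske F).Enc n k (msg j) (c j)) * h (fun p => c p.1 p.2) =
    ∑ r : ι → Bits (Fin (m n)), (∏ _j : ι, unif (Fin (m n))) *
      ∑ Y : Fin n → ι → Bits (Fin (ℓ n)), (∏ i, outDist F n r (Y i)) *
        h (ciphertexts r msg Y) := by
  have hkey (r : ι → Bits (Fin (m n))) (Y : Fin n → ι → Bits (Fin (ℓ n))) :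
      ∏ i, outDist F n r (Y i) = ∑ k : Bits (KeyReg n), unif (KeyReg n) *
        ∏ i, ∏ j, F n (fun t => k (i, t)) (r j) (Y i j) :=
    (sum_unif_mul_prod fun i k => ∏ j, F n k (r j) (Y i j)).symm
  simp_rw [sum_prod_enc_mul, hkey, Finset.sum_mul, Finset.mul_sum]
  rw [Finset.sum_comm]
  refine Finset.sum_congr rfl fun r _ => ?_
  rw [Finset.sum_comm]
  exact Finset.sum_congr rfl fun Y _ => Finset.sum_congr rfl fun k _ => by ring

end Ciphertexts

section Experiment

variable {m ℓ q : ℕ → ℕ} {F : KeyedFun m ℓ}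
  (A : CPAAdversary q (fun n => Fin (ℓ n)) (CtReg m ℓ)) (n : ℕ)

/-- The memory that the adversary keeps after choosing the messages `msgs`, with trace the
probability of that choice. -/
def memState (msgs : Bits (Fin (q n) × Bool × Fin (ℓ n))) : Op (Fin (A.memLen n)) :=
  afterOutcome ((A.choose n).run (A.advice n)) msgs

/-- The probability that the adversary chooses the messages `msgs`. -/
def msgsProb (msgs : Bits (Fin (q n) × Bool × Fin (ℓ n))) : ℝ := (memState A n msgs).trace.re

/-- The joint probability of choosing `msgs` and then guessing `b` on the ciphertexts `c`. -/
def guessProb (b : Bool) (msgs : Bits (Fin (q n) × Bool × Fin (ℓ n)))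
    (c : Bits (Fin (q n) × CtReg m ℓ n)) : ℝ :=
  measure ((A.guess n).run (tensor (memState A n msgs) (ket c))) fun _ => b

theorem memState_posSemidef (msgs : Bits (Fin (q n) × Bool × Fin (ℓ n))) :
    (memState A n msgs).PosSemidef :=
  afterOutcome_posSemidef ((A.choose n).run_posSemidef (A.isDensity n).posSemidef) msgs

theorem msgsProb_nonneg (msgs : Bits (Fin (q n) × Bool × Fin (ℓ n))) : 0 ≤ msgsProb A n msgs :=
  (Complex.le_def.1 (memState_posSemidef A n msgs).trace_nonneg).1

theorem memState_trace (msgs : Bits (Fin (q n) × Bool × Fin (ℓ n))) :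
    (memState A n msgs).trace = (msgsProb A n msgs : ℂ) :=
  Complex.ext rfl (Complex.le_def.1 (memState_posSemidef A n msgs).trace_nonneg).2.symm

theorem sum_msgsProb : ∑ msgs, msgsProb A n msgs = 1 := by
  simp only [msgsProb, memState]
  rw [← Complex.re_sum, sum_afterOutcome_trace, Circuit.run_trace, (A.isDensity n).trace_eq_one,
    Complex.one_re]

theorem guessProb_nonneg (b : Bool) (msgs : Bits (Fin (q n) × Bool × Fin (ℓ n)))
    (c : Bits (Fin (q n) × CtReg m ℓ n)) : 0 ≤ guessProb A n b msgs c :=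
  measure_nonneg ((A.guess n).run_posSemidef
    (tensor_ket_posSemidef (memState_posSemidef A n msgs) c)) _

theorem guessProb_true_add_false (msgs : Bits (Fin (q n) × Bool × Fin (ℓ n)))
    (c : Bits (Fin (q n) × CtReg m ℓ n)) :
    guessProb A n true msgs c + guessProb A n false msgs c = msgsProb A n msgs := by
  rw [msgsProb, ← tensor_ket_trace (memState A n msgs) c, ← (A.guess n).run_trace, ← sum_measure,
    ← (Equiv.funUnique Unit Bool).symm.sum_comp, Fintype.sum_bool]
  rfl

theorem guessProb_le (b : Bool) (msgs : Bits (Fin (q n) × Bool × Fin (ℓ n)))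
    (c : Bits (Fin (q n) × CtReg m ℓ n)) : guessProb A n b msgs c ≤ msgsProb A n msgs := by
  have hadd := guessProb_true_add_false A n msgs c
  have htrue := guessProb_nonneg A n true msgs c
  have hfalse := guessProb_nonneg A n false msgs c
  cases b <;> linarith

/-- The joint probability of choosing `msgs` and then guessing `b` when the `b`-messages are
encrypted with nonces `r` and the values under each block of the key are drawn from `D`. -/
def winWith (D : (Fin (q n) → Bits (Fin (ℓ n))) → ℝ) (b : Bool)
    (msgs : Bits (Fin (q n) × Bool × Fin (ℓ n))) (r : Fin (q n) → Bits (Fin (m n))) : ℝ :=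
  ∑ Y : Fin n → Fin (q n) → Bits (Fin (ℓ n)), (∏ i, D (Y i)) *
    guessProb A n b msgs (ciphertexts r (fun j t => msgs (j, b, t)) Y)

/-- The probability of guessing the challenge bit when the nonces are `r` and the values under each
block of the key are drawn from `D`. -/
def winProb (D : (Fin (q n) → Bits (Fin (ℓ n))) → ℝ) (r : Fin (q n) → Bits (Fin (m n))) : ℝ :=
  ∑ b : Bool, (1 / 2) * ∑ msgs, winWith A n D b msgs r

theorem cpaWin_eq : (ske F).cpaWin A n =
    ∑ r, (∏ _j : Fin (q n), unif (Fin (m n))) * winProb A n (outDist F n r) r := by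
  simp only [winProb, Finset.mul_sum (s := (Finset.univ : Finset Bool)),
    mul_left_comm (∏ _j : Fin (q n), unif (Fin (m n))) (1 / 2)]
  rw [Finset.sum_comm]
  refine Finset.sum_congr rfl fun b _ => ?_
  rw [← Finset.mul_sum]
  simp only [Finset.mul_sum (s := (Finset.univ : Finset (Bits (Fin (q n) × Bool × Fin (ℓ n)))))]
  rw [Finset.sum_comm, Finset.sum_comm (s := (Finset.univ : Finset (Fin (q n) → _)))]
  exact congrArg _ <| Finset.sum_congr rfl fun msgs _ =>
    sum_key_enc_mul (fun j t => msgs (j, b, t)) (guessProb A n b msgs)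

/-- The uniform distribution on lists of `Q` strings of length `L`. -/
def unifDist (Q L : ℕ) (_Y : Fin Q → Bits (Fin L)) : ℝ := ∏ _j : Fin Q, unif (Fin L)

theorem unifDist_nonneg (Q L : ℕ) (Y : Fin Q → Bits (Fin L)) : 0 ≤ unifDist Q L Y :=
  Finset.prod_nonneg fun _ _ => unif_nonneg _

theorem sum_unifDist (Q L : ℕ) : ∑ Y, unifDist Q L Y = 1 := sum_prod_unif (Fin Q) (Fin L)

theorem ciphertexts_eq_ciphertexts_zero {ι : Type} (r : ι → Bits (Fin (m n)))
    (msg : ι → Bits (Fin (ℓ n))) (Y : Fin n → ι → Bits (Fin (ℓ n))) :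
    ciphertexts r msg Y = ciphertexts r (fun _ _ => false) fun i j => xorBits (msg j) (Y i j) := by
  ext ⟨j, t | ⟨i, t⟩⟩
  · rfl
  · exact (Bool.false_xor _).symm

theorem winWith_unif (b : Bool) (msgs : Bits (Fin (q n) × Bool × Fin (ℓ n)))
    (r : Fin (q n) → Bits (Fin (m n))) :
    winWith A n (unifDist (q n) (ℓ n)) b msgs r =
      ∑ Y : Fin n → Fin (q n) → Bits (Fin (ℓ n)), (∏ i, unifDist (q n) (ℓ n) (Y i)) *
        guessProb A n b msgs (ciphertexts r (fun _ _ => false) Y) := by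
  have hinv : Function.Involutive fun (Y : Fin n → Fin (q n) → Bits (Fin (ℓ n))) i j =>
      xorBits (fun t => msgs (j, b, t)) (Y i j) := fun Y => by
    ext i j t
    simp [xorBits]
  simp only [winWith, ciphertexts_eq_ciphertexts_zero n r fun j t => msgs (j, b, t)]
  exact Equiv.sum_comp hinv.toPerm fun Y => (∏ i, unifDist (q n) (ℓ n) (Y i)) *
    guessProb A n b msgs (ciphertexts r (fun _ _ => false) Y)

theorem winProb_unif (r : Fin (q n) → Bits (Fin (m n))) :
    winProb A n (unifDist (q n) (ℓ n)) r = 1 / 2 := by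
  have hmsgs (msgs : Bits (Fin (q n) × Bool × Fin (ℓ n))) :
      ∑ b : Bool, winWith A n (unifDist (q n) (ℓ n)) b msgs r = msgsProb A n msgs := by
    rw [Fintype.sum_bool, winWith_unif, winWith_unif, ← Finset.sum_add_distrib]
    simp_rw [← mul_add, guessProb_true_add_false]
    rw [← Finset.sum_mul, sum_prod_apply fun _ => unifDist (q n) (ℓ n), sum_unifDist,
      Finset.prod_const_one, one_mul]
  rw [winProb, ← Finset.mul_sum, Finset.sum_comm, Finset.sum_congr rfl fun msgs _ => hmsgs msgs,
    sum_msgsProb, mul_one]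

variable {n} {D D' : (Fin (q n) → Bits (Fin (ℓ n))) → ℝ}

theorem winWith_nonneg (hD : ∀ Y, 0 ≤ D Y) (b : Bool)
    (msgs : Bits (Fin (q n) × Bool × Fin (ℓ n))) (r : Fin (q n) → Bits (Fin (m n))) :
    0 ≤ winWith A n D b msgs r :=
  Finset.sum_nonneg fun _ _ =>
    mul_nonneg (Finset.prod_nonneg fun _ _ => hD _) (guessProb_nonneg A n _ _ _)

theorem winWith_le (hD : ∀ Y, 0 ≤ D Y) (hD1 : ∑ Y, D Y = 1) (b : Bool)
    (msgs : Bits (Fin (q n) × Bool × Fin (ℓ n))) (r : Fin (q n) → Bits (Fin (m n))) :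
    winWith A n D b msgs r ≤ msgsProb A n msgs :=
  calc winWith A n D b msgs r
      ≤ ∑ Y : Fin n → Fin (q n) → Bits (Fin (ℓ n)), (∏ i, D (Y i)) * msgsProb A n msgs :=
        Finset.sum_le_sum fun Y _ => mul_le_mul_of_nonneg_left (guessProb_le A n _ _ _)
          (Finset.prod_nonneg fun _ _ => hD _)
    _ = msgsProb A n msgs := by
        rw [← Finset.sum_mul, sum_prod_apply fun _ => D, hD1, Finset.prod_const_one, one_mul]

theorem abs_winProb_sub_le {B : ℝ} {r : Fin (q n) → Bits (Fin (m n))}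
    (h : ∀ b msgs, |winWith A n D b msgs r - winWith A n D' b msgs r| ≤ B * msgsProb A n msgs) :
    |winProb A n D r - winProb A n D' r| ≤ B := by
  have hb (b : Bool) :
      |∑ msgs, winWith A n D b msgs r - ∑ msgs, winWith A n D' b msgs r| ≤ B := by
    rw [← Finset.sum_sub_distrib]
    exact (Finset.abs_sum_le_sum_abs _ _).trans ((Finset.sum_le_sum fun msgs _ => h b msgs).trans
      (by rw [← Finset.mul_sum, sum_msgsProb, mul_one]))
  simp only [winProb]
  rw [← Finset.sum_sub_distrib]
  simp_rw [← mul_sub]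
  exact abs_sum_mul_le (fun _ => by norm_num) (by norm_num) hb

end Experiment

section Distinguisher

variable {m ℓ q : ℕ → ℕ} {n : ℕ}

/-- The positions of the nonces and of block `i` among the ciphertexts. -/
def viewEmb (m ℓ q : ℕ → ℕ) (i : Fin n) : KeyedFun.ViewReg m ℓ q n ↪ Fin (q n) × CtReg m ℓ n where
  toFun := Sum.elim (fun p => (p.1, .inl p.2)) fun p => (p.1, .inr (i, p.2))
  inj' := by
    rintro (⟨j, t⟩ | ⟨j, t⟩) (⟨j', t'⟩ | ⟨j', t'⟩) h <;> simp_all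

/-- The ciphertexts with nonces `r` and block `i` equal to `Z`, all other blocks being zero, after
adding `mask`. -/
def simulated (i : Fin n) (r : Fin (q n) → Bits (Fin (m n)))
    (mask : Bits (Fin (q n) × CtReg m ℓ n)) (Z : Fin (q n) → Bits (Fin (ℓ n))) :
    Bits (Fin (q n) × CtReg m ℓ n) :=
  xorBits (Function.extend (viewEmb m ℓ q i) (KeyedFun.view r Z) fun _ => false) mask

/-- The mask that turns the values of block `i` into ciphertexts of the messages `msg`, when the
other blocks have the values `Y`. -/
def hybridMask (i : Fin n) (msg : Fin (q n) → Bits (Fin (ℓ n)))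
    (Y : Fin n → Fin (q n) → Bits (Fin (ℓ n))) : Bits (Fin (q n) × CtReg m ℓ n) :=
  ciphertexts (fun _ _ => false) msg (Function.update Y i fun _ _ => false)

theorem simulated_hybridMask (i : Fin n) (r : Fin (q n) → Bits (Fin (m n)))
    (msg : Fin (q n) → Bits (Fin (ℓ n))) (Y : Fin n → Fin (q n) → Bits (Fin (ℓ n)))
    (Z : Fin (q n) → Bits (Fin (ℓ n))) :
    simulated i r (hybridMask i msg Y) Z = ciphertexts r msg (Function.update Y i Z) := by
  have hview (s : KeyedFun.ViewReg m ℓ q n) :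
      Function.extend (viewEmb m ℓ q i) (KeyedFun.view r Z) (fun _ => false) (viewEmb m ℓ q i s) =
        KeyedFun.view r Z s :=
    (viewEmb m ℓ q i).injective.extend_apply _ _ _
  ext ⟨j, t | ⟨i', t⟩⟩
  · change xor _ false = r j t
    rw [Bool.xor_false]
    exact hview (.inl (j, t))
  · change xor _ (xor (msg j t) (Function.update Y i (fun _ _ => false) i' j t)) =
      xor (msg j t) (Function.update Y i Z i' j t)
    by_cases hi : i' = i
    · subst hi
      rw [Function.update_self, Function.update_self, Bool.xor_false, Bool.xor_comm]
      exact congrArg _ (hview (.inr (j, t)))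
    · rw [Function.extend_apply', Function.update_of_ne hi, Function.update_of_ne hi,
        Bool.false_xor]
      rintro ⟨s | s, hs⟩
      · cases congrArg Prod.snd hs
      · exact hi (congrArg Prod.fst (Sum.inr_injective (congrArg Prod.snd hs))).symm

/-- A circuit without gates that ignores its input. -/
abbrev constCircuit (I : Type) [Fintype I] [DecidableEq I] : Circuit I Unit where
  Wire := I ⊕ Unit
  gates := []
  inp := .inl
  out := .inr

theorem constCircuit_size (I : Type) [Fintype I] [DecidableEq I] :
    (constCircuit I).size = 2 * (Fintype.card I + 1) := by
  change 0 + Fintype.card (I ⊕ Unit) + Fintype.card (I ⊕ Unit) = _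
  rw [Fintype.card_sum, Fintype.card_unit]
  ring

variable (A : CPAAdversary q (fun n => Fin (ℓ n)) (CtReg m ℓ))

theorem isDensity_ket {I : Type} [Fintype I] [DecidableEq I] (x : Bits I) : IsDensity (ket x) :=
  ⟨ket_posSemidef x, ket_trace x⟩

theorem isDensity_memState {msgs : Bits (Fin (q n) × Bool × Fin (ℓ n))}
    (h : msgsProb A n msgs ≠ 0) :
    IsDensity ((((msgsProb A n msgs)⁻¹ : ℝ) : ℂ) • memState A n msgs) where
  posSemidef := (memState_posSemidef A n msgs).smul
    (by exact_mod_cast inv_nonneg.2 (msgsProb_nonneg A n msgs))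
  trace_eq_one := by
    rw [Matrix.trace_smul, memState_trace, smul_eq_mul, ← Complex.ofReal_mul, inv_mul_cancel₀ h,
      Complex.ofReal_one]

theorem polyBounded_memLen : PolyBounded A.memLen :=
  A.guess_polySize.mono fun n => by
    have h := Fintype.card_le_of_embedding (A.guess n).inp
    simp only [Fintype.card_sum, Fintype.card_fin] at h
    simp only [Circuit.size]
    lia

/-- What is fixed in one hybrid step: the block whose values are replaced, the messages chosen by
the adversary, the nonces, and the mask added to the challenge. -/
structure HybridChoice (n : ℕ) where
  block : Fin n
  msgs : Bits (Fin (q n) × Bool × Fin (ℓ n))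
  nonces : Fin (q n) → Bits (Fin (m n))
  mask : Bits (Fin (q n) × CtReg m ℓ n)
  msgsProb_ne_zero : msgsProb A n msgs ≠ 0
  nonces_injective : Function.Injective nonces

instance : Finite (HybridChoice A n) :=
  Finite.of_injective (fun a => (a.block, a.msgs, a.nonces, a.mask)) fun a a' h => by
    cases a
    cases a'
    simp_all

/-- The distinguisher that gets the normalized memory of the adversary as advice and runs the
adversary on the simulated ciphertexts. -/
def hybridDistinguisher (hm : PolyBounded m) (hℓ : PolyBounded ℓ) (hq : PolyBounded q)
    (c : ∀ n, Option (HybridChoice A n)) : Distinguisher (KeyedFun.ViewReg m ℓ q) where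
  advLen := A.memLen
  circuit n := (c n).elim (constCircuit _) fun a =>
    (A.guess n).maskInput a.mask (viewEmb m ℓ q a.block)
  advice n := (c n).elim (ket fun _ => false) fun a =>
    (((msgsProb A n a.msgs)⁻¹ : ℝ) : ℂ) • memState A n a.msgs
  polySize := by
    refine (((PolyBounded.const 2).mul (((polyBounded_memLen A).add ((hq.mul hm).add
      (hq.mul hℓ))).add (.const 1))).add ((PolyBounded.const 7).mul A.guess_polySize)).mono
      fun n => ?_
    cases c n with
    | none =>
      have hsize := constCircuit_size (Fin (A.memLen n) ⊕ KeyedFun.ViewReg m ℓ q n)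
      simp only [Fintype.card_sum, Fintype.card_prod, Fintype.card_fin] at hsize
      exact hsize.le.trans (Nat.le_add_right _ _)
    | some a => exact ((A.guess n).maskInput_size a.mask (viewEmb m ℓ q a.block)).trans (by simp)
  isDensity n := by
    cases c n with
    | none => exact isDensity_ket _
    | some a => exact isDensity_memState A a.msgsProb_ne_zero

theorem hybridDistinguisher_accept (hm : PolyBounded m) (hℓ : PolyBounded ℓ) (hq : PolyBounded q)
    {c : ∀ n, Option (HybridChoice A n)} {a : HybridChoice A n} (hc : c n = some a)
    (Z : Fin (q n) → Bits (Fin (ℓ n))) :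
    (hybridDistinguisher A hm hℓ hq c).accept n (KeyedFun.view a.nonces Z) =
      (msgsProb A n a.msgs)⁻¹ *
        guessProb A n true a.msgs (simulated a.block a.nonces a.mask Z) := by
  have hrun : (hybridDistinguisher A hm hℓ hq c).accept n (KeyedFun.view a.nonces Z) =
      measure (((A.guess n).maskInput a.mask (viewEmb m ℓ q a.block)).run
        (tensor ((((msgsProb A n a.msgs)⁻¹ : ℝ) : ℂ) • memState A n a.msgs)
          (ket (KeyedFun.view a.nonces Z)))) fun _ => true := by
    simp only [Distinguisher.accept, hybridDistinguisher]
    rw [hc]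
    rfl
  rw [hrun, Circuit.maskInput_run, tensor_smul, Circuit.run_smul, measure_smul]
  rfl

end Distinguisher

section Security

variable {m ℓ q : ℕ → ℕ} {F : KeyedFun m ℓ}
  (A : CPAAdversary q (fun n => Fin (ℓ n)) (CtReg m ℓ)) {n : ℕ}

/-- The difference between the acceptance probabilities of the distinguisher for the choice `a` on
values of `F` and on uniform strings. -/
def hybridGap (F : KeyedFun m ℓ) (a : HybridChoice A n) : ℝ :=
  |∑ Z, (outDist F n a.nonces Z - unifDist (q n) (ℓ n) Z) * ((msgsProb A n a.msgs)⁻¹ *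
    guessProb A n true a.msgs (simulated a.block a.nonces a.mask Z))|

theorem exists_hybridGap_le (hF : F.IsSelectivelySecureQPRF) (hq : PolyBounded q) :
    ∃ δ, Negligible δ ∧ (∀ n, 0 ≤ δ n) ∧ ∀ n a, hybridGap A (n := n) F a ≤ δ n := by
  have hm := hF.qpt.polyBounded_inputLen
  have hℓ := hF.qpt.polyBounded_outputLen
  refine exists_negligible_of_families _ fun c => ?_
  obtain ⟨ε, hε, hle⟩ := hF.selectivelySecure q hq (hybridDistinguisher A hm hℓ hq c) fun n =>
    (c n).elim (fun _ _ => false) HybridChoice.nonces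
  refine ⟨ε, hε, fun n a ha => ?_⟩
  have hgap := hle n
  rw [ha] at hgap
  convert hgap a.nonces_injective using 1
  simp only [hybridGap, Option.elim_some, KeyedFun.realAccept, KeyedFun.idealAccept, outDist,
    unifDist, hybridDistinguisher_accept A hm hℓ hq ha, sub_mul, Finset.sum_sub_distrib,
    Finset.sum_mul, Finset.mul_sum, mul_assoc]
  rw [Finset.sum_comm]

variable {msgs : Bits (Fin (q n) × Bool × Fin (ℓ n))} {r : Fin (q n) → Bits (Fin (m n))} {δ : ℝ}

theorem abs_hybrid_step_true_le (hδ : ∀ a, hybridGap A (n := n) F a ≤ δ)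
    (hmsgs : msgsProb A n msgs ≠ 0) (hr : Function.Injective r)
    (msg : Fin (q n) → Bits (Fin (ℓ n))) (i : Fin n) (Y : Fin n → Fin (q n) → Bits (Fin (ℓ n))) :
    |∑ Z, (outDist F n r Z - unifDist (q n) (ℓ n) Z) *
      guessProb A n true msgs (ciphertexts r msg (Function.update Y i Z))|
        ≤ δ * msgsProb A n msgs := by
  have hpos : 0 < msgsProb A n msgs := (msgsProb_nonneg A n msgs).lt_of_ne' hmsgs
  have hgap := hδ ⟨i, msgs, r, hybridMask i msg Y, hmsgs, hr⟩
  simp only [hybridGap, simulated_hybridMask, mul_left_comm _ (msgsProb A n msgs)⁻¹] at hgap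
  rwa [← Finset.mul_sum, abs_mul, abs_of_pos (inv_pos.2 hpos), inv_mul_le_iff₀' hpos] at hgap

theorem hybrid_step_false_eq_neg (hF : F.QPT) (c : (Fin (q n) → Bits (Fin (ℓ n))) →
    Bits (Fin (q n) × CtReg m ℓ n)) :
    ∑ Z, (outDist F n r Z - unifDist (q n) (ℓ n) Z) * guessProb A n false msgs (c Z) =
      -∑ Z, (outDist F n r Z - unifDist (q n) (ℓ n) Z) * guessProb A n true msgs (c Z) := by
  have hmass : ∑ Z, (outDist F n r Z - unifDist (q n) (ℓ n) Z) = 0 := by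
    rw [Finset.sum_sub_distrib, sum_outDist hF, sum_unifDist, sub_self]
  rw [eq_neg_iff_add_eq_zero, add_comm, ← Finset.sum_add_distrib]
  simp_rw [← mul_add, guessProb_true_add_false]
  rw [← Finset.sum_mul, hmass, zero_mul]

theorem abs_hybrid_step_le (hF : F.QPT) (hδ : ∀ a, hybridGap A (n := n) F a ≤ δ) (b : Bool)
    (hr : Function.Injective r) (msg : Fin (q n) → Bits (Fin (ℓ n))) (i : Fin n)
    (Y : Fin n → Fin (q n) → Bits (Fin (ℓ n))) :
    |∑ Z, (outDist F n r Z - unifDist (q n) (ℓ n) Z) *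
      guessProb A n b msgs (ciphertexts r msg (Function.update Y i Z))|
        ≤ δ * msgsProb A n msgs := by
  by_cases hmsgs : msgsProb A n msgs = 0
  · have hguess (c) : guessProb A n b msgs c = 0 :=
      le_antisymm (hmsgs ▸ guessProb_le A n b msgs c) (guessProb_nonneg A n b msgs c)
    simp [hguess, hmsgs]
  · have htrue := abs_hybrid_step_true_le A hδ hmsgs hr msg i Y
    cases b with
    | true => exact htrue
    | false => rwa [hybrid_step_false_eq_neg A hF, abs_neg]

theorem abs_winWith_sub_le (hF : F.QPT) (hδ : ∀ a, hybridGap A (n := n) F a ≤ δ) (b : Bool)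
    (hr : Function.Injective r) :
    |winWith A n (outDist F n r) b msgs r - winWith A n (unifDist (q n) (ℓ n)) b msgs r|
      ≤ n * (δ * msgsProb A n msgs) := by
  rw [winWith, winWith, ← Finset.sum_sub_distrib]
  simp_rw [← sub_mul]
  exact abs_sum_prod_sub_prod_le (outDist_nonneg hF r) (unifDist_nonneg _ _) (sum_outDist hF r)
    (sum_unifDist _ _) _ fun i Y => abs_hybrid_step_le A hF hδ b hr _ i Y

open Classical in
theorem abs_winProb_sub_half_le (hF : F.QPT) (h0 : 0 ≤ δ)
    (hδ : ∀ a, hybridGap A (n := n) F a ≤ δ) (r : Fin (q n) → Bits (Fin (m n))) :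
    |winProb A n (outDist F n r) r - 1 / 2| ≤ n * δ + if Function.Injective r then 0 else 1 := by
  rw [← winProb_unif A n r]
  refine abs_winProb_sub_le A fun b msgs => ?_
  split_ifs with hr
  · rw [add_zero, mul_assoc]
    exact abs_winWith_sub_le A hF hδ b hr
  · have hδmsgs : 0 ≤ n * δ * msgsProb A n msgs :=
      mul_nonneg (mul_nonneg n.cast_nonneg h0) (msgsProb_nonneg A n msgs)
    have hreal := winWith_nonneg A (outDist_nonneg hF r) b msgs r
    have hreal' := winWith_le A (outDist_nonneg hF r) (sum_outDist hF r) b msgs r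
    have hideal := winWith_nonneg A (unifDist_nonneg _ _) b msgs r
    have hideal' := winWith_le A (unifDist_nonneg _ _) (sum_unifDist _ _) b msgs r
    rw [abs_le]
    constructor <;> linarith

theorem abs_cpaWin_sub_half_le (hF : F.QPT) (h0 : 0 ≤ δ)
    (hδ : ∀ a, hybridGap A (n := n) F a ≤ δ) :
    |(ske F).cpaWin A n - 1 / 2| ≤ n * δ + (q n * q n : ℕ) * unif (Fin (m n)) := by
  classical
  let w (_ : Fin (q n) → Bits (Fin (m n))) : ℝ := ∏ _j : Fin (q n), unif (Fin (m n))
  have hw (r) : 0 ≤ w r := Finset.prod_nonneg fun _ _ => unif_nonneg _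
  have hw1 : ∑ r, w r = 1 := sum_prod_unif (Fin (q n)) (Fin (m n))
  calc |(ske F).cpaWin A n - 1 / 2|
      = |∑ r, w r * (winProb A n (outDist F n r) r - 1 / 2)| := by
        simp_rw [mul_sub]
        rw [cpaWin_eq, Finset.sum_sub_distrib, ← Finset.sum_mul, hw1, one_mul]
    _ ≤ ∑ r, w r * (n * δ + if Function.Injective r then 0 else 1) := by
        refine (Finset.abs_sum_le_sum_abs _ _).trans (Finset.sum_le_sum fun r _ => ?_)
        rw [abs_mul, abs_of_nonneg (hw r)]
        exact mul_le_mul_of_nonneg_left (abs_winProb_sub_half_le A hF h0 hδ r) (hw r)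
    _ = n * δ + ∑ r, w r * if Function.Injective r then 0 else 1 := by
        simp_rw [mul_add]
        rw [Finset.sum_add_distrib, ← Finset.sum_mul, hw1, one_mul]
    _ ≤ n * δ + (q n * q n : ℕ) * unif (Fin (m n)) := by
        simpa only [Fintype.card_fin] using
          add_le_add_right (sum_prod_unif_mul_not_injective_le (ι := Fin (q n))) _

theorem ske_secure (hF : F.IsSelectivelySecureQPRF)
    (hm : (fun n : ℕ => Real.log n) =o[atTop] fun n : ℕ => (m n : ℝ)) :
    (ske F).NonAdaptiveCPASecure := by
  intro q hq A
  obtain ⟨δ, hδ, h0, hle⟩ := exists_hybridGap_le A hF hq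
  exact ⟨_, (hδ.polyBounded_mul .id).add ((negligible_unif hm).polyBounded_mul (hq.mul hq)),
    fun n => abs_cpaWin_sub_half_le A hF.qpt (h0 n) (hle n)⟩

end Security

end QCrypto

end

theorem mainTheorem8 (m ℓ : ℕ → ℕ) (F : QCrypto.KeyedFun m ℓ)
    (hF : F.IsSelectivelySecureQPRF)
    (hm : (fun n : ℕ => Real.log n) =o[Filter.atTop] fun n : ℕ => (m n : ℝ)) :
    (QCrypto.ske F).IsNonAdaptiveCPASecureEncryption :=
  ⟨QCrypto.ske_qpt hF.qpt, QCrypto.ske_correct hF.qpt hF.pseudodeterministic,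
    QCrypto.ske_secure hF hm⟩
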